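/- **Setting.** Let $(\theta_j)_{j\ge1}$, $(\kappa_j)_{j\ge1}$ be non-negative real sequences such that $(\kappa_j)$ is non-arithmetic (there is no integer $j_0>1$ dividing every $j$ with $\kappa_j\ne0$) and $\kappa_j>0$ for some $j\ge2$. For a permutation $\sigma$ of $\{1,\dots,N\}$ let $C_j(\sigma)$ be the number of its cycles of length $j$, and let $$\tilde{\mathbb P}_N(\sigma)=\frac1{N!\,H_N}\prod_{j=1}^N(\theta_j+N\kappa_j)^{C_j(\sigma)},\qquad H_N=\frac1{N!}\sum_{\sigma}\prod_{j=1}^N(\theta_j+N\kappa_j)^{C_j(\sigma)} ,$$ which is defined whenever $H_N>0$. Let $L_1(\sigma)$ be the length of the cycle containing $1$, $L_2(\sigma)$ the length of the cycle containing the smallest element not in the first cycle, and so on ($L_j=0$ if there are fewer than $j$ cycles). For a function $g$ write $g^{\{n\}}(z)=z^n\,\frac{d^n g}{dz^n}(z)$, and $g^{\{n\}}(R)=\lim_{r\uparrow R}g^{\{n\}}(r)$. For $R,\eta>0$, $\varphi\in(0,\pi/2)$ put $\Delta_0=\{z\in\mathbb C:|z|<R|1+\eta e^{i\varphi}|,\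 z\ne R,\ |\arg(z-R)|>\varphi\}$. **Assumptions.** The power series $g_\theta(z)=\sum_{j\ge1}\frac{\theta_j}{j}z^j$ and $g_\kappa(z)=\sum_{j\ge1}\frac{\kappa_j}{j}z^j$ both have radius of convergence $R\in(0,\infty)$ and extend holomorphically to a domain $\Delta_0=\Delta_0(R,\eta,\varphi)$; $g_\kappa^{\{1\}}(R)<1$ (supercritical case); and for some $\theta^*>0$, $\delta>0$, as $z\to R$ in $\Delta_0$, $$g_\theta(z)=-\theta^*\log(1-z/R)+O\big((1-z/R)^{\delta}\big),\qquad g_\kappa(z)=g_\kappa(R)-g_\kappa^{\{1\}}(R)(1-z/R)+O\big((1-z/R)^{1+\delta}\big).$$ There are a non-integer $s>1$ with $g_\kappa^{\{n\}}(R)<\infty$ for $n<s$ and $g_\kappa^{\{n\}}(R)=\infty$ for $n>s$, a real constant $a_s\neq0$ and numbers $\delta_n>0$ such that, as $z\to R$ in $\Delta_0$, $$g_\kappa^{\{n\}}(z)=g_\kappa^{\{n\}}(R)\{1+O((1-z/R)^{\delta_n})\}\quad(0\le n<s),$$ $$g_\kappa^{\{n\}}(z)=\frac{\Gamma(-s+n)\,a_s}{\Gamma(-s)}(1-z/R)^{s-n}\{1+O((1-z/R)^{\delta_n})\}\quad(n>s),$$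 $$g_\theta^{\{n\}}(z)=\frac{\theta^*(n-1)!}{(1-z/R)^n}\{1+O((1-z/R)^{\delta_n})\}\quad(n\ge1).$$ **Modified stick-breaking process.** Let $\tilde\nu=1-g_\kappa^{\{1\}}(R)$. Let $(U_n)_{n\ge1}$ be uniform on $[0,1]$, $(B_n)_{n\ge1}$ have the $\mathrm{Beta}(1,\theta^*)$ distribution, all these variables being independent. Put $\eta_0=1$ and, for $n\ge1$, $$\xi_n=\mathbf 1\Big\{U_n\le\frac{\tilde\nu\,\eta_{n-1}}{1-\tilde\nu+\tilde\nu\,\eta_{n-1}}\Big\},\quad D_n=\xi_nB_n,\quad \eta_n=\prod_{j=1}^n(1-D_j),\quad X_n=\eta_{n-1}D_n .$$ **Theorem.** Under these assumptions $H_N>0$ for all sufficiently large $N$; $\tilde\nu>0$ is the limiting expected fraction of points in long cycles, $$\tilde\nu=\lim_{K\to\infty}\liminf_{N\to\infty}\frac1N\,\tilde{\mathbb E}_N\Big[\sum_{j>K}jC_j\Big];$$ and for each $m$, under $\tilde{\mathbb P}_N$, $$\frac1{N\tilde\nu}(L_1,\dots,L_m)\xrightarrow{\ d\ }(X_1,\dots,X_m),\qquad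 N\to\infty .$$ In particular, $L_1/(N\tilde\nu)$ converges in distribution to $X_1$, whose law is the sum of an atom of mass $1-\tilde\nu$ at $0$ and an absolutely continuous part on $(0,1)$ with density $\tilde\nu\,\theta^*(1-x)^{\theta^*-1}$. -/

import Mathlib

open MeasureTheory ProbabilityTheory Filter Topology Asymptotics Set
open scoped NNReal ENNReal

noncomputable section

namespace SurrogateSpatial

/-! ### The surrogate-spatial measure on permutations

Sequences indexed by the positive integers are functions on `ℕ` whose value at `0` is never used. -/

/-- Permutations of a finite set carry the discrete σ-algebra. -/
instance instMeasurableSpacePerm (N : ℕ) : MeasurableSpace (Equiv.Perm (Fin N)) := ⊤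

/-- The cycle count `C_j(σ)`: the number of cycles of length `j` in the cycle decomposition of `σ`,
fixed points being cycles of length one. -/
def cycleCount {N : ℕ} (σ : Equiv.Perm (Fin N)) (j : ℕ) : ℕ := σ.partition.parts.count j

/-- The product `∏_{j=1}^N (θ_j + N κ_j)^{C_j(σ)}`. -/
def weight (θ κ : ℕ → ℝ≥0) (N : ℕ) (σ : Equiv.Perm (Fin N)) : ℝ≥0 :=
  ∏ j ∈ Finset.Icc 1 N, (θ j + N * κ j) ^ cycleCount σ j

/-- The normalization constant `H_N`. -/
def normConst (θ κ : ℕ → ℝ≥0) (N : ℕ) : ℝ≥0 :=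
  (∑ σ : Equiv.Perm (Fin N), weight θ κ N σ) / (N.factorial : ℝ≥0)

open Classical in
/-- The surrogate-spatial measure on the permutations of `N` elements, which gives `σ` the mass
`weight σ / (N! H_N)`. It makes sense only if `H_N ≠ 0`; for other `N` the point mass at
the identity is used as a placeholder, so that the object is a probability measure for all `N`. -/
def surrogateMeasure (θ κ : ℕ → ℝ≥0) (N : ℕ) : Measure (Equiv.Perm (Fin N)) :=
  if normConst θ κ N = 0 then Measure.dirac 1
  else ∑ σ : Equiv.Perm (Fin N),
    ((weight θ κ N σ / ((N.factorial : ℝ≥0) * normConst θ κ N) : ℝ≥0) : ℝ≥0∞) • Measure.dirac σ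

instance instIsProbabilityMeasureSurrogate (θ κ : ℕ → ℝ≥0) (N : ℕ) :
    IsProbabilityMeasure (surrogateMeasure θ κ N) := by
  unfold surrogateMeasure
  split_ifs with h
  · infer_instance
  · constructor
    have hN : (N.factorial : ℝ≥0) ≠ 0 := by exact_mod_cast Nat.factorial_ne_zero N
    have hS : (N.factorial : ℝ≥0) * normConst θ κ N = ∑ σ : Equiv.Perm (Fin N), weight θ κ N σ := by
      unfold normConst
      field_simp
    simp only [Measure.coe_finsetSum, Finset.sum_apply, Measure.smul_apply, measure_univ,
      smul_eq_mul, mul_one]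
    rw [← ENNReal.ofNNReal_finsetSum, ← Finset.sum_div, ← hS, div_self (mul_ne_zero hN h)]
    rfl

/-! ### Lexicographically ordered cycle lengths -/

open Classical in
/-- The set of elements of the cycle of `σ` that contains `i`. -/
def cycleSet {N : ℕ} (σ : Equiv.Perm (Fin N)) (i : Fin N) : Finset (Fin N) :=
  Finset.univ.filter fun k => σ.SameCycle i k

/-- The union of the first `n` cycles of `σ`, where every new cycle is the one that contains
the smallest element not in the previous cycles. -/
def firstCycles {N : ℕ} (σ : Equiv.Perm (Fin N)) : ℕ → Finset (Fin N)
  | 0 => ∅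
  | n + 1 =>
    if h : (firstCycles σ n)ᶜ.Nonempty then
      firstCycles σ n ∪ cycleSet σ ((firstCycles σ n)ᶜ.min' h)
    else firstCycles σ n

/-- `lexLength σ n` is the length `L_{n+1}(σ)` of the cycle number `n + 1` of `σ` in the
lexicographic order: the cycle containing the smallest element not in the first `n` cycles.
It is `0` if `σ` has at most `n` cycles. -/
def lexLength {N : ℕ} (σ : Equiv.Perm (Fin N)) (n : ℕ) : ℕ :=
  if h : (firstCycles σ n)ᶜ.Nonempty then (cycleSet σ ((firstCycles σ n)ᶜ.min' h)).card else 0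

/-! ### The expected fraction of points in long cycles -/

/-- `ν̃_K = liminf_N N⁻¹ E_N[∑_{j > K} j C_j]`. -/
def longFraction (θ κ : ℕ → ℝ≥0) (K : ℕ) : ℝ :=
  liminf (fun N : ℕ => (1 / (N : ℝ)) *
    ∫ σ, (∑ j ∈ Finset.Ioc K N, (j : ℝ) * (cycleCount σ j : ℝ)) ∂(surrogateMeasure θ κ N)) atTop

/-! ### Generating functions -/

/-- The power series `∑_{j ≥ 1} (a_j / j) z^j` (its coefficient at `j = 0` is `a 0 / 0 = 0`). -/
def genSeries (a : ℕ → ℝ≥0) : FormalMultilinearSeries ℂ ℂ ℂ :=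
  FormalMultilinearSeries.ofScalars ℂ fun j : ℕ => (((a j : ℝ) / (j : ℝ) : ℝ) : ℂ)

/-- The modified derivative `g^{n}(z) = z^n (d/dz)^n g(z)`. -/
def modDeriv (g : ℂ → ℂ) (n : ℕ) (z : ℂ) : ℂ := z ^ n * iteratedDeriv n g z

/-- The domain `Δ₀(R, η, φ)`. -/
def domainDelta (R η φ : ℝ) : Set ℂ :=
  {z : ℂ | ‖z‖ < ‖(R : ℂ) * (1 + η * Complex.exp (φ * Complex.I))‖ ∧ z ≠ R ∧
    φ < |Complex.arg (z - R)|}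

/-! ### The modified stick-breaking process

For given values `u n = U_{n+1}` and `b n = B_{n+1}` of the driving variables. -/

/-- `u*(x) = ν x / (1 - ν + ν x)`. -/
def uStar (ν x : ℝ) : ℝ := ν * x / (1 - ν + ν * x)

/-- `D = ξ B`, where `ξ` is the indicator of `U ≤ u*(x)` and `x` is the previous `η`. -/
def stickD (ν x u b : ℝ) : ℝ := (if u ≤ uStar ν x then 1 else 0) * b

/-- `η_0 = 1`, `η_n = η_{n-1} (1 - D_n)`. -/
def stickEta (ν : ℝ) (u b : ℕ → ℝ) : ℕ → ℝ
  | 0 => 1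
  | n + 1 => stickEta ν u b n * (1 - stickD ν (stickEta ν u b n) (u n) (b n))

/-- `stickX ν u b n` is `X_{n+1} = η_n D_{n+1}`. -/
def stickX (ν : ℝ) (u b : ℕ → ℝ) (n : ℕ) : ℝ :=
  stickEta ν u b n * stickD ν (stickEta ν u b n) (u n) (b n)

end SurrogateSpatial

end

open SurrogateSpatial

/-!
With `T_j = θ_j R^j` and `K_j = κ_j R^j`, the singularity at `R` gives `T_j → θ*` at a polynomial
rate, `K_j = O(j^{-s})` and `∑ K_j = g_κ^{1}(R) = c < 1`. By the exponential formula `R^n H_n` is a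
coefficient of `exp (∑ (T_j / j) z^j) exp (N ∑ (K_j / j) z^j)`. Up to normalization the second
factor is the law of a sum of `N` independent compound Poisson variables with mean `c`, which
concentrates at `c N` and has only large deviations of probability `o(1/N)` by one big jump; the
coefficients of the first factor grow like `n^{θ* - 1}`. Hence the coefficient of `z^n` behaves like
`(n - c N)^{θ* - 1}` for `n / N → c + (1 - c) x`, and ratios of such coefficients are the
probabilities that the cycle of a given element has length `l`: for fixed `l` they carry the mass
`c / (c + (1 - c) x)`, for `l` of order `N` a beta density.

Removing the cycle of the smallest element leaves the same problem with fewer elements and with the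
same weights, so Fatou's lemma along the recursion bounds the lower limits of the integrals of
nonnegative functions of the cycle lengths by those of the stick-breaking process. Since both laws
have mass one, the lower bounds are enough for convergence in distribution.
-/

namespace SurrogateSpatial

section Transfer

/-! ### Coefficients of functions with one singularity on the circle of convergence -/

theorem isBigO_principal_of_forall_nhdsWithin {X E F : Type*} [TopologicalSpace X] [Norm E]
    [SeminormedAddCommGroup F] {f : X → E} {g : X → F} {K S : Set X} (hK : IsCompact K)
    (hSK : S ⊆ K) (h : ∀ x ∈ K, f =O[𝓝[S] x] g) : f =O[𝓟 S] g := by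
  suffices f =O[𝓟 (K ∩ S)] g by rwa [inter_eq_right.2 hSK] at this
  refine hK.induction_on (p := fun t => f =O[𝓟 (t ∩ S)] g) (by simp)
    (fun t t' htt' ht' => ht'.mono (principal_mono.2 (inter_subset_inter_left S htt')))
    (fun t t' ht ht' => ?_) fun x hx => ?_
  · rw [union_inter_distrib_right, ← sup_principal]
    exact ht.sup ht'
  · obtain ⟨C, hC⟩ := (h x hx).bound
    rw [eventually_nhdsWithin_iff] at hC
    exact ⟨_, mem_nhdsWithin_of_mem_nhds hC,
      isBigO_principal.2 ⟨C, fun y hy => hy.1 hy.2⟩⟩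

theorem one_sub_div_ne_zero {R : ℝ} {z : ℂ} (hR : 0 < R) (hz : z ≠ R) : 1 - z / R ≠ 0 := by
  rw [sub_ne_zero, ne_comm, Ne, div_eq_one_iff_eq (Complex.ofReal_ne_zero.2 hR.ne')]
  exact hz

theorem ne_ofReal_of_norm_lt {R : ℝ} {z : ℂ} (hz : ‖z‖ < R) : z ≠ R := by
  rintro rfl
  rw [Complex.norm_real] at hz
  exact (le_abs_self R).not_gt hz

theorem isBigO_principal_ball_of_nhdsWithin {F : ℂ → ℂ} {R β : ℝ} (hR : 0 < R)
    (hF : ContinuousOn F (Metric.closedBall 0 R \ {(R : ℂ)}))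
    (hO : F =O[𝓝[Metric.ball 0 R] (R : ℂ)] fun z => ‖1 - z / R‖ ^ β) :
    F =O[𝓟 (Metric.ball 0 R)] fun z : ℂ => ‖1 - z / R‖ ^ β := by
  refine isBigO_principal_of_forall_nhdsWithin (isCompact_closedBall (0 : ℂ) R)
    Metric.ball_subset_closedBall fun z hz => ?_
  rcases eq_or_ne z R with rfl | hzR
  · exact hO
  have hpos : 0 < ‖1 - z / R‖ := norm_pos_iff.2 (one_sub_div_ne_zero hR hzR)
  have hball : Metric.ball (0 : ℂ) R ⊆ Metric.closedBall 0 R \ {(R : ℂ)} := fun w hw =>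
    ⟨Metric.ball_subset_closedBall hw, ne_ofReal_of_norm_lt (mem_ball_zero_iff.1 hw)⟩
  have hF1 : F =O[𝓝[Metric.ball 0 R] z] fun _ => (1 : ℝ) :=
    ((hF z ⟨hz, hzR⟩).mono hball).tendsto.isBigO_one ℝ
  have hg : ContinuousAt (fun w : ℂ => ‖1 - w / R‖ ^ β) z :=
    ContinuousAt.rpow_const (by fun_prop) (Or.inl hpos.ne')
  refine hF1.trans ((isBigO_const_left_iff_pos_le_norm one_ne_zero).2
    ⟨‖1 - z / R‖ ^ β / 2, by positivity, ?_⟩)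
  filter_upwards [nhdsWithin_le_nhds (hg.eventually_const_lt (half_lt_self (by positivity)))]
    with w hw
  exact hw.le.trans (le_abs_self _)

/-- The average of the Poisson kernel of the circle with radius `r` at the point `r² / R`. -/
theorem circleAverage_inv_norm_one_sub_div_sq {r R : ℝ} (hr : 0 < r) (hrR : r < R) :
    Real.circleAverage (fun z : ℂ => (‖1 - z / R‖ ^ 2)⁻¹) 0 r = (1 - (r / R) ^ 2)⁻¹ := by
  have hR : 0 < R := hr.trans hrR
  have hRC : (R : ℂ) ≠ 0 := Complex.ofReal_ne_zero.2 hR.ne'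
  have hw : ‖((r ^ 2 / R : ℝ) : ℂ)‖ = r ^ 2 / R := by
    rw [Complex.norm_real, Real.norm_of_nonneg (by positivity)]
  have hwr : ((r ^ 2 / R : ℝ) : ℂ) ∈ Metric.ball (0 : ℂ) r := by
    rw [mem_ball_zero_iff, hw, div_lt_iff₀ hR]
    nlinarith
  have hkernel : EqOn (poissonKernel 0 ((r ^ 2 / R : ℝ) : ℂ) • fun _ => (1 : ℝ))
      ((1 - (r / R) ^ 2) • fun z : ℂ => (‖1 - z / R‖ ^ 2)⁻¹) (Metric.sphere 0 |r|) := by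
    intro z hz
    have hzr : ‖z‖ = r := by rwa [mem_sphere_zero_iff_norm, abs_of_pos hr] at hz
    have hdist : ‖z - ((r ^ 2 / R : ℝ) : ℂ)‖ = r * ‖1 - z / R‖ := by
      have hconj : z - ((r ^ 2 / R : ℝ) : ℂ) = z * (starRingEnd ℂ) (1 - z / R) := by
        have hzz := Complex.mul_conj z
        rw [Complex.normSq_eq_norm_sq, hzr] at hzz
        simp only [map_sub, map_one, map_div₀, Complex.conj_ofReal, mul_sub, mul_one]
        rw [mul_div_assoc', hzz]
        push_cast
        rfl
      rw [hconj, norm_mul, Complex.norm_conj, hzr]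
    simp only [Pi.smul_apply', Pi.smul_apply, poissonKernel_def, sub_zero, smul_eq_mul, mul_one,
      hzr, hw, hdist]
    field_simp
  have hmean := InnerProductSpace.HarmonicContOnCl.circleAverage_poissonKernel_smul
    (InnerProductSpace.harmonicContOnCl_const (c := (1 : ℝ))) hwr
  rw [Real.circleAverage_congr_sphere hkernel, Real.circleAverage_smul, smul_eq_mul] at hmean
  exact eq_inv_of_mul_eq_one_right hmean

theorem hasFPowerSeriesOnBall_ofScalars {F : ℂ → ℂ} {a : ℕ → ℂ} {R : ℝ} (hR : 0 < R)
    (ha : ∀ z, ‖z‖ < R → HasSum (fun j => a j * z ^ j) (F z)) :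
    HasFPowerSeriesOnBall F (FormalMultilinearSeries.ofScalars ℂ a) 0 (ENNReal.ofReal R) := by
  refine ⟨ENNReal.le_of_forall_nnreal_lt fun ρ hρ => ?_, ENNReal.ofReal_pos.2 hR, fun {z} hz => ?_⟩
  · refine FormalMultilinearSeries.le_radius_of_tendsto _ (l := 0) ?_
    have := (ha ρ (by simpa [ENNReal.lt_ofReal_iff_toReal_lt] using hρ)).summable
      |>.tendsto_atTop_zero.norm
    simpa [FormalMultilinearSeries.ofScalars_norm] using this
  · rw [Metric.eball_ofReal, mem_ball_zero_iff] at hz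
    simpa [FormalMultilinearSeries.ofScalars_apply_eq', mul_comm] using ha z hz

theorem norm_coeff_mul_pow_le_circleAverage {F : ℂ → ℂ} {a : ℕ → ℂ} {r R : ℝ} (hr : 0 < r)
    (hrR : r < R) (ha : ∀ z, ‖z‖ < R → HasSum (fun j => a j * z ^ j) (F z)) (n : ℕ) :
    ‖a n‖ * r ^ n ≤ Real.circleAverage (fun z => ‖F z‖) 0 r := by
  lift r to ℝ≥0 using hr.le
  have hF := hasFPowerSeriesOnBall_ofScalars (hr.trans hrR) ha
  have hdiff : DifferentiableOn ℂ F (Metric.closedBall 0 r) :=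
    hF.differentiableOn.mono fun z hz => by
      rw [Metric.eball_ofReal]
      exact Metric.closedBall_subset_ball hrR hz
  have heq := (hdiff.hasFPowerSeriesOnBall (by exact_mod_cast hr)).hasFPowerSeriesAt
    |>.eq_formalMultilinearSeries hF.hasFPowerSeriesAt
  have hle := norm_cauchyPowerSeries_le F 0 r n
  rw [heq, FormalMultilinearSeries.ofScalars_norm, abs_of_pos hr, inv_pow,
    ← div_eq_mul_inv, le_div_iff₀ (by positivity)] at hle
  rwa [Real.circleAverage_def, smul_eq_mul]

theorem le_mul_inv_norm_one_sub_div_sq {r R A x β : ℝ} {z : ℂ} (hrR : r < R) (hβ : 2 ≤ β)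
    (hA : 0 ≤ A) (hz : ‖z‖ = r) (hx : x ≤ A * ‖1 - z / R‖ ^ (-β)) :
    x ≤ A * (1 - r / R) ^ (2 - β) * (‖1 - z / R‖ ^ 2)⁻¹ := by
  have hR : 0 < R := (hz ▸ norm_nonneg z).trans_lt hrR
  have hρ : 0 < 1 - r / R := sub_pos.2 ((div_lt_one hR).2 hrR)
  have hdist : 1 - r / R ≤ ‖1 - z / R‖ := by
    have := norm_sub_norm_le (1 : ℂ) (z / R)
    rwa [norm_one, norm_div, Complex.norm_real, hz, Real.norm_of_nonneg hR.le] at this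
  have hpos : 0 < ‖1 - z / R‖ := hρ.trans_le hdist
  calc x ≤ A * ‖1 - z / R‖ ^ (-β) := hx
    _ = A * (‖1 - z / R‖ ^ (2 - β) * (‖1 - z / R‖ ^ 2)⁻¹) := by
      rw [← Real.rpow_natCast, ← Real.rpow_neg hpos.le, ← Real.rpow_add hpos]
      congr 2
      push_cast
      ring
    _ ≤ A * ((1 - r / R) ^ (2 - β) * (‖1 - z / R‖ ^ 2)⁻¹) := by
      have := Real.rpow_le_rpow_of_nonpos hρ hdist (sub_nonpos.2 hβ)
      gcongr
    _ = _ := (mul_assoc _ _ _).symm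

theorem circleAverage_norm_le_rpow {F : ℂ → ℂ} {r R A β : ℝ} (hr : 0 < r) (hrR : r < R)
    (hβ : 2 ≤ β) (hF : ContinuousOn F (Metric.ball 0 R))
    (hA : ∀ z, ‖z‖ < R → ‖F z‖ ≤ A * ‖1 - z / R‖ ^ (-β)) :
    Real.circleAverage (fun z => ‖F z‖) 0 r ≤ A * (1 - r / R) ^ (1 - β) := by
  have hR : 0 < R := hr.trans hrR
  have hρ : 0 < 1 - r / R := sub_pos.2 ((div_lt_one hR).2 hrR)
  have hA0 : 0 ≤ A := by simpa using (norm_nonneg _).trans (hA 0 (by simpa using hR))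
  have hsphere : ∀ z ∈ Metric.sphere (0 : ℂ) |r|, ‖z‖ = r := fun z hz => by
    rwa [mem_sphere_zero_iff_norm, abs_of_pos hr] at hz
  have hne : ∀ z ∈ Metric.sphere (0 : ℂ) |r|, 1 - z / R ≠ 0 := fun z hz =>
    one_sub_div_ne_zero hR (ne_ofReal_of_norm_lt ((hsphere z hz).trans_lt hrR))
  have hbound : ∀ z ∈ Metric.sphere (0 : ℂ) |r|,
      ‖F z‖ ≤ A * (1 - r / R) ^ (2 - β) * (‖1 - z / R‖ ^ 2)⁻¹ := fun z hz =>
    le_mul_inv_norm_one_sub_div_sq hrR hβ hA0 (hsphere z hz) (hA z ((hsphere z hz).trans_lt hrR))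
  have hFint : CircleIntegrable (fun z => ‖F z‖) 0 r :=
    (hF.norm.mono fun z hz => mem_ball_zero_iff.2 (by
      rw [mem_sphere_zero_iff_norm] at hz; exact hz.trans_lt hrR)).circleIntegrable hr.le
  have hkint : CircleIntegrable
      ((A * (1 - r / R) ^ (2 - β)) • fun z : ℂ => (‖1 - z / R‖ ^ 2)⁻¹) 0 r := by
    refine ContinuousOn.circleIntegrable' (ContinuousOn.const_smul (ContinuousOn.inv₀ ?_ ?_) _)
    · fun_prop
    · exact fun z hz => pow_ne_zero _ (norm_ne_zero_iff.2 (hne z hz))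
  calc Real.circleAverage (fun z => ‖F z‖) 0 r
      ≤ A * (1 - r / R) ^ (2 - β) * (1 - (r / R) ^ 2)⁻¹ := by
        rw [← circleAverage_inv_norm_one_sub_div_sq hr hrR, ← smul_eq_mul (A * _),
          ← Real.circleAverage_smul]
        exact Real.circleAverage_mono hFint hkint hbound
    _ ≤ A * (1 - r / R) ^ (2 - β) * (1 - r / R)⁻¹ := by
        gcongr
        nlinarith [div_pos hr hR]
    _ = A * (1 - r / R) ^ (1 - β) := by
        rw [mul_assoc, ← Real.rpow_neg_one, ← Real.rpow_add hρ]
        ring_nf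

theorem isBigO_norm_coeff_of_isBigO_nhdsWithin {F : ℂ → ℂ} {a : ℕ → ℂ} {R β : ℝ} (hR : 0 < R)
    (hβ : 2 ≤ β) (hF : ContinuousOn F (Metric.closedBall 0 R \ {(R : ℂ)}))
    (hO : F =O[𝓝[Metric.ball 0 R] (R : ℂ)] fun z => ‖1 - z / R‖ ^ (-β))
    (ha : ∀ z, ‖z‖ < R → HasSum (fun j => a j * z ^ j) (F z)) :
    (fun j => ‖a j‖ * R ^ j) =O[atTop] fun j => (j : ℝ) ^ (β - 1) := by
  obtain ⟨A, hA⟩ := isBigO_principal.1 (isBigO_principal_ball_of_nhdsWithin hR hF hO)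
  have hA' : ∀ z : ℂ, ‖z‖ < R → ‖F z‖ ≤ A * ‖1 - z / R‖ ^ (-β) := fun z hz => by
    simpa only [Real.norm_of_nonneg (Real.rpow_nonneg (norm_nonneg _) _)] using
      hA z (mem_ball_zero_iff.2 hz)
  have hFball : ContinuousOn F (Metric.ball 0 R) := hF.mono fun z hz =>
    ⟨Metric.ball_subset_closedBall hz, ne_ofReal_of_norm_lt (mem_ball_zero_iff.1 hz)⟩
  refine IsBigO.of_bound (A * 2 ^ (β - 1) * Real.exp 1) ?_
  filter_upwards [eventually_ge_atTop 1] with j hj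
  have hj0 : (1 : ℝ) ≤ j := by exact_mod_cast hj
  -- Cauchy's bound on the circle with radius `R / (1 + 1 / j)`; note `(1 + 1 / j) ^ j ≤ e`
  set q : ℝ := 1 + (j : ℝ)⁻¹ with hq
  have hq1 : 1 < q := lt_add_of_pos_right 1 (by positivity)
  have hcauchy : ‖a j‖ * (R * q⁻¹) ^ j ≤ A * (1 - R * q⁻¹ / R) ^ (1 - β) :=
    have hlt : R * q⁻¹ < R := mul_lt_of_lt_one_right hR (inv_lt_one_of_one_lt₀ hq1)
    (norm_coeff_mul_pow_le_circleAverage (by positivity) hlt ha j).trans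
      (circleAverage_norm_le_rpow (by positivity) hlt hβ hFball hA')
  have hdist : 1 - R * q⁻¹ / R = ((j : ℝ) + 1)⁻¹ := by
    rw [hq]
    field_simp
    ring
  have hA0 : 0 ≤ A := by simpa using (norm_nonneg _).trans (hA' 0 (by simpa using hR))
  have hgrowth : ((j : ℝ) + 1) ^ (β - 1) ≤ 2 ^ (β - 1) * (j : ℝ) ^ (β - 1) := by
    rw [← Real.mul_rpow (by norm_num) (by positivity)]
    exact Real.rpow_le_rpow (by positivity) (by linarith) (by linarith)
  rw [hdist, Real.inv_rpow (by positivity), ← Real.rpow_neg (by positivity), neg_sub] at hcauchy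
  rw [Real.norm_of_nonneg (by positivity), Real.norm_of_nonneg (by positivity)]
  calc ‖a j‖ * R ^ j = ‖a j‖ * (R * q⁻¹) ^ j * q ^ j := by
        rw [mul_pow, inv_pow]
        field_simp
    _ ≤ A * (2 ^ (β - 1) * (j : ℝ) ^ (β - 1)) * Real.exp 1 := by
        exact mul_le_mul (hcauchy.trans (by gcongr)) Real.one_add_inv_pow_le_exp (by positivity)
          (by positivity)
    _ = _ := by ring

end Transfer

section ModDeriv

theorem differentiableOn_iteratedDeriv {f : ℂ → ℂ} {V : Set ℂ} (hV : IsOpen V)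
    (hf : DifferentiableOn ℂ f V) (n : ℕ) : DifferentiableOn ℂ (iteratedDeriv n f) V := by
  induction n with
  | zero => rwa [iteratedDeriv_zero]
  | succ n ih =>
    rw [iteratedDeriv_succ]
    exact ih.deriv hV

theorem continuousOn_modDeriv {f : ℂ → ℂ} {V : Set ℂ} (hV : IsOpen V)
    (hf : DifferentiableOn ℂ f V) (n : ℕ) : ContinuousOn (modDeriv f n) V :=
  (continuous_id.pow n).continuousOn.mul (differentiableOn_iteratedDeriv hV hf n).continuousOn

theorem iteratedDeriv_zero_eq_factorial_mul {F : ℂ → ℂ} {a : ℕ → ℂ} {R : ℝ} (hR : 0 < R)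
    (ha : ∀ z, ‖z‖ < R → HasSum (fun j => a j * z ^ j) (F z)) (n : ℕ) :
    iteratedDeriv n F 0 = n.factorial * a n := by
  rw [iteratedDeriv_eq_iteratedFDeriv,
    ← (hasFPowerSeriesOnBall_ofScalars hR ha).factorial_smul 1 n]
  simp

theorem hasSum_modDeriv {F : ℂ → ℂ} {a : ℕ → ℂ} {R : ℝ}
    (ha : ∀ z, ‖z‖ < R → HasSum (fun j => a j * z ^ j) (F z)) (n : ℕ) {z : ℂ} (hz : ‖z‖ < R) :
    HasSum (fun j => j.descFactorial n * a j * z ^ j) (modDeriv F n z) := by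
  have hR : 0 < R := (norm_nonneg z).trans_lt hz
  have hdiff : DifferentiableOn ℂ F (Metric.ball 0 R) := by
    have := (hasFPowerSeriesOnBall_ofScalars hR ha).differentiableOn
    rwa [Metric.eball_ofReal] at this
  have htaylor := (Complex.hasSum_taylorSeries_on_ball
    (differentiableOn_iteratedDeriv Metric.isOpen_ball hdiff n)
    (mem_ball_zero_iff.2 hz)).mul_left (z ^ n)
  have hshift : HasSum (fun k => ((k + n).descFactorial n : ℂ) * a (k + n) * z ^ (k + n))
      (modDeriv F n z) := by
    refine htaylor.congr_fun fun k => ?_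
    have hfac : ((k + n).factorial : ℂ) = k.factorial * (k + n).descFactorial n := by
      have := Nat.factorial_mul_descFactorial (Nat.le_add_left n k)
      rw [Nat.add_sub_cancel] at this
      exact_mod_cast this.symm
    have hk : (k.factorial : ℂ) ≠ 0 := Nat.cast_ne_zero.2 k.factorial_ne_zero
    rw [iteratedDeriv_eq_iterate, iteratedDeriv_eq_iterate, ← Function.iterate_add_apply,
      ← iteratedDeriv_eq_iterate, iteratedDeriv_zero_eq_factorial_mul hR ha, hfac]
    simp only [smul_eq_mul, sub_zero, pow_add]
    field_simp
  refine (hasSum_nat_add_iff' n).1 ?_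
  rwa [Finset.sum_eq_zero, sub_zero]
  intro j hj
  rw [Nat.descFactorial_eq_zero_iff_lt.2 (Finset.mem_range.1 hj), Nat.cast_zero, zero_mul, zero_mul]

theorem hasSum_of_eq_genSeries_sum {a : ℕ → ℝ≥0} {R : ℝ} {g : ℂ → ℂ}
    (hrad : ENNReal.ofReal R ≤ (genSeries a).radius)
    (hg : ∀ z : ℂ, ‖z‖ < R → g z = (genSeries a).sum z) {z : ℂ} (hz : ‖z‖ < R) :
    HasSum (fun j : ℕ => (a j / j : ℂ) * z ^ j) (g z) := by
  have hz' : z ∈ Metric.eball (0 : ℂ) (genSeries a).radius :=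
    Metric.eball_subset_eball hrad (by rwa [Metric.eball_ofReal, mem_ball_zero_iff])
  rw [hg z hz]
  refine ((genSeries a).hasSum hz').congr_fun fun j => ?_
  simp [genSeries, mul_comm]

theorem closedBall_diff_subset_interior_domainDelta {R η φ : ℝ} (hR : 0 < R) (hη : 0 < η)
    (hφ : 0 < φ) (hφ' : φ < Real.pi / 2) :
    Metric.closedBall 0 R \ {(R : ℂ)} ⊆ interior (domainDelta R η φ) := by
  have hopen : IsOpen
      {z : ℂ | ‖z‖ < ‖(R : ℂ) * (1 + η * Complex.exp (φ * Complex.I))‖ ∧ z.re < R} :=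
    (isOpen_lt continuous_norm continuous_const).inter
      (isOpen_lt Complex.continuous_re continuous_const)
  refine Subset.trans ?_ (interior_maximal (fun z hz => ⟨hz.1, ?_, hφ'.trans ?_⟩) hopen)
  · rintro z ⟨hzR, hne⟩
    rw [mem_closedBall_zero_iff] at hzR
    refine ⟨hzR.trans_lt ?_, ((Complex.re_le_norm z).trans hzR).lt_of_ne fun hre => hne ?_⟩
    · have hcos : 0 < Real.cos φ := Real.cos_pos_of_mem_Ioo ⟨by linarith, hφ'⟩
      have hone : 1 < ‖(1 + η * Complex.exp (φ * Complex.I) : ℂ)‖ := by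
        refine lt_of_lt_of_le ?_ (Complex.re_le_norm _)
        simpa [Complex.exp_re] using mul_pos hη hcos
      rw [norm_mul, Complex.norm_real, Real.norm_of_nonneg hR.le]
      exact lt_mul_of_one_lt_right hR hone
    · have hnorm : ‖z‖ = z.re := le_antisymm (hzR.trans hre.ge) (Complex.re_le_norm z)
      have him : z.im = 0 := Complex.re_eq_norm.1 hnorm.symm |>.2.symm
      exact Complex.ext hre (by simpa using him)
  · rintro rfl
    exact lt_irrefl _ hz.2
  · rw [← not_le, Complex.abs_arg_le_pi_div_two_iff, not_le, Complex.sub_re, Complex.ofReal_re]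
    exact sub_neg.2 hz.2

end ModDeriv

section Scaled

/-- The sequence `a_j R^j`, `j ≥ 1`, which turns the generating functions into series with radius
of convergence `1`; the unused value `a 0` is replaced by `0`. -/
noncomputable def scaled (a : ℕ → ℝ≥0) (R : ℝ) (j : ℕ) : ℝ :=
  if j = 0 then 0 else a j * R ^ j

variable {a : ℕ → ℝ≥0} {R : ℝ}

theorem scaled_of_ne_zero {j : ℕ} (hj : j ≠ 0) : scaled a R j = a j * R ^ j := if_neg hj

theorem scaled_zero : scaled a R 0 = 0 := if_pos rfl

theorem scaled_nonneg (hR : 0 ≤ R) (j : ℕ) : 0 ≤ scaled a R j := by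
  unfold scaled
  split_ifs <;> positivity

theorem pow_le_two_pow_mul_descFactorial {j n : ℕ} (h : 2 * n ≤ j) :
    j ^ n ≤ 2 ^ n * j.descFactorial n :=
  calc j ^ n ≤ (2 * (j + 1 - n)) ^ n := by gcongr; omega
    _ = 2 ^ n * (j + 1 - n) ^ n := mul_pow _ _ _
    _ ≤ _ := by gcongr; exact Nat.pow_sub_le_descFactorial j n

theorem isBigO_scaled_of_isBigO_modDeriv {g : ℂ → ℂ} {n : ℕ} {s : ℝ} (hR : 0 < R) (hn : s + 2 ≤ n)
    (ha : ∀ z : ℂ, ‖z‖ < R → HasSum (fun j : ℕ => (a j / j : ℂ) * z ^ j) (g z))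
    (hg : ContinuousOn (modDeriv g n) (Metric.closedBall 0 R \ {(R : ℂ)}))
    (hO : modDeriv g n =O[𝓝[Metric.ball 0 R] (R : ℂ)] fun z => ‖1 - z / R‖ ^ (s - n)) :
    scaled a R =O[atTop] fun j => (j : ℝ) ^ (-s) := by
  have hcoeff := isBigO_norm_coeff_of_isBigO_nhdsWithin (β := n - s) hR (by linarith) hg
    (by simpa only [neg_sub] using hO) fun z hz => hasSum_modDeriv ha n hz
  have hbound : scaled a R =O[atTop] fun j : ℕ =>
      (j : ℝ) ^ (1 - n : ℝ) * (‖(j.descFactorial n : ℂ) * (a j / j)‖ * R ^ j) := by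
    refine IsBigO.of_bound (2 ^ n) ?_
    filter_upwards [eventually_ge_atTop (2 * n), eventually_ge_atTop 1] with j hjn hj
    have hj0 : (0 : ℝ) < j := by exact_mod_cast hj
    have hdesc : (j : ℝ) ^ n ≤ 2 ^ n * j.descFactorial n := by
      exact_mod_cast pow_le_two_pow_mul_descFactorial hjn
    rw [Real.norm_of_nonneg (scaled_nonneg hR.le j), Real.norm_of_nonneg (by positivity),
      scaled_of_ne_zero (by omega), norm_mul, norm_div, Complex.norm_natCast, Complex.norm_natCast,
      Complex.norm_of_nonneg (a j).coe_nonneg, Real.rpow_sub hj0, Real.rpow_one, Real.rpow_natCast]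
    calc (a j : ℝ) * R ^ j = (j / j ^ n) * (j ^ n * (a j / j) * R ^ j) := by field_simp
      _ ≤ (j / j ^ n) * (2 ^ n * j.descFactorial n * (a j / j) * R ^ j) := by gcongr
      _ = _ := by ring
  refine (hbound.trans ((isBigO_refl _ _).mul hcoeff)).congr' EventuallyEq.rfl ?_
  filter_upwards [eventually_gt_atTop 0] with j hj
  rw [← Real.rpow_add (by exact_mod_cast hj)]
  ring_nf

theorem hasSum_two_div_one_sub_div_pow_three {z : ℂ} (hz : ‖z‖ < R) :
    HasSum (fun j : ℕ => ((j + 1) * (j + 2) / R ^ j : ℂ) * z ^ j) (2 / (1 - z / R) ^ 3) := by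
  have hR : 0 < R := (norm_nonneg z).trans_lt hz
  have hzR : ‖z / R‖ < 1 := by
    rwa [norm_div, Complex.norm_real, Real.norm_of_nonneg hR.le, div_lt_one hR]
  have hchoose := (hasSum_choose_mul_geometric_of_norm_lt_one 2 hzR).mul_left (2 : ℂ)
  rw [mul_one_div] at hchoose
  refine hchoose.congr_fun fun j => ?_
  rw [Nat.cast_choose_two, div_pow]
  push_cast
  ring

theorem isBigO_sub_of_isBigO_quadratic_sub {x : ℕ → ℝ} {L d : ℝ} (hd : d ≤ 1)
    (h : (fun j : ℕ => ((j : ℝ) - 1) * (j - 2) * x j - L * ((j + 1) * (j + 2)))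
      =O[atTop] fun j => (j : ℝ) ^ (2 - d)) :
    (fun j => x j - L) =O[atTop] fun j => (j : ℝ) ^ (-d) := by
  have hlinear : (fun j : ℕ => 6 * L * j) =O[atTop] fun j => (j : ℝ) ^ (2 - d) := by
    refine IsBigO.of_bound (6 * |L|) ?_
    filter_upwards [eventually_ge_atTop 1] with j hj
    have hj1 : (1 : ℝ) ≤ j := by exact_mod_cast hj
    rw [norm_mul, norm_mul, Real.norm_natCast, Real.norm_ofNat, Real.norm_eq_abs L,
      Real.norm_of_nonneg (by positivity)]
    gcongr
    simpa using Real.rpow_le_rpow_of_exponent_le hj1 (by linarith : 1 ≤ 2 - d)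
  have hquad : (fun j : ℕ => (j : ℝ) ^ 2 * (x j - L)) =O[atTop] fun j =>
      ((j : ℝ) - 1) * (j - 2) * x j - L * ((j + 1) * (j + 2)) + 6 * L * j := by
    refine IsBigO.of_bound 8 ?_
    filter_upwards [eventually_ge_atTop 4] with j hj
    have hj4 : (4 : ℝ) ≤ j := by exact_mod_cast hj
    rw [show ((j : ℝ) - 1) * (j - 2) * x j - L * ((j + 1) * (j + 2)) + 6 * L * j =
      (j - 1) * (j - 2) * (x j - L) by ring, norm_mul, norm_mul, ← mul_assoc,
      Real.norm_of_nonneg (by positivity),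
      Real.norm_of_nonneg (by nlinarith : (0 : ℝ) ≤ (j - 1) * (j - 2))]
    gcongr
    nlinarith
  refine ((isBigO_refl (fun j : ℕ => (j : ℝ) ^ (-2 : ℝ)) _).mul
    (hquad.trans (h.add hlinear))).congr' ?_ ?_
  all_goals
    filter_upwards [eventually_gt_atTop 0] with j hj
    have hj0 : (0 : ℝ) < j := by exact_mod_cast hj
  · rw [← mul_assoc, ← Real.rpow_natCast, ← Real.rpow_add hj0]
    simp
  · rw [← Real.rpow_add hj0]
    ring_nf

theorem isBigO_scaled_sub_of_isBigO_modDeriv {g : ℂ → ℂ} {L d : ℝ} (hR : 0 < R) (hd : d ≤ 1)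
    (ha : ∀ z : ℂ, ‖z‖ < R → HasSum (fun j : ℕ => (a j / j : ℂ) * z ^ j) (g z))
    (hg : ContinuousOn (modDeriv g 3) (Metric.closedBall 0 R \ {(R : ℂ)}))
    (hO : (fun z : ℂ => modDeriv g 3 z - L * (2 / (1 - z / R) ^ 3))
      =O[𝓝[Metric.ball 0 R] (R : ℂ)] fun z => ‖1 - z / R‖ ^ (-3 + d)) :
    (fun j => scaled a R j - L) =O[atTop] fun j => (j : ℝ) ^ (-d) := by
  have hcont : ContinuousOn (fun z : ℂ => modDeriv g 3 z - L * (2 / (1 - z / R) ^ 3))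
      (Metric.closedBall 0 R \ {(R : ℂ)}) :=
    hg.sub (continuousOn_const.mul (continuousOn_const.div (by fun_prop)
      fun z hz => pow_ne_zero 3 (one_sub_div_ne_zero hR hz.2)))
  have hcoeff := isBigO_norm_coeff_of_isBigO_nhdsWithin (β := 3 - d) hR (by linarith) hcont
    (by rwa [neg_sub, sub_eq_neg_add]) fun z hz => ((hasSum_modDeriv ha 3 hz).sub
      ((hasSum_two_div_one_sub_div_pow_three hz).mul_left (L : ℂ))).congr_fun fun j => by
        rw [← mul_assoc, sub_mul]
  refine isBigO_sub_of_isBigO_quadratic_sub hd (IsBigO.of_norm_left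
    (hcoeff.congr' ?_ (.of_eq (by ring_nf))))
  filter_upwards [eventually_ge_atTop 2] with j hj
  have hj0 : (j : ℂ) ≠ 0 := Nat.cast_ne_zero.2 (by omega)
  have hRC : (R : ℂ) ≠ 0 := Complex.ofReal_ne_zero.2 hR.ne'
  have hdesc : (j.descFactorial 3 : ℂ) = (j - 2) * ((j - 1) * j) := by
    simp only [Nat.descFactorial_succ, Nat.descFactorial_zero, Nat.sub_zero]
    push_cast [show 1 ≤ j by omega, hj]
    ring
  have hterm : (((j : ℝ) - 1) * (j - 2) * scaled a R j - L * ((j + 1) * (j + 2)) : ℝ) =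
      (j.descFactorial 3 * (a j / j) - L * ((j + 1) * (j + 2) / R ^ j) : ℂ) * R ^ j := by
    rw [hdesc, scaled_of_ne_zero (by omega)]
    push_cast
    field_simp
  rw [← Complex.norm_real, hterm, norm_mul, norm_pow, Complex.norm_real, Real.norm_of_nonneg hR.le]

theorem hasSum_scaled_of_tendsto_modDeriv {g : ℂ → ℂ} {c : ℝ} (hR : 0 < R)
    (ha : ∀ z : ℂ, ‖z‖ < R → HasSum (fun j : ℕ => (a j / j : ℂ) * z ^ j) (g z))
    (hsum : Summable (scaled a R))
    (hc : Tendsto (fun r : ℝ => modDeriv g 1 (r : ℂ)) (𝓝[<] R) (𝓝 (c : ℂ))) :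
    HasSum (scaled a R) c := by
  have habel := Real.tendsto_tsum_powerSeries_nhdsWithin_lt hsum.hasSum.tendsto_sum_nat
  have hscale : Tendsto (fun x : ℝ => R * x) (𝓝[<] 1) (𝓝[<] R) := by
    refine tendsto_nhdsWithin_iff.2 ⟨?_, ?_⟩
    · simpa using ((continuous_const_mul R).tendsto 1).mono_left nhdsWithin_le_nhds
    · filter_upwards [self_mem_nhdsWithin] with x hx using mul_lt_of_lt_one_right hR hx
  have hseries : ∀ᶠ x : ℝ in 𝓝[<] 1,
      modDeriv g 1 ((R * x : ℝ) : ℂ) = ((∑' j, scaled a R j * x ^ j : ℝ) : ℂ) := by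
    filter_upwards [Ioo_mem_nhdsLT one_pos] with x hx
    have hxR : ‖((R * x : ℝ) : ℂ)‖ < R := by
      rw [Complex.norm_real, Real.norm_of_nonneg (mul_nonneg hR.le hx.1.le)]
      exact mul_lt_of_lt_one_right hR hx.2
    rw [← (hasSum_modDeriv ha 1 hxR).tsum_eq, Complex.ofReal_tsum]
    refine tsum_congr fun j => ?_
    rcases eq_or_ne j 0 with rfl | hj
    · simp [scaled_zero]
    · have : (j : ℂ) ≠ 0 := Nat.cast_ne_zero.2 hj
      rw [Nat.descFactorial_one, scaled_of_ne_zero hj]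
      push_cast
      field_simp
      ring
  have heq : (c : ℂ) = (∑' j, scaled a R j : ℝ) :=
    tendsto_nhds_unique ((hc.comp hscale).congr' hseries)
      ((Complex.continuous_ofReal.tendsto _).comp habel)
  rw [Complex.ofReal_inj.1 heq]
  exact hsum.hasSum

theorem isBigO_rpow_norm_one_sub_div {p q : ℝ} (hR : 0 < R) (hpq : p ≤ q) :
    (fun z : ℂ => ‖1 - z / R‖ ^ q) =O[𝓝[Metric.ball 0 R] (R : ℂ)] fun z => ‖1 - z / R‖ ^ p := by
  have hzero : ‖1 - (R : ℂ) / R‖ < 1 := by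
    rw [div_self (Complex.ofReal_ne_zero.2 hR.ne'), sub_self, norm_zero]
    exact one_pos
  have hcont : Continuous fun z : ℂ => ‖1 - z / R‖ := by fun_prop
  refine IsBigO.of_bound' ?_
  filter_upwards [nhdsWithin_le_nhds (hcont.tendsto _ |>.eventually_lt_const hzero),
    self_mem_nhdsWithin] with z hz hzR
  have hpos : 0 < ‖1 - z / R‖ := norm_pos_iff.2
    (one_sub_div_ne_zero hR (ne_ofReal_of_norm_lt (mem_ball_zero_iff.1 hzR)))
  rw [Real.norm_of_nonneg (by positivity), Real.norm_of_nonneg (by positivity)]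
  exact Real.rpow_le_rpow_of_exponent_ge hpos hz.le hpq

theorem isBigO_rpow_of_isBigO_sub_cpow {F : ℂ → ℂ} {C : ℂ} {p d : ℝ} (hR : 0 < R) (hd : 0 ≤ d)
    (hF : (fun z : ℂ => F z - C * (1 - z / R) ^ (p : ℂ)) =O[𝓝[Metric.ball 0 R] (R : ℂ)]
      fun z => ‖1 - z / R‖ ^ (p + d)) :
    F =O[𝓝[Metric.ball 0 R] (R : ℂ)] fun z => ‖1 - z / R‖ ^ p := by
  have hmain : (fun z : ℂ => C * (1 - z / R) ^ (p : ℂ)) =O[𝓝[Metric.ball 0 R] (R : ℂ)]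
      fun z => ‖1 - z / R‖ ^ p :=
    (IsBigO.of_bound' (Eventually.of_forall fun z => by
      rw [Complex.norm_cpow_real, Real.norm_of_nonneg (by positivity)])).const_mul_left C
  simpa only [sub_add_cancel] using
    (hF.trans (isBigO_rpow_norm_one_sub_div hR (le_add_of_nonneg_right hd))).add hmain

end Scaled

section DeltaExtension

/-- The function `g` extends the power series `∑_{j ≥ 1} (a_j / j) z^j`, whose radius of convergence
is at least `R`, holomorphically to the domain `Δ₀(R, η, φ)`. -/
structure IsDeltaExtension (g : ℂ → ℂ) (a : ℕ → ℝ≥0) (R η φ : ℝ) : Prop where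
  R_pos : 0 < R
  η_pos : 0 < η
  φ_pos : 0 < φ
  φ_lt : φ < Real.pi / 2
  le_radius : ENNReal.ofReal R ≤ (genSeries a).radius
  eq_sum : ∀ z : ℂ, ‖z‖ < R → g z = (genSeries a).sum z
  differentiableOn : DifferentiableOn ℂ g (domainDelta R η φ)

namespace IsDeltaExtension

variable {g : ℂ → ℂ} {a : ℕ → ℝ≥0} {R η φ : ℝ}

theorem hasSum (h : IsDeltaExtension g a R η φ) (z : ℂ) (hz : ‖z‖ < R) :
    HasSum (fun j : ℕ => (a j / j : ℂ) * z ^ j) (g z) :=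
  hasSum_of_eq_genSeries_sum h.le_radius h.eq_sum hz

theorem continuousOn_modDeriv (h : IsDeltaExtension g a R η φ) (n : ℕ) :
    ContinuousOn (modDeriv g n) (Metric.closedBall 0 R \ {(R : ℂ)}) :=
  (SurrogateSpatial.continuousOn_modDeriv isOpen_interior
    (h.differentiableOn.mono interior_subset) n).mono
    (closedBall_diff_subset_interior_domainDelta h.R_pos h.η_pos h.φ_pos h.φ_lt)

theorem nhdsWithin_ball_le (h : IsDeltaExtension g a R η φ) :
    𝓝[Metric.ball 0 R] (R : ℂ) ≤ 𝓝[domainDelta R η φ] (R : ℂ) :=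
  nhdsWithin_mono _ fun _ hz => interior_subset
    (closedBall_diff_subset_interior_domainDelta h.R_pos h.η_pos h.φ_pos h.φ_lt
      ⟨Metric.ball_subset_closedBall hz, ne_ofReal_of_norm_lt (mem_ball_zero_iff.1 hz)⟩)

theorem isBigO_scaled (h : IsDeltaExtension g a R η φ) {n : ℕ} {s d : ℝ} {C : ℂ} (hn : s + 2 ≤ n)
    (hd : 0 ≤ d)
    (hg : (fun z : ℂ => modDeriv g n z - C * (1 - z / R) ^ ((s - n : ℝ) : ℂ))
      =O[𝓝[domainDelta R η φ] (R : ℂ)] fun z : ℂ => ‖1 - z / R‖ ^ (s - n + d)) :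
    scaled a R =O[atTop] fun j => (j : ℝ) ^ (-s) :=
  isBigO_scaled_of_isBigO_modDeriv h.R_pos hn h.hasSum (h.continuousOn_modDeriv n)
    (isBigO_rpow_of_isBigO_sub_cpow h.R_pos hd (hg.mono h.nhdsWithin_ball_le))

theorem exists_isBigO_scaled_sub (h : IsDeltaExtension g a R η φ) {L d : ℝ} (hd : 0 < d)
    (hg : (fun z : ℂ => modDeriv g 3 z - L * (2 / (1 - z / R) ^ 3))
      =O[𝓝[domainDelta R η φ] (R : ℂ)] fun z : ℂ => ‖1 - z / R‖ ^ (-3 + d)) :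
    ∃ d' : ℝ, 0 < d' ∧ (fun j => scaled a R j - L) =O[atTop] fun j => (j : ℝ) ^ (-d') :=
  ⟨min d 1, lt_min hd one_pos, isBigO_scaled_sub_of_isBigO_modDeriv h.R_pos (min_le_right d 1)
    h.hasSum (h.continuousOn_modDeriv 3) ((hg.mono h.nhdsWithin_ball_le).trans
      (isBigO_rpow_norm_one_sub_div h.R_pos (by gcongr; exact min_le_left d 1)))⟩

theorem hasSum_scaled (h : IsDeltaExtension g a R η φ) {s c : ℝ} (hs : 1 < s)
    (ha : scaled a R =O[atTop] fun j => (j : ℝ) ^ (-s))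
    (hc : Tendsto (fun r : ℝ => modDeriv g 1 (r : ℂ)) (𝓝[<] R) (𝓝 (c : ℂ))) :
    HasSum (scaled a R) c :=
  hasSum_scaled_of_tendsto_modDeriv h.R_pos h.hasSum
    (summable_of_isBigO_nat (Real.summable_nat_rpow.2 (neg_lt_neg hs)) ha) hc

end IsDeltaExtension

end DeltaExtension

/-! ### Coefficients of exponentials of power series -/

open Finset.HasAntidiagonal

/-- The formal power series `∑_{j ≥ 1} (w_j / j) X^j`. -/
noncomputable def logSeries (w : ℕ → ℝ) : PowerSeries ℝ := PowerSeries.mk fun j => w j / j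

/-- The coefficient of `X^n` in `exp (∑_{j ≥ 1} (w_j / j) X^j)`. By the exponential formula it is
the average over the permutations of `n` elements of the product of `w_j` over all cycles, `j` being
the length of the cycle. -/
noncomputable def expCoeff (w : ℕ → ℝ) (n : ℕ) : ℝ :=
  PowerSeries.coeff n ((PowerSeries.exp ℝ).subst (logSeries w))

theorem coeff_logSeries (w : ℕ → ℝ) (n : ℕ) : PowerSeries.coeff n (logSeries w) = w n / n :=
  PowerSeries.coeff_mk _ _

theorem constantCoeff_logSeries (w : ℕ → ℝ) : PowerSeries.constantCoeff (logSeries w) = 0 := by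
  simp [logSeries]

theorem hasSubst_logSeries (w : ℕ → ℝ) : PowerSeries.HasSubst (logSeries w) :=
  PowerSeries.HasSubst.of_constantCoeff_zero' (constantCoeff_logSeries w)

theorem coeff_derivative_logSeries (w : ℕ → ℝ) (n : ℕ) :
    PowerSeries.coeff n (PowerSeries.derivative ℝ (logSeries w)) = w (n + 1) := by
  rw [PowerSeries.coeff_derivative, coeff_logSeries]
  push_cast
  field_simp

theorem derivative_exp_subst_logSeries (w : ℕ → ℝ) :
    PowerSeries.derivative ℝ ((PowerSeries.exp ℝ).subst (logSeries w)) =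
      (PowerSeries.exp ℝ).subst (logSeries w) * PowerSeries.derivative ℝ (logSeries w) := by
  rw [PowerSeries.derivative_subst (hasSubst_logSeries w), PowerSeries.derivative_exp]

theorem hasSum_coeff_logSeries_pow_div_factorial (w : ℕ → ℝ) (n : ℕ) :
    HasSum (fun k : ℕ => PowerSeries.coeff n (logSeries w ^ k) / k.factorial) (expCoeff w n) := by
  have hcoeff (k : ℕ) :
      PowerSeries.coeff k (PowerSeries.exp ℝ) • PowerSeries.coeff n (logSeries w ^ k) =
        PowerSeries.coeff n (logSeries w ^ k) / k.factorial := by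
    simp [PowerSeries.coeff_exp, div_eq_inv_mul]
  have hfin := PowerSeries.coeff_subst_finite' (hasSubst_logSeries w) (PowerSeries.exp ℝ) n
  simp_rw [hcoeff] at hfin
  rw [expCoeff, PowerSeries.coeff_subst' (hasSubst_logSeries w), finsum_congr hcoeff,
    ← tsum_eq_finsum (L := .unconditional ℕ) hfin]
  exact (summable_of_hasFiniteSupport hfin).hasSum

theorem expCoeff_zero (w : ℕ → ℝ) : expCoeff w 0 = 1 := by
  refine (hasSum_coeff_logSeries_pow_div_factorial w 0).unique ?_
  convert! hasSum_ite_eq 0 (1 : ℝ) using 2 with k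
  rw [PowerSeries.coeff_zero_eq_constantCoeff_apply, map_pow, constantCoeff_logSeries]
  rcases eq_or_ne k 0 with rfl | hk <;> simp [*]

theorem succ_mul_expCoeff (w : ℕ → ℝ) (n : ℕ) :
    ((n : ℝ) + 1) * expCoeff w (n + 1) =
      ∑ p ∈ antidiagonal n, expCoeff w p.1 * w (p.2 + 1) := by
  have h := congrArg (PowerSeries.coeff n) (derivative_exp_subst_logSeries w)
  rw [PowerSeries.coeff_derivative, PowerSeries.coeff_mul] at h
  simp only [coeff_derivative_logSeries] at h
  rw [mul_comm]
  exact h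

theorem mul_expCoeff (w : ℕ → ℝ) (n : ℕ) :
    (n : ℝ) * expCoeff w n = ∑ l ∈ Finset.Icc 1 n, w l * expCoeff w (n - l) := by
  cases n with
  | zero => simp
  | succ n =>
    push_cast
    rw [succ_mul_expCoeff, ← Finset.Nat.sum_antidiagonal_swap]
    refine (Finset.Nat.sum_antidiagonal_eq_sum_range_succ
      (fun i j => expCoeff w j * w (i + 1)) n).trans ?_
    rw [← Finset.Ico_succ_right_eq_Icc, Finset.sum_Ico_eq_sum_range]
    refine Finset.sum_congr (by simp) fun i _ => ?_
    rw [mul_comm, add_comm 1 i, Nat.add_sub_add_right]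

theorem eq_expCoeff_of_recurrence {w u : ℕ → ℝ} (h0 : u 0 = 1)
    (hu : ∀ n : ℕ, ((n : ℝ) + 1) * u (n + 1) = ∑ p ∈ antidiagonal n, u p.1 * w (p.2 + 1))
    (n : ℕ) : u n = expCoeff w n := by
  induction n using Nat.strong_induction_on with
  | _ n ih =>
    cases n with
    | zero => rw [h0, expCoeff_zero]
    | succ n =>
      refine mul_left_cancel₀ (by positivity : (n : ℝ) + 1 ≠ 0) ?_
      rw [hu, succ_mul_expCoeff]
      exact Finset.sum_congr rfl fun p hp => by
        rw [ih _ (Finset.Nat.antidiagonal.fst_lt hp)]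

theorem expCoeff_add (w w' : ℕ → ℝ) (n : ℕ) :
    expCoeff (w + w') n = ∑ p ∈ antidiagonal n, expCoeff w p.1 * expCoeff w' p.2 := by
  set P := (PowerSeries.exp ℝ).subst (logSeries w) with hP
  set Q := (PowerSeries.exp ℝ).subst (logSeries w') with hQ
  have hderiv : PowerSeries.derivative ℝ (P * Q) = P * Q *
      (PowerSeries.derivative ℝ (logSeries w) + PowerSeries.derivative ℝ (logSeries w')) := by
    rw [Derivation.leibniz, hP, hQ, derivative_exp_subst_logSeries, derivative_exp_subst_logSeries]
    simp only [smul_eq_mul]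
    ring
  rw [← eq_expCoeff_of_recurrence (u := fun m => PowerSeries.coeff m (P * Q)) ?_ ?_ n]
  · exact PowerSeries.coeff_mul n P Q
  · rw [PowerSeries.coeff_mul, Finset.Nat.antidiagonal_zero, Finset.sum_singleton]
    exact (congrArg₂ (· * ·) (expCoeff_zero w) (expCoeff_zero w')).trans (mul_one 1)
  · intro m
    have h := congrArg (PowerSeries.coeff m) hderiv
    rw [PowerSeries.coeff_derivative] at h
    rw [mul_comm, h, PowerSeries.coeff_mul]
    simp only [map_add, coeff_derivative_logSeries, Pi.add_apply]

theorem abs_expCoeff_le {w w' : ℕ → ℝ} (h : ∀ j, 1 ≤ j → |w j| ≤ w' j) (n : ℕ) :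
    |expCoeff w n| ≤ expCoeff w' n := by
  induction n using Nat.strong_induction_on with
  | _ n ih =>
    cases n with
    | zero => simp [expCoeff_zero]
    | succ n =>
      have hn : (0 : ℝ) < (n : ℝ) + 1 := by positivity
      refine le_of_mul_le_mul_left ?_ hn
      rw [← abs_of_pos hn, ← abs_mul, abs_of_pos hn, succ_mul_expCoeff, succ_mul_expCoeff]
      refine (Finset.abs_sum_le_sum_abs _ _).trans (Finset.sum_le_sum fun p hp => ?_)
      have hfst := ih p.1 (Finset.Nat.antidiagonal.fst_lt hp)
      rw [abs_mul]
      exact mul_le_mul hfst (h _ (Nat.succ_pos _)) (abs_nonneg _) ((abs_nonneg _).trans hfst)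

theorem expCoeff_nonneg {w : ℕ → ℝ} (h : ∀ j, 1 ≤ j → 0 ≤ w j) (n : ℕ) : 0 ≤ expCoeff w n :=
  (abs_nonneg _).trans (abs_expCoeff_le (fun j hj => (abs_of_nonneg (h j hj)).le) n)

theorem expCoeff_mul_pow (w : ℕ → ℝ) (r : ℝ) (n : ℕ) :
    expCoeff (fun j => w j * r ^ j) n = expCoeff w n * r ^ n := by
  refine (eq_expCoeff_of_recurrence (u := fun n => expCoeff w n * r ^ n) ?_ (fun n => ?_) n).symm
  · rw [expCoeff_zero, pow_zero, mul_one]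
  · rw [← mul_assoc, succ_mul_expCoeff, Finset.sum_mul]
    refine Finset.sum_congr rfl fun p hp => ?_
    rw [← mem_antidiagonal.1 hp]
    ring

theorem expCoeff_one (n : ℕ) : expCoeff (fun _ => 1) n = 1 :=
  (eq_expCoeff_of_recurrence (u := fun _ => 1) rfl (fun n => by simp) n).symm

theorem expCoeff_add_one (w : ℕ → ℝ) (n : ℕ) :
    expCoeff (w + fun _ => 1) n = ∑ i ∈ Finset.range (n + 1), expCoeff w i := by
  simp only [expCoeff_add, expCoeff_one, mul_one]
  exact Finset.Nat.sum_antidiagonal_eq_sum_range_succ (fun i _ => expCoeff w i) n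

section Summable

theorem summable_norm_coeff_mul {f g : PowerSeries ℝ}
    (hf : Summable fun n => ‖PowerSeries.coeff n f‖)
    (hg : Summable fun n => ‖PowerSeries.coeff n g‖) :
    Summable fun n => ‖PowerSeries.coeff n (f * g)‖ := by
  exact (summable_norm_sum_mul_antidiagonal_of_summable_norm hf hg).congr fun n =>
    congrArg norm (PowerSeries.coeff_mul n f g).symm

theorem tsum_coeff_mul {f g : PowerSeries ℝ} (hf : Summable fun n => ‖PowerSeries.coeff n f‖)
    (hg : Summable fun n => ‖PowerSeries.coeff n g‖) :
    ∑' n, PowerSeries.coeff n (f * g) =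
      (∑' n, PowerSeries.coeff n f) * ∑' n, PowerSeries.coeff n g := by
  rw [tsum_mul_tsum_eq_tsum_sum_antidiagonal_of_summable_norm hf hg]
  exact tsum_congr fun n => PowerSeries.coeff_mul n f g

theorem tsum_norm_coeff_mul_le {f g : PowerSeries ℝ}
    (hf : Summable fun n => ‖PowerSeries.coeff n f‖)
    (hg : Summable fun n => ‖PowerSeries.coeff n g‖) :
    ∑' n, ‖PowerSeries.coeff n (f * g)‖ ≤
      (∑' n, ‖PowerSeries.coeff n f‖) * ∑' n, ‖PowerSeries.coeff n g‖ := by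
  have hf' : Summable fun n => ‖‖PowerSeries.coeff n f‖‖ := by simpa only [norm_norm] using hf
  have hg' : Summable fun n => ‖‖PowerSeries.coeff n g‖‖ := by simpa only [norm_norm] using hg
  rw [tsum_mul_tsum_eq_tsum_sum_antidiagonal_of_summable_norm hf' hg']
  refine (summable_norm_coeff_mul hf hg).tsum_le_tsum (fun n => ?_)
    (summable_norm_sum_mul_antidiagonal_of_summable_norm hf' hg').of_norm
  rw [PowerSeries.coeff_mul]
  exact norm_sum_le_of_le _ fun p _ => norm_mul_le _ _

variable {f : PowerSeries ℝ}

theorem summable_norm_coeff_one :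
    Summable fun n => ‖PowerSeries.coeff n (1 : PowerSeries ℝ)‖ :=
  summable_of_ne_finset_zero (s := {0}) fun n hn => by
    rw [PowerSeries.coeff_one, if_neg (by simpa using hn), norm_zero]

theorem summable_norm_coeff_pow (hf : Summable fun n => ‖PowerSeries.coeff n f‖) (k : ℕ) :
    Summable fun n => ‖PowerSeries.coeff n (f ^ k)‖ := by
  induction k with
  | zero => simpa only [pow_zero] using summable_norm_coeff_one
  | succ k ih => simpa only [pow_succ] using summable_norm_coeff_mul ih hf

theorem tsum_coeff_pow (hf : Summable fun n => ‖PowerSeries.coeff n f‖) (k : ℕ) :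
    ∑' n, PowerSeries.coeff n (f ^ k) = (∑' n, PowerSeries.coeff n f) ^ k := by
  induction k with
  | zero => simp only [pow_zero, PowerSeries.coeff_one, tsum_ite_eq]
  | succ k ih => rw [pow_succ, pow_succ, tsum_coeff_mul (summable_norm_coeff_pow hf k) hf, ih]

theorem tsum_norm_coeff_pow_le (hf : Summable fun n => ‖PowerSeries.coeff n f‖) (k : ℕ) :
    ∑' n, ‖PowerSeries.coeff n (f ^ k)‖ ≤ (∑' n, ‖PowerSeries.coeff n f‖) ^ k := by
  induction k with
  | zero =>
    simp only [pow_zero, PowerSeries.coeff_one, apply_ite (norm : ℝ → ℝ), norm_one, norm_zero,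
      tsum_ite_eq, le_refl]
  | succ k ih =>
    rw [pow_succ, pow_succ]
    exact (tsum_norm_coeff_mul_le (summable_norm_coeff_pow hf k) hf).trans (by gcongr)

theorem summable_coeff_pow_div_factorial (hf : Summable fun n => ‖PowerSeries.coeff n f‖) :
    Summable fun p : ℕ × ℕ => PowerSeries.coeff p.2 (f ^ p.1) / (p.1.factorial : ℝ) := by
  refine Summable.of_norm ((summable_prod_of_nonneg fun p => norm_nonneg _).2 ⟨fun k => ?_, ?_⟩)
  · simpa only [norm_div] using (summable_norm_coeff_pow hf k).div_const _
  · refine .of_nonneg_of_le (fun k => tsum_nonneg fun n => norm_nonneg _) (fun k => ?_)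
      (Real.summable_pow_div_factorial (∑' n, ‖PowerSeries.coeff n f‖))
    simp only [norm_div, RCLike.norm_natCast, tsum_div_const]
    gcongr
    exact tsum_norm_coeff_pow_le hf k

theorem hasSum_expCoeff {w : ℕ → ℝ} (hw : Summable fun j => |w j| / j) :
    HasSum (expCoeff w) (Real.exp (∑' j, w j / j)) := by
  have hlog : Summable fun n => ‖PowerSeries.coeff n (logSeries w)‖ := hw.congr fun j => by
    rw [coeff_logSeries, norm_div, Real.norm_eq_abs, RCLike.norm_natCast]
  have hprod := summable_coeff_pow_div_factorial hlog
  have htsum : ∑' p : ℕ × ℕ, PowerSeries.coeff p.2 (logSeries w ^ p.1) / (p.1.factorial : ℝ) =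
      Real.exp (∑' j, w j / j) := by
    rw [hprod.tsum_prod, Real.exp_eq_exp_ℝ, NormedSpace.exp_eq_tsum_div]
    exact tsum_congr fun k => by simp only [tsum_div_const, tsum_coeff_pow hlog, coeff_logSeries]
  refine ((Equiv.prodComm ℕ ℕ).hasSum_iff.2 (htsum ▸ hprod.hasSum)).prod_fiberwise fun n => ?_
  exact hasSum_coeff_logSeries_pow_div_factorial w n

theorem summable_abs_expCoeff {w : ℕ → ℝ} (hw : Summable fun j => |w j| / j) :
    Summable fun n => |expCoeff w n| :=
  .of_nonneg_of_le (fun _ => abs_nonneg _) (fun n => abs_expCoeff_le (fun _ _ => le_rfl) n)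
    (hasSum_expCoeff (w := fun j => |w j|) (by simpa only [abs_abs] using hw)).summable

end Summable

/-! ### Asymptotics of the coefficients -/

section Convolution

theorem tendsto_sum_range_mul {e : ℕ → ℝ} {a : ℕ → ℕ → ℝ} {m : ℕ → ℕ} {L M : ℝ}
    (he : Summable fun j => |e j|) (hm : Tendsto m atTop atTop)
    (ha : ∀ j, Tendsto (fun n => a n j) atTop (𝓝 L))
    (hM : ∀ᶠ n in atTop, ∀ j < m n, |a n j| ≤ M) :
    Tendsto (fun n => ∑ j ∈ Finset.range (m n), a n j * e j) atTop (𝓝 (L * ∑' j, e j)) := by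
  rw [← tsum_mul_left]
  have htsum : Tendsto (fun n => ∑' j, if j < m n then a n j * e j else 0) atTop
      (𝓝 (∑' j, L * e j)) := by
    refine tendsto_tsum_of_dominated_convergence (bound := fun j => |M| * |e j|)
      (he.mul_left _) (fun j => ?_) ?_
    · refine ((ha j).mul_const (e j)).congr' ?_
      filter_upwards [hm.eventually_gt_atTop j] with n hn using (if_pos hn).symm
    · filter_upwards [hM] with n hn j
      split_ifs with hj
      · rw [norm_mul]
        exact mul_le_mul_of_nonneg_right ((hn j hj).trans (le_abs_self M)) (abs_nonneg _)
      · rw [norm_zero]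
        positivity
  refine htsum.congr fun n => ?_
  rw [tsum_eq_sum (s := Finset.range (m n)) fun j hj => if_neg (by simpa using hj)]
  exact Finset.sum_congr rfl fun j hj => if_pos (Finset.mem_range.1 hj)

variable {u e : ℕ → ℝ} {s p L : ℝ}

theorem rpow_le_two_mul_rpow {x y : ℝ} (hp : p ≤ 1) (hx : 0 < x) (hxy : x ≤ y) (hyx : y ≤ 2 * x) :
    y ^ p ≤ 2 * x ^ p := by
  have hy : 0 < y := hx.trans_le hxy
  rw [← div_le_iff₀ (by positivity), ← Real.div_rpow hy.le hx.le]
  calc (y / x) ^ p ≤ (y / x) ^ (1 : ℝ) :=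
        Real.rpow_le_rpow_of_exponent_le ((one_le_div hx).2 hxy) hp
    _ ≤ 2 := by rwa [Real.rpow_one, div_le_iff₀ hx]

theorem tendsto_rpow_mul_comp_sub (hu : Tendsto (fun n : ℕ => (n : ℝ) ^ p * u n) atTop (𝓝 L))
    (j : ℕ) : Tendsto (fun n : ℕ => (n : ℝ) ^ p * u (n - j)) atTop (𝓝 L) := by
  rw [← tendsto_add_atTop_iff_nat j]
  have hratio : Tendsto (fun n : ℕ => ((n : ℝ) / (n + j)) ^ p) atTop (𝓝 1) := by
    simpa only [Real.one_rpow] using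
      (tendsto_natCast_div_add_atTop (j : ℝ)).rpow_const (p := p) (Or.inl one_ne_zero)
  have hquot := hu.div hratio one_ne_zero
  rw [div_one] at hquot
  refine hquot.congr' ?_
  filter_upwards [eventually_gt_atTop 0] with n hn
  have hn0 : (0 : ℝ) < n := Nat.cast_pos.2 hn
  rw [Nat.add_sub_cancel, Nat.cast_add, Pi.div_apply, Real.div_rpow hn0.le (by positivity)]
  field_simp

theorem tendsto_rpow_mul_sum_range_half (hp : p ≤ 1) (he : Summable fun j => |e j|)
    (hu : Tendsto (fun n : ℕ => (n : ℝ) ^ p * u n) atTop (𝓝 L)) :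
    Tendsto (fun n : ℕ => ∑ j ∈ Finset.range (n / 2 + 1), (n : ℝ) ^ p * u (n - j) * e j) atTop
      (𝓝 (L * ∑' j, e j)) := by
  obtain ⟨C, hC⟩ := hu.abs.bddAbove_range
  refine tendsto_sum_range_mul (M := 2 * C) he
    ((tendsto_add_atTop_nat 1).comp (Nat.tendsto_div_const_atTop two_ne_zero))
    (tendsto_rpow_mul_comp_sub hu) ?_
  filter_upwards [eventually_gt_atTop 0] with n hn j hj
  have hsub : (0 : ℝ) < (n - j : ℕ) := Nat.cast_pos.2 (by omega)
  calc |(n : ℝ) ^ p * u (n - j)| = (n : ℝ) ^ p * |u (n - j)| := by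
        rw [abs_mul, abs_of_nonneg (Real.rpow_nonneg n.cast_nonneg p)]
    _ ≤ 2 * ((n - j : ℕ) : ℝ) ^ p * |u (n - j)| := by
        gcongr
        exact rpow_le_two_mul_rpow hp hsub (by exact_mod_cast Nat.sub_le n j)
          (by exact_mod_cast (by omega : n ≤ 2 * (n - j)))
    _ = 2 * |((n - j : ℕ) : ℝ) ^ p * u (n - j)| := by
        rw [abs_mul, abs_of_nonneg (Real.rpow_nonneg hsub.le p), mul_assoc]
    _ ≤ 2 * C := by
        gcongr
        exact hC ⟨n - j, rfl⟩

theorem tendsto_rpow_mul_sum_Ico_half (hu0 : ∀ n, 0 ≤ u n)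
    (hsum : (fun n : ℕ => (n : ℝ) ^ (-s) * ∑ i ∈ Finset.range (n + 1), u i) =O[atTop]
      fun _ => (1 : ℝ))
    (he : Tendsto (fun n : ℕ => (n : ℝ) * e n) atTop (𝓝 0)) :
    Tendsto (fun n : ℕ => ∑ j ∈ Finset.Ico (n / 2 + 1) (n + 1),
      (n : ℝ) ^ (1 - s) * u (n - j) * e j) atTop (𝓝 0) := by
  refine (isLittleO_one_iff ℝ).1 (IsLittleO.trans_isBigO (isLittleO_iff.2 fun c hc => ?_) hsum)
  have hsmall : ∀ᶠ n : ℕ in atTop, ‖(n : ℝ) * e n‖ ≤ c / 2 :=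
    he.norm.eventually_le_const (by rw [norm_zero]; positivity)
  have hhalf := (Nat.tendsto_div_const_atTop two_ne_zero).eventually
    (eventually_forall_ge_atTop.2 hsmall)
  filter_upwards [hhalf, eventually_gt_atTop 0] with n hn hn0
  have hn0 : (0 : ℝ) < n := Nat.cast_pos.2 hn0
  have hterm : ∀ j ∈ Finset.Ico (n / 2 + 1) (n + 1), ‖(n : ℝ) ^ (1 - s) * u (n - j) * e j‖ ≤
      c * ((n : ℝ) ^ (-s) * u (n - j)) := by
    intro j hj
    rw [Finset.mem_Ico] at hj
    have hnj : (n : ℝ) ≤ 2 * j := by exact_mod_cast (by omega : n ≤ 2 * j)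
    have hej : (n : ℝ) * ‖e j‖ ≤ c := by
      have := hn j (by omega)
      rw [norm_mul, RCLike.norm_natCast] at this
      calc (n : ℝ) * ‖e j‖ ≤ 2 * j * ‖e j‖ := by gcongr
        _ ≤ c := by linarith
    calc ‖(n : ℝ) ^ (1 - s) * u (n - j) * e j‖ = n * ‖e j‖ * ((n : ℝ) ^ (-s) * u (n - j)) := by
          rw [norm_mul, norm_mul, Real.norm_of_nonneg (hu0 _), Real.norm_of_nonneg (by positivity),
            sub_eq_neg_add, Real.rpow_add_one hn0.ne']
          ring
      _ ≤ c * ((n : ℝ) ^ (-s) * u (n - j)) := by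
          have := hu0 (n - j)
          gcongr
  have hsub : ∑ j ∈ Finset.Ico (n / 2 + 1) (n + 1), u (n - j) ≤
      ∑ i ∈ Finset.range (n + 1), u i := by
    rw [← Finset.sum_range_reflect u (n + 1), Finset.range_eq_Ico]
    exact Finset.sum_le_sum_of_subset_of_nonneg (Finset.Ico_subset_Ico_left (Nat.zero_le _))
      fun j _ _ => hu0 _
  refine (norm_sum_le_of_le _ hterm).trans ?_
  rw [← Finset.mul_sum, ← Finset.mul_sum, Real.norm_of_nonneg
    (mul_nonneg (by positivity) (Finset.sum_nonneg fun i _ => hu0 i))]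
  gcongr

theorem tendsto_rpow_mul_sum_antidiagonal (hs : 0 ≤ s) (hu0 : ∀ n, 0 ≤ u n)
    (hu : Tendsto (fun n : ℕ => (n : ℝ) ^ (1 - s) * u n) atTop (𝓝 L))
    (hsum : (fun n : ℕ => (n : ℝ) ^ (-s) * ∑ i ∈ Finset.range (n + 1), u i) =O[atTop]
      fun _ => (1 : ℝ))
    (he : Summable fun j => |e j|) (he0 : Tendsto (fun n : ℕ => (n : ℝ) * e n) atTop (𝓝 0)) :
    Tendsto (fun n : ℕ => (n : ℝ) ^ (1 - s) * ∑ q ∈ antidiagonal n, u q.1 * e q.2) atTop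
      (𝓝 (L * ∑' j, e j)) := by
  have hsplit := (tendsto_rpow_mul_sum_range_half (by linarith) he hu).add
    (tendsto_rpow_mul_sum_Ico_half hu0 hsum he0)
  rw [add_zero] at hsplit
  refine hsplit.congr fun n => ?_
  rw [Finset.sum_range_add_sum_Ico _ (by omega), ← Finset.Nat.sum_antidiagonal_swap]
  refine Eq.trans ?_ (congrArg _
    (Finset.Nat.sum_antidiagonal_eq_sum_range_succ (fun j i => u i * e j) n).symm)
  simp only [Finset.mul_sum, mul_assoc]

end Convolution

theorem succ_mul_expCoeff_const (s : ℝ) (n : ℕ) :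
    ((n : ℝ) + 1) * expCoeff (fun _ => s) (n + 1) = (s + n) * expCoeff (fun _ => s) n := by
  have hrec (m : ℕ) : ((m : ℝ) + 1) * expCoeff (fun _ => s) (m + 1) =
      ∑ i ∈ Finset.range (m + 1), expCoeff (fun _ => s) i * s :=
    (succ_mul_expCoeff _ m).trans (Finset.Nat.sum_antidiagonal_eq_sum_range_succ
      (fun i _ => expCoeff (fun _ => s) i * s) m)
  cases n with
  | zero => simpa [expCoeff_zero] using hrec 0
  | succ n =>
    rw [hrec, Finset.sum_range_succ, ← hrec]
    push_cast
    ring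

theorem expCoeff_const (s : ℝ) (n : ℕ) :
    expCoeff (fun _ => s) n = (∏ j ∈ Finset.range n, (s + j)) / n.factorial := by
  induction n with
  | zero => simp [expCoeff_zero]
  | succ n ih =>
    have h := succ_mul_expCoeff_const s n
    rw [ih] at h
    rw [Finset.prod_range_succ, Nat.factorial_succ, eq_div_iff (by positivity)]
    push_cast
    field_simp at h
    linarith

theorem tendsto_rpow_mul_expCoeff_const {s : ℝ} (hs : 0 < s) :
    Tendsto (fun n : ℕ => (n : ℝ) ^ (1 - s) * expCoeff (fun _ => s) n) atTop
      (𝓝 (Real.Gamma s)⁻¹) := by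
  have hlim := ((Real.GammaSeq_tendsto_Gamma s).inv₀ (Real.Gamma_pos_of_pos hs).ne').mul
    (tendsto_natCast_div_add_atTop s)
  rw [mul_one] at hlim
  refine hlim.congr' ?_
  filter_upwards [eventually_gt_atTop 0] with n hn
  have hn0 : (0 : ℝ) < n := Nat.cast_pos.2 hn
  rw [expCoeff_const, Real.GammaSeq, Finset.prod_range_succ, Real.rpow_sub hn0, Real.rpow_one,
    add_comm (n : ℝ) s]
  field_simp

theorem isBigO_rpow_mul_sum_expCoeff_of_tendsto {w : ℕ → ℝ} {s L : ℝ}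
    (h : Tendsto (fun n : ℕ => (n : ℝ) ^ (1 - (s + 1)) * expCoeff (w + fun _ => 1) n) atTop (𝓝 L)) :
    (fun n : ℕ => (n : ℝ) ^ (-s) * ∑ i ∈ Finset.range (n + 1), expCoeff w i) =O[atTop]
      fun _ => (1 : ℝ) := by
  simp only [expCoeff_add_one, sub_add_cancel_right] at h
  exact h.isBigO_one ℝ

theorem tendsto_mul_expCoeff_zero {ε : ℕ → ℝ} (h0 : Tendsto ε atTop (𝓝 0))
    (hsum : Summable fun j => |ε j| / j) :
    Tendsto (fun n : ℕ => (n : ℝ) * expCoeff ε n) atTop (𝓝 0) := by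
  rw [← tendsto_add_atTop_iff_nat 1]
  obtain ⟨M, hM⟩ := h0.abs.bddAbove_range
  have hconv := tendsto_sum_range_mul (a := fun n i => ε (n - i + 1)) (M := M)
    (summable_abs_expCoeff hsum) (tendsto_add_atTop_nat 1)
    (fun i => h0.comp ((tendsto_add_atTop_nat 1).comp (tendsto_sub_atTop_nat i)))
    (Eventually.of_forall fun n i _ => hM ⟨_, rfl⟩)
  rw [zero_mul] at hconv
  refine hconv.congr fun n => ?_
  push_cast
  rw [succ_mul_expCoeff]
  refine Eq.trans (Finset.sum_congr rfl fun i _ => mul_comm _ _)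
    (Finset.Nat.sum_antidiagonal_eq_sum_range_succ (fun i j => expCoeff ε i * ε (j + 1)) n).symm

theorem tendsto_atTop_of_tendsto_div {ι : Type*} {l : Filter ι} {N k : ι → ℕ} {y : ℝ}
    (hy : 0 < y) (hN : Tendsto N l atTop) (hk : Tendsto (fun i => (k i : ℝ) / N i) l (𝓝 y)) :
    Tendsto k l atTop := by
  have hNr : Tendsto (fun i => (N i : ℝ)) l atTop := tendsto_natCast_atTop_atTop.comp hN
  refine tendsto_natCast_atTop_iff.1 ((hNr.atTop_mul_pos hy hk).congr' ?_)
  filter_upwards [hNr.eventually_ne_atTop 0] with i hi using mul_div_cancel₀ _ hi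

theorem rpow_one_sub_mul_eq {x k : ℝ} (hx : 0 < x) (hk : 0 < k) (s b : ℝ) :
    x ^ (1 - s) * b = k ^ (1 - s) * b * (k / x) ^ (s - 1) := by
  rw [Real.div_rpow hk.le hx.le, ← neg_sub s 1, Real.rpow_neg hx.le, Real.rpow_neg hk.le]
  field_simp

section Perturbation

variable {s : ℝ} {ε : ℕ → ℝ}

theorem tendsto_rpow_mul_expCoeff (hs : 0 < s) (h0 : Tendsto ε atTop (𝓝 0))
    (hsum : Summable fun j => |ε j| / j) :
    Tendsto (fun n : ℕ => (n : ℝ) ^ (1 - s) * expCoeff (fun j => s + ε j) n) atTop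
      (𝓝 ((Real.Gamma s)⁻¹ * Real.exp (∑' j, ε j / j))) := by
  rw [← (hasSum_expCoeff hsum).tsum_eq]
  refine (tendsto_rpow_mul_sum_antidiagonal hs.le (fun n => expCoeff_nonneg (fun _ _ => hs.le) n)
    (tendsto_rpow_mul_expCoeff_const hs) (isBigO_rpow_mul_sum_expCoeff_of_tendsto
      (tendsto_rpow_mul_expCoeff_const (add_pos hs one_pos))) (summable_abs_expCoeff hsum)
    (tendsto_mul_expCoeff_zero h0 hsum)).congr fun n => ?_
  rw [← expCoeff_add]
  rfl

theorem isBigO_sum_expCoeff (hs : 0 < s) (h0 : Tendsto ε atTop (𝓝 0))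
    (hsum : Summable fun j => |ε j| / j) :
    (fun n : ℕ => ∑ i ∈ Finset.range (n + 1), expCoeff (fun j => s + ε j) i) =O[atTop]
      fun n => (n : ℝ) ^ s := by
  have h : Tendsto (fun n : ℕ => (n : ℝ) ^ (1 - (s + 1)) *
      expCoeff ((fun j => s + ε j) + fun _ => 1) n) atTop
      (𝓝 ((Real.Gamma (s + 1))⁻¹ * Real.exp (∑' j, ε j / j))) := by
    refine (tendsto_rpow_mul_expCoeff (by positivity) h0 hsum).congr fun n => ?_
    congr 2
    funext j
    exact add_right_comm s 1 (ε j)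
  refine ((isBigO_refl (fun n : ℕ => (n : ℝ) ^ s) atTop).mul
    (isBigO_rpow_mul_sum_expCoeff_of_tendsto h)).congr' ?_ (by simp)
  filter_upwards [eventually_gt_atTop 0] with n hn
  rw [← mul_assoc, ← Real.rpow_add (Nat.cast_pos.2 hn), add_neg_cancel, Real.rpow_zero, one_mul]

theorem tendsto_rpow_mul_expCoeff_comp (hs : 0 < s) (h0 : Tendsto ε atTop (𝓝 0))
    (hsum : Summable fun j => |ε j| / j) {ι : Type*} {l : Filter ι} {N k : ι → ℕ} {y : ℝ}
    (hy : 0 < y) (hN : Tendsto N l atTop) (hk : Tendsto (fun i => (k i : ℝ) / N i) l (𝓝 y)) :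
    Tendsto (fun i => (N i : ℝ) ^ (1 - s) * expCoeff (fun j => s + ε j) (k i)) l
      (𝓝 ((Real.Gamma s)⁻¹ * Real.exp (∑' j, ε j / j) * y ^ (s - 1))) := by
  have hk' := tendsto_atTop_of_tendsto_div hy hN hk
  refine (((tendsto_rpow_mul_expCoeff hs h0 hsum).comp hk').mul
    (hk.rpow_const (p := s - 1) (Or.inl hy.ne'))).congr' ?_
  filter_upwards [hN.eventually_gt_atTop 0, hk'.eventually_gt_atTop 0] with i hi hi'
  exact (rpow_one_sub_mul_eq (Nat.cast_pos.2 hi) (Nat.cast_pos.2 hi') _ _).symm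

end Perturbation

/-! ### Sums of independent compound Poisson variables -/

/-- The probability that a sum of `N` independent compound Poisson variables with generating
function `exp (∑_j (K_j / j) (z^j - 1))` equals `n`. -/
noncomputable def poissonSumProb (K : ℕ → ℝ) (N n : ℕ) : ℝ :=
  Real.exp (-(N * ∑' j, K j / j)) * expCoeff (fun j => N * K j) n

theorem summable_div_natCast {K : ℕ → ℝ} (hK0 : ∀ j, 0 ≤ K j) (hK : Summable K) :
    Summable fun j : ℕ => K j / j := by
  refine hK.of_nonneg_of_le (fun j => div_nonneg (hK0 j) j.cast_nonneg) fun j => ?_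
  rcases j.eq_zero_or_pos with rfl | hj
  · simpa using hK0 0
  · exact div_le_self (hK0 j) (by exact_mod_cast hj)

theorem summable_mul_pow_of_le_one {a : ℕ → ℝ} (ha : ∀ j, 0 ≤ a j) (hs : Summable a) {r : ℝ}
    (hr0 : 0 ≤ r) (hr1 : r ≤ 1) : Summable fun j => a j * r ^ j :=
  hs.of_nonneg_of_le (fun j => mul_nonneg (ha j) (pow_nonneg hr0 j)) fun j =>
    mul_le_of_le_one_right (ha j) (pow_le_one₀ hr0 hr1)

section PoissonSum

variable {K : ℕ → ℝ} {c₁ : ℝ}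

theorem poissonSumProb_nonneg (hK0 : ∀ j, 0 ≤ K j) (N n : ℕ) : 0 ≤ poissonSumProb K N n :=
  mul_nonneg (Real.exp_pos _).le (expCoeff_nonneg (fun j _ => mul_nonneg N.cast_nonneg (hK0 j)) n)

theorem natCast_mul_poissonSumProb (K : ℕ → ℝ) (N n : ℕ) :
    (n : ℝ) * poissonSumProb K N n =
      N * ∑ l ∈ Finset.Icc 1 n, K l * poissonSumProb K N (n - l) := by
  simp only [poissonSumProb]
  rw [mul_left_comm, mul_expCoeff, Finset.mul_sum, Finset.mul_sum]
  exact Finset.sum_congr rfl fun l _ => by ring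

theorem hasSum_poissonSumProb_mul_pow (hK0 : ∀ j, 0 ≤ K j) (hK : Summable fun j => K j / j)
    (N : ℕ) {r : ℝ} (hr0 : 0 ≤ r) (hr1 : r ≤ 1) :
    HasSum (fun n => poissonSumProb K N n * r ^ n)
      (Real.exp (-(N * ∑' j : ℕ, K j / j * (1 - r ^ j)))) := by
  have hKr := summable_mul_pow_of_le_one (fun j => div_nonneg (hK0 j) j.cast_nonneg) hK hr0 hr1
  have hw : Summable fun j : ℕ => |(N : ℝ) * K j * r ^ j| / j := by
    refine (hKr.mul_left (N : ℝ)).congr fun j => ?_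
    have := hK0 j
    rw [abs_of_nonneg (by positivity)]
    ring
  have hexponent : -(N * ∑' j : ℕ, K j / j * (1 - r ^ j)) =
      -(N * ∑' j, K j / j) + ∑' j : ℕ, (N : ℝ) * K j * r ^ j / j := by
    simp only [mul_sub, mul_one]
    rw [hK.tsum_sub hKr, mul_sub, ← tsum_mul_left (f := fun j : ℕ => K j / j * r ^ j), neg_sub,
      sub_eq_neg_add]
    exact congrArg _ (tsum_congr fun j => by ring)
  rw [hexponent, Real.exp_add]
  refine ((hasSum_expCoeff hw).mul_left _).congr_fun fun n => ?_
  rw [expCoeff_mul_pow (fun j => (N : ℝ) * K j) r n, poissonSumProb]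
  ring

theorem hasSum_poissonSumProb (hK0 : ∀ j, 0 ≤ K j) (hK : Summable fun j => K j / j) (N : ℕ) :
    HasSum (poissonSumProb K N) 1 := by
  simpa using hasSum_poissonSumProb_mul_pow hK0 hK N zero_le_one le_rfl

theorem mul_one_sub_exp_neg_div_nonneg {t x : ℝ} (ht : 0 ≤ t) (hx : 0 < x) :
    0 ≤ x * (1 - Real.exp (-(t / x))) :=
  mul_nonneg hx.le (sub_nonneg.2 (Real.exp_le_one_iff.2 (neg_nonpos.2 (by positivity))))

theorem mul_one_sub_exp_neg_div_le (t : ℝ) {x : ℝ} (hx : 0 < x) :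
    x * (1 - Real.exp (-(t / x))) ≤ t := by
  calc x * (1 - Real.exp (-(t / x))) ≤ x * (t / x) := by
        gcongr
        linarith [Real.add_one_le_exp (-(t / x))]
    _ = t := mul_div_cancel₀ _ hx.ne'

theorem tendsto_mul_one_sub_exp_neg_div (t : ℝ) :
    Tendsto (fun N : ℕ => (N : ℝ) * (1 - Real.exp (-(t / N)))) atTop (𝓝 t) := by
  have hderiv : HasDerivAt (fun x : ℝ => 1 - Real.exp (-(t * x))) t 0 := by
    simpa using (((hasDerivAt_id (0 : ℝ)).const_mul t).neg.exp).const_sub 1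
  refine (hderiv.tendsto_slope_zero_right.comp
    (tendsto_inv_atTop_nhdsGT_zero.comp tendsto_natCast_atTop_atTop)).congr fun N => ?_
  simp [div_eq_mul_inv]

theorem tendsto_exp_neg_mul_tsum_one_sub_exp (hK0 : ∀ j, 0 ≤ K j) (hK : HasSum K c₁)
    (hK00 : K 0 = 0) {t : ℝ} (ht : 0 ≤ t) :
    Tendsto (fun N : ℕ => Real.exp (-(N * ∑' j : ℕ, K j / j * (1 - Real.exp (-(t / N)) ^ j))))
      atTop (𝓝 (Real.exp (-(t * c₁)))) := by
  have hterm (N j : ℕ) : N * (K j / j * (1 - Real.exp (-(t / N)) ^ j)) =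
      K j / j * (N * (1 - Real.exp (-(t * j / N)))) := by
    rw [← Real.exp_nat_mul]
    ring_nf
  have hKj (j : ℕ) : K j / j * (t * j) = t * K j := by
    rcases eq_or_ne j 0 with rfl | hj
    · simp [hK00]
    · field_simp
  refine (Real.continuous_exp.tendsto _).comp (Tendsto.neg ?_)
  rw [← hK.tsum_eq, ← tsum_mul_left]
  simp only [← tsum_mul_left, hterm]
  refine tendsto_tsum_of_dominated_convergence (bound := fun j => t * K j) (hK.summable.mul_left t)
    (fun j => ?_) ?_
  · rw [← hKj]
    exact (tendsto_mul_one_sub_exp_neg_div (t * j)).const_mul _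
  · filter_upwards [eventually_gt_atTop 0] with N hN j
    have hN0 : (0 : ℝ) < N := Nat.cast_pos.2 hN
    have hKj0 := div_nonneg (hK0 j) (j.cast_nonneg (α := ℝ))
    rw [Real.norm_of_nonneg (mul_nonneg hKj0
      (mul_one_sub_exp_neg_div_nonneg (by positivity) hN0)), ← hKj]
    exact mul_le_mul_of_nonneg_left (mul_one_sub_exp_neg_div_le _ hN0) hKj0

theorem hasSum_poissonSumProb_mul_sq (hK0 : ∀ j, 0 ≤ K j) (hK : Summable fun j => K j / j)
    (N : ℕ) (a : ℝ) :
    HasSum (fun n : ℕ => poissonSumProb K N n * (Real.exp (-((n : ℝ) / N)) - a) ^ 2)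
      (Real.exp (-(N * ∑' j : ℕ, K j / j * (1 - Real.exp (-(2 / N)) ^ j))) -
        2 * a * Real.exp (-(N * ∑' j : ℕ, K j / j * (1 - Real.exp (-(1 / N)) ^ j))) + a ^ 2) := by
  have hmoment {t : ℝ} (ht : 0 ≤ t) := hasSum_poissonSumProb_mul_pow hK0 hK N
    (Real.exp_pos (-(t / N))).le (Real.exp_le_one_iff.2 (neg_nonpos.2 (by positivity)))
  have hpow (t : ℝ) (n : ℕ) : Real.exp (-(t / N)) ^ n = Real.exp (-(n / N) * t) := by
    rw [← Real.exp_nat_mul]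
    ring_nf
  have h := ((hmoment zero_le_two).sub ((hmoment zero_le_one).mul_left (2 * a))).add
    ((hasSum_poissonSumProb hK0 hK N).mul_left (a ^ 2))
  rw [mul_one] at h
  refine h.congr_fun fun n => ?_
  rw [hpow, hpow, mul_one, mul_two, Real.exp_add]
  ring

theorem tendsto_tsum_poissonSumProb_mul_sq (hK0 : ∀ j, 0 ≤ K j) (hK : HasSum K c₁)
    (hK00 : K 0 = 0) :
    Tendsto (fun N : ℕ => ∑' n : ℕ, poissonSumProb K N n *
      (Real.exp (-((n : ℝ) / N)) - Real.exp (-c₁)) ^ 2) atTop (𝓝 0) := by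
  have hlim := ((tendsto_exp_neg_mul_tsum_one_sub_exp hK0 hK hK00 zero_le_two).sub
    ((tendsto_exp_neg_mul_tsum_one_sub_exp hK0 hK hK00 zero_le_one).const_mul
      (2 * Real.exp (-c₁)))).add_const (Real.exp (-c₁) ^ 2)
  have hzero : Real.exp (-(2 * c₁)) - 2 * Real.exp (-c₁) * Real.exp (-(1 * c₁)) +
      Real.exp (-c₁) ^ 2 = 0 := by
    rw [two_mul c₁, neg_add, Real.exp_add, one_mul]
    ring
  rw [hzero] at hlim
  exact hlim.congr fun N => (hasSum_poissonSumProb_mul_sq hK0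
    (summable_div_natCast hK0 hK.summable) N _).tsum_eq.symm

theorem exists_forall_le_sq_exp_neg_sub (c : ℝ) {ε : ℝ} (hε : 0 < ε) :
    ∃ δ > 0, ∀ x, ε < |x - c| → δ ≤ (Real.exp (-x) - Real.exp (-c)) ^ 2 := by
  have hlower : Real.exp (-(c + ε)) < Real.exp (-c) := Real.exp_lt_exp.2 (by linarith)
  have hupper : Real.exp (-c) < Real.exp (-(c - ε)) := Real.exp_lt_exp.2 (by linarith)
  refine ⟨min ((Real.exp (-c) - Real.exp (-(c + ε))) ^ 2)
      ((Real.exp (-(c - ε)) - Real.exp (-c)) ^ 2),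
    lt_min (pow_pos (sub_pos.2 hlower) 2) (pow_pos (sub_pos.2 hupper) 2), fun x hx => ?_⟩
  rcases lt_abs.1 hx with hx | hx
  · have hexp : Real.exp (-x) ≤ Real.exp (-(c + ε)) := Real.exp_le_exp.2 (by linarith)
    rw [← neg_sub (Real.exp (-c)) (Real.exp (-x)), neg_sq]
    exact (min_le_left _ _).trans (pow_le_pow_left₀ (by linarith) (by linarith) 2)
  · have hexp : Real.exp (-(c - ε)) ≤ Real.exp (-x) := Real.exp_le_exp.2 (by linarith)
    exact (min_le_right _ _).trans (pow_le_pow_left₀ (by linarith) (by linarith) 2)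

/-- Chebyshev's inequality for the bounded variable `exp (-n / N)`, whose first two moments are
Laplace transforms. -/
theorem tendsto_tsum_indicator_poissonSumProb (hK0 : ∀ j, 0 ≤ K j) (hK : HasSum K c₁)
    (hK00 : K 0 = 0) {ε : ℝ} (hε : 0 < ε) :
    Tendsto (fun N : ℕ => ∑' n, {n : ℕ | ε < |(n : ℝ) / N - c₁|}.indicator (poissonSumProb K N) n)
      atTop (𝓝 0) := by
  obtain ⟨δ, hδ, hfar⟩ := exists_forall_le_sq_exp_neg_sub c₁ hε
  have hlim := (tendsto_tsum_poissonSumProb_mul_sq hK0 hK hK00).div_const δ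
  rw [zero_div] at hlim
  have hq0 := poissonSumProb_nonneg hK0
  refine squeeze_zero (fun N => tsum_nonneg (Set.indicator_nonneg fun n _ => hq0 N n))
    (fun N => ?_) hlim
  have hle (n : ℕ) : {n : ℕ | ε < |(n : ℝ) / N - c₁|}.indicator (poissonSumProb K N) n ≤
      poissonSumProb K N n * (Real.exp (-((n : ℝ) / N)) - Real.exp (-c₁)) ^ 2 / δ := by
    refine Set.indicator_apply_le' (fun hn => ?_) fun _ => ?_
    · rw [le_div_iff₀ hδ]
      exact mul_le_mul_of_nonneg_left (hfar _ hn) (hq0 N n)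
    · have := hq0 N n
      positivity
  have hsum := (hasSum_poissonSumProb_mul_sq hK0 (summable_div_natCast hK0 hK.summable) N
    (Real.exp (-c₁))).summable.div_const δ
  rw [← tsum_div_const]
  exact (Summable.of_nonneg_of_le (Set.indicator_nonneg fun n _ => hq0 N n) hle hsum).tsum_le_tsum
    hle hsum

/-- One step of the recurrence `n q_n = N ∑_l K_l q_{n-l}`: terms `l ≤ x` are controlled by the
bound `B` on `q` at smaller arguments, terms `l > x` by the total mass of `q`. -/
theorem poissonSumProb_le_of_forall_le (hK0 : ∀ j, 0 ≤ K j) (hK : HasSum K c₁) {c B T x : ℝ}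
    {N n : ℕ} (hc : 0 < c) (hN : 0 < N) (hB0 : 0 ≤ B) (hT : ∀ l : ℕ, x < l → K l ≤ T)
    (hn : c * N ≤ n)
    (hB : ∀ l ≤ n, (l : ℝ) ≤ x → poissonSumProb K N (n - l) ≤ B) :
    poissonSumProb K N n ≤ (c₁ * B + T) / c := by
  have hq0 := poissonSumProb_nonneg hK0 N
  have hqs := hasSum_poissonSumProb hK0 (summable_div_natCast hK0 hK.summable) N
  have hN0 : (0 : ℝ) < N := Nat.cast_pos.2 hN
  have hT0 : 0 ≤ T := by
    obtain ⟨l, hl⟩ := exists_nat_gt x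
    exact (hK0 l).trans (hT l hl)
  have hterm : ∀ l ∈ Finset.Icc 1 n, K l * poissonSumProb K N (n - l) ≤
      K l * B + T * poissonSumProb K N (n - l) := by
    intro l hl
    rcases le_or_gt (l : ℝ) x with hlx | hlx
    · have := mul_le_mul_of_nonneg_left (hB l (Finset.mem_Icc.1 hl).2 hlx) (hK0 l)
      linarith [mul_nonneg hT0 (hq0 (n - l))]
    · have := mul_le_mul_of_nonneg_right (hT l hlx) (hq0 (n - l))
      linarith [mul_nonneg (hK0 l) hB0]
  have hinj : Set.InjOn (fun l => n - l) (Finset.Icc 1 n : Finset ℕ) := by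
    intro a ha b hb hab
    simp only [Finset.coe_Icc, Set.mem_Icc] at ha hb hab
    omega
  have hmass : ∑ l ∈ Finset.Icc 1 n, poissonSumProb K N (n - l) ≤ 1 := by
    rw [← Finset.sum_image (f := poissonSumProb K N) hinj]
    exact sum_le_hasSum _ (fun j _ => hq0 j) hqs
  have hsum : ∑ l ∈ Finset.Icc 1 n, K l * poissonSumProb K N (n - l) ≤ c₁ * B + T := by
    refine (Finset.sum_le_sum hterm).trans ?_
    rw [Finset.sum_add_distrib, ← Finset.sum_mul, ← Finset.mul_sum]
    have hKsum : ∑ l ∈ Finset.Icc 1 n, K l ≤ c₁ := sum_le_hasSum _ (fun j _ => hK0 j) hK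
    gcongr
    exact mul_le_of_le_one_right hT0 hmass
  rw [le_div_iff₀ hc, mul_comm]
  refine le_of_mul_le_mul_left ?_ hN0
  calc (N : ℝ) * (c * poissonSumProb K N n) = c * N * poissonSumProb K N n := by ring
    _ ≤ n * poissonSumProb K N n := mul_le_mul_of_nonneg_right hn (hq0 n)
    _ ≤ N * (c₁ * B + T) := by
        rw [natCast_mul_poissonSumProb]
        gcongr

theorem poissonSumProb_le_pow_add (hK0 : ∀ j, 0 ≤ K j) (hK : HasSum K c₁) {ε T x : ℝ}
    (hε : 0 < ε) (hx : 0 ≤ x) (hT : ∀ l : ℕ, x < l → K l ≤ T) {N : ℕ} (hN : 0 < N) (i n : ℕ)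
    (hn : (c₁ + ε) * N + i * x ≤ n) :
    poissonSumProb K N n ≤ (c₁ / (c₁ + ε)) ^ i + T / ε := by
  have hc₁ : 0 ≤ c₁ := hK.nonneg hK0
  have hT0 : 0 ≤ T := by
    obtain ⟨l, hl⟩ := exists_nat_gt x
    exact (hK0 l).trans (hT l hl)
  induction i generalizing n with
  | zero =>
    have hle := le_hasSum (hasSum_poissonSumProb hK0 (summable_div_natCast hK0 hK.summable) N) n
      fun j _ => poissonSumProb_nonneg hK0 N j
    rw [pow_zero]
    exact le_add_of_le_of_nonneg hle (by positivity)
  | succ i ih =>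
    rw [Nat.cast_add, Nat.cast_one] at hn
    refine (poissonSumProb_le_of_forall_le hK0 hK (c := c₁ + ε)
      (B := (c₁ / (c₁ + ε)) ^ i + T / ε) (by positivity) hN (by positivity) hT
      (by nlinarith [mul_nonneg i.cast_nonneg hx]) fun l hl hlx => ih (n - l) ?_).trans_eq ?_
    · rw [Nat.cast_sub hl]
      linarith
    · rw [pow_succ]
      field_simp
      ring

theorem tendsto_natCast_mul_pow_ceil_rpow {β ρ : ℝ} (hβ : 0 < β) (hρ0 : 0 ≤ ρ) (hρ1 : ρ < 1) :
    Tendsto (fun N : ℕ => (N : ℝ) * ρ ^ ⌈(N : ℝ) ^ β⌉₊) atTop (𝓝 0) := by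
  obtain ⟨p, hp⟩ := exists_nat_ge β⁻¹
  rw [inv_le_iff_one_le_mul₀ hβ, mul_comm] at hp
  have hpow : Tendsto (fun N : ℕ => (N : ℝ) ^ β) atTop atTop :=
    (tendsto_rpow_atTop hβ).comp tendsto_natCast_atTop_atTop
  refine squeeze_zero' (Eventually.of_forall fun N => by positivity) ?_
    ((tendsto_pow_const_mul_const_pow_of_abs_lt_one p (by rwa [abs_of_nonneg hρ0])).comp
      (tendsto_nat_ceil_atTop.comp hpow))
  filter_upwards [eventually_ge_atTop 1] with N hN
  refine mul_le_mul_of_nonneg_right ?_ (pow_nonneg hρ0 _)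
  calc (N : ℝ) ≤ (N : ℝ) ^ (β * p) := Real.self_le_rpow_of_one_le (by exact_mod_cast hN) hp
    _ = ((N : ℝ) ^ β) ^ p := by rw [Real.rpow_mul N.cast_nonneg, Real.rpow_natCast]
    _ ≤ (⌈(N : ℝ) ^ β⌉₊ : ℝ) ^ p := by
        gcongr
        exact Nat.le_ceil _

theorem tendsto_natCast_mul_div_ceil_rpow {a β σ : ℝ} (ha : 0 < a) (hβ : 0 ≤ β) (hσ : 0 < σ)
    (hβσ : 1 < σ * (1 - β)) :
    Tendsto (fun N : ℕ => (N : ℝ) * (a * N / ⌈(N : ℝ) ^ β⌉₊) ^ (-σ)) atTop (𝓝 0) := by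
  have hlim : Tendsto (fun N : ℕ => (a / 2) ^ (-σ) * (N : ℝ) ^ (-(σ * (1 - β) - 1))) atTop
      (𝓝 ((a / 2) ^ (-σ) * 0)) :=
    ((tendsto_rpow_neg_atTop (sub_pos.2 hβσ)).comp tendsto_natCast_atTop_atTop).const_mul _
  rw [mul_zero] at hlim
  refine squeeze_zero' (Eventually.of_forall fun N => by positivity) ?_ hlim
  filter_upwards [eventually_ge_atTop 1] with N hN
  have hN1 : (1 : ℝ) ≤ N := by exact_mod_cast hN
  have hN0 : (0 : ℝ) < N := by linarith
  have hceil : (⌈(N : ℝ) ^ β⌉₊ : ℝ) ≤ 2 * (N : ℝ) ^ β := by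
    linarith [Nat.ceil_lt_add_one (Real.rpow_nonneg hN0.le β), Real.one_le_rpow hN1 hβ]
  have hceil0 : (0 : ℝ) < ⌈(N : ℝ) ^ β⌉₊ := Nat.cast_pos.2 (Nat.ceil_pos.2 (by positivity))
  have hwidth : a / 2 * (N : ℝ) ^ (1 - β) ≤ a * N / ⌈(N : ℝ) ^ β⌉₊ := by
    rw [Real.rpow_sub hN0, Real.rpow_one, le_div_iff₀ hceil0]
    calc a / 2 * (N / (N : ℝ) ^ β) * ⌈(N : ℝ) ^ β⌉₊
        ≤ a / 2 * (N / (N : ℝ) ^ β) * (2 * (N : ℝ) ^ β) := by gcongr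
      _ = a * N := by field_simp
  calc (N : ℝ) * (a * N / ⌈(N : ℝ) ^ β⌉₊) ^ (-σ)
      ≤ N * (a / 2 * (N : ℝ) ^ (1 - β)) ^ (-σ) := by
        gcongr _ * ?_
        exact Real.rpow_le_rpow_of_nonpos (by positivity) hwidth (by linarith)
    _ = (a / 2) ^ (-σ) * (N : ℝ) ^ (-(σ * (1 - β) - 1)) := by
        rw [Real.mul_rpow (by positivity) (by positivity), ← Real.rpow_mul hN0.le, mul_left_comm,
          mul_comm (N : ℝ), ← Real.rpow_add_one hN0.ne']
        ring_nf

/-- Each jump of size at most `ε N ^ (1 - β) / 2` gains a factor `c₁ / (c₁ + ε / 2)`, and `N ^ β`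
such jumps cannot cover the distance `ε N`; a longer jump contributes `O (N ^ (-σ (1 - β)))`, which
is `o (N ^ (-1))` for the chosen `β`. -/
theorem eventually_natCast_mul_poissonSumProb_le (hK0 : ∀ j, 0 ≤ K j) (hK : HasSum K c₁) {σ : ℝ}
    (hσ : 1 < σ) (hKO : K =O[atTop] fun j => (j : ℝ) ^ (-σ)) {ε τ : ℝ} (hε : 0 < ε) (hτ : 0 < τ) :
    ∀ᶠ N : ℕ in atTop, ∀ n : ℕ, (c₁ + ε) * N ≤ n → N * poissonSumProb K N n ≤ τ := by
  have hc₁ : 0 ≤ c₁ := hK.nonneg hK0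
  have hσ0 : 0 < σ := by linarith
  obtain ⟨C, hC0, hC⟩ := bound_of_isBigO_nat_atTop hKO
  have htail {x : ℝ} (hx : 0 < x) (l : ℕ) (hl : x < l) : K l ≤ C * x ^ (-σ) := by
    have hl0 : (0 : ℝ) < l := hx.trans hl
    have hKl := hC (Real.rpow_pos_of_pos hl0 (-σ)).ne'
    rw [Real.norm_of_nonneg (hK0 l), Real.norm_of_nonneg (by positivity)] at hKl
    exact hKl.trans (mul_le_mul_of_nonneg_left
      (Real.rpow_le_rpow_of_nonpos hx hl.le (by linarith)) hC0.le)
  set β := (σ - 1) / (2 * σ) with hβ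
  have hβ0 : 0 < β := div_pos (by linarith) (by positivity)
  have hβσ : 1 < σ * (1 - β) := by
    rw [hβ, mul_sub, mul_one, mul_div_assoc', mul_comm 2, mul_div_mul_left _ _ hσ0.ne']
    linarith
  have hlim := (tendsto_natCast_mul_pow_ceil_rpow hβ0 (ρ := c₁ / (c₁ + ε / 2)) (by positivity)
    ((div_lt_one (by positivity)).2 (by linarith))).add
    ((tendsto_natCast_mul_div_ceil_rpow (a := ε / 2) (by positivity) hβ0.le hσ0 hβσ).const_mul
      (C / (ε / 2)))
  rw [mul_zero, add_zero] at hlim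
  filter_upwards [hlim.eventually_le_const hτ, eventually_gt_atTop 0] with N hNτ hN n hn
  have hN0 : (0 : ℝ) < N := Nat.cast_pos.2 hN
  have hceil0 : (0 : ℝ) < ⌈(N : ℝ) ^ β⌉₊ := Nat.cast_pos.2 (Nat.ceil_pos.2 (by positivity))
  have hx : 0 < ε / 2 * N / ⌈(N : ℝ) ^ β⌉₊ := by positivity
  calc (N : ℝ) * poissonSumProb K N n
      ≤ N * ((c₁ / (c₁ + ε / 2)) ^ ⌈(N : ℝ) ^ β⌉₊ +
          C * (ε / 2 * N / ⌈(N : ℝ) ^ β⌉₊) ^ (-σ) / (ε / 2)) := by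
        refine mul_le_mul_of_nonneg_left (poissonSumProb_le_pow_add hK0 hK (by positivity) hx.le
          (htail hx) hN _ n ?_) hN0.le
        rw [mul_div_cancel₀ _ hceil0.ne']
        linarith
    _ ≤ τ := by
        convert! hNτ using 1
        ring

end PoissonSum

/-- The weights `T_j + N K_j`, where `T_j` and `K_j` stand for `θ_j R^j` and `κ_j R^j`. -/
noncomputable def mixWeight (T K : ℕ → ℝ) (N j : ℕ) : ℝ := T j + N * K j

/-- The coefficient of `z^n` in `exp (∑_j (T_j / j) z^j) exp (N ∑_j (K_j / j) (z^j - 1))`. -/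
noncomputable def mixedCoeff (T K : ℕ → ℝ) (N n : ℕ) : ℝ :=
  Real.exp (-(N * ∑' j, K j / j)) * expCoeff (mixWeight T K N) n

theorem mixedCoeff_eq_sum (T K : ℕ → ℝ) (N n : ℕ) :
    mixedCoeff T K N n =
      ∑ j ∈ Finset.range (n + 1), poissonSumProb K N j * expCoeff T (n - j) := by
  have hconv := (expCoeff_add (fun j => (N : ℝ) * K j) T n).trans
    (Finset.Nat.sum_antidiagonal_eq_sum_range_succ
      (fun i j => expCoeff (fun j => (N : ℝ) * K j) i * expCoeff T j) n)
  have hadd : mixWeight T K N = (fun j => (N : ℝ) * K j) + T :=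
    funext fun j => add_comm _ _
  rw [mixedCoeff, hadd, hconv, Finset.mul_sum]
  simp only [poissonSumProb, mul_assoc]

theorem tendsto_tsum_mul_of_concentrated {q g : ℕ → ℕ → ℝ} {c L M : ℝ} (hq0 : ∀ N j, 0 ≤ q N j)
    (hq : ∀ N, HasSum (q N) 1)
    (hfar : ∀ ε > 0, Tendsto (fun N : ℕ => ∑' j, {j : ℕ | ε < |(j : ℝ) / N - c|}.indicator (q N) j)
      atTop (𝓝 0))
    (hM : ∀ᶠ N in atTop, ∀ j, |g N j| ≤ M)
    (hg : Tendsto (fun p : ℕ × ℕ => g p.1 p.2)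
      (comap (fun p : ℕ × ℕ => (p.2 : ℝ) / p.1) (𝓝 c) ⊓ comap Prod.fst atTop) (𝓝 L)) :
    Tendsto (fun N => ∑' j, q N j * g N j) atTop (𝓝 L) := by
  refine Metric.tendsto_nhds.2 fun τ hτ => ?_
  obtain ⟨⟨δ, N₀⟩, ⟨hδ, -⟩, hnear⟩ := ((Metric.nhds_basis_closedBall.comap _).inf
    (atTop_basis.comap _)).eventually_iff.1 (Metric.tendsto_nhds.1 hg (τ / 2) (half_pos hτ))
  have hfar' := (hfar δ hδ).const_mul (|M| + |L|)
  rw [mul_zero] at hfar'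
  filter_upwards [hM, hfar'.eventually_lt_const (half_pos hτ), eventually_ge_atTop N₀]
    with N hMN hfarN hN
  have hsummable : Summable fun j => q N j * g N j :=
    Summable.of_norm_bounded ((hq N).summable.mul_right M) fun j => by
      rw [norm_mul, Real.norm_of_nonneg (hq0 N j)]
      exact mul_le_mul_of_nonneg_left (hMN j) (hq0 N j)
  have hdiff : HasSum (fun j => q N j * (g N j - L)) (∑' j, q N j * g N j - L) := by
    simpa only [mul_sub, one_mul] using hsummable.hasSum.sub ((hq N).mul_right L)
  have hbound : HasSum (fun j => τ / 2 * q N j + (|M| + |L|) *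
      {j : ℕ | δ < |(j : ℝ) / N - c|}.indicator (q N) j) _ :=
    ((hq N).mul_left (τ / 2)).add (((hq N).summable.indicator _).hasSum.mul_left (|M| + |L|))
  have hle (j : ℕ) : ‖q N j * (g N j - L)‖ ≤ τ / 2 * q N j + (|M| + |L|) *
      {j : ℕ | δ < |(j : ℝ) / N - c|}.indicator (q N) j := by
    rw [norm_mul, Real.norm_of_nonneg (hq0 N j), mul_comm (q N j)]
    by_cases hj : δ < |(j : ℝ) / N - c|
    · rw [Set.indicator_of_mem (by exact hj), ← add_mul]
      refine mul_le_mul_of_nonneg_right ?_ (hq0 N j)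
      linarith [abs_sub (g N j) L, hMN j, le_abs_self M, Real.norm_eq_abs (g N j - L)]
    · rw [Set.indicator_of_notMem (by exact hj), mul_zero, add_zero]
      have hnearj : dist (g N j) L < τ / 2 := hnear (x := (N, j)) ⟨not_lt.1 hj, hN⟩
      exact mul_le_mul_of_nonneg_right hnearj.le (hq0 N j)
  rw [Real.dist_eq, ← hdiff.tsum_eq]
  refine (tsum_of_norm_bounded hbound hle).trans_lt ?_
  linarith

theorem isBigO_rpow_comp_of_tendsto_div {n : ℕ → ℕ} {v s : ℝ} (hv : v ≠ 0)
    (hn : Tendsto (fun N : ℕ => (n N : ℝ) / N) atTop (𝓝 v)) :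
    (fun N => (n N : ℝ) ^ s) =O[atTop] fun N : ℕ => (N : ℝ) ^ s := by
  refine ((hn.rpow_const (p := s) (Or.inl hv)).isBigO_one ℝ).mul
    (isBigO_refl (fun N : ℕ => (N : ℝ) ^ s) atTop) |>.congr' ?_ (by simp)
  filter_upwards [eventually_gt_atTop 0] with N hN
  have hN0 : (0 : ℝ) < N := Nat.cast_pos.2 hN
  rw [Real.div_rpow (n N).cast_nonneg hN0.le, div_mul_cancel₀ _ (by positivity)]

theorem tendsto_rpow_mul_sum_filter_le {q : ℕ → ℕ → ℝ} {b : ℕ → ℝ} {n : ℕ → ℕ} {s v x : ℝ}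
    (hq0 : ∀ N j, 0 ≤ q N j) (hb0 : ∀ k, 0 ≤ b k)
    (hb : (fun n => ∑ i ∈ Finset.range (n + 1), b i) =O[atTop] fun n : ℕ => (n : ℝ) ^ s)
    (hq : ∀ τ > 0, ∀ᶠ N : ℕ in atTop, ∀ j : ℕ, x * N ≤ j → N * q N j ≤ τ) (hv : 0 < v)
    (hn : Tendsto (fun N : ℕ => (n N : ℝ) / N) atTop (𝓝 v)) :
    Tendsto (fun N : ℕ => (N : ℝ) ^ (1 - s) *
      ∑ j ∈ (Finset.range (n N + 1)).filter (fun j : ℕ => x * N ≤ (j : ℝ)),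
        q N j * b (n N - j)) atTop (𝓝 0) := by
  have hbound : (fun N : ℕ => (N : ℝ) ^ (-s) * ∑ i ∈ Finset.range (n N + 1), b i) =O[atTop]
      fun _ => (1 : ℝ) := by
    refine ((isBigO_refl (fun N : ℕ => (N : ℝ) ^ (-s)) atTop).mul
      ((hb.comp_tendsto (tendsto_atTop_of_tendsto_div hv tendsto_id hn)).trans
        (isBigO_rpow_comp_of_tendsto_div hv.ne' hn))).congr' EventuallyEq.rfl ?_
    filter_upwards [eventually_gt_atTop 0] with N hN
    rw [← Real.rpow_add (Nat.cast_pos.2 hN), neg_add_cancel, Real.rpow_zero]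
  refine (isLittleO_one_iff ℝ).1 (IsLittleO.trans_isBigO (isLittleO_iff.2 fun τ hτ => ?_) hbound)
  filter_upwards [hq τ hτ, eventually_gt_atTop 0] with N hqN hN
  have hN0 : (0 : ℝ) < N := Nat.cast_pos.2 hN
  have hsum : N * ∑ j ∈ (Finset.range (n N + 1)).filter (fun j : ℕ => x * N ≤ (j : ℝ)),
        q N j * b (n N - j) ≤
      τ * ∑ i ∈ Finset.range (n N + 1), b i := by
    rw [← Finset.sum_range_reflect b (n N + 1), Finset.mul_sum, Finset.mul_sum]
    refine (Finset.sum_le_sum fun j hj => ?_).trans (Finset.sum_le_sum_of_subset_of_nonneg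
      (Finset.filter_subset _ _) fun j _ _ => mul_nonneg hτ.le (hb0 _))
    rw [← mul_assoc]
    exact mul_le_mul_of_nonneg_right (hqN j (Finset.mem_filter.1 hj).2) (hb0 _)
  have hsum0 : 0 ≤ ∑ j ∈ (Finset.range (n N + 1)).filter (fun j : ℕ => x * N ≤ (j : ℝ)),
        q N j * b (n N - j) :=
    Finset.sum_nonneg fun j _ => mul_nonneg (hq0 N j) (hb0 _)
  rw [Real.norm_of_nonneg (by positivity), Real.norm_of_nonneg
    (mul_nonneg (by positivity) (Finset.sum_nonneg fun i _ => hb0 i)), sub_eq_neg_add,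
    Real.rpow_add_one hN0.ne', mul_assoc, mul_left_comm τ]
  gcongr

theorem exists_forall_abs_rpow_mul_le {b : ℕ → ℝ} {s L : ℝ}
    (hb : Tendsto (fun n : ℕ => (n : ℝ) ^ (1 - s) * b n) atTop (𝓝 L)) {y z : ℝ} (hy : 0 < y) :
    ∃ M : ℝ, ∀ N k : ℕ, 0 < N → y ≤ (k : ℝ) / N → (k : ℝ) / N ≤ z →
      |(N : ℝ) ^ (1 - s) * b k| ≤ M := by
  obtain ⟨D, hD⟩ := hb.abs.bddAbove_range
  have hcont : ContinuousOn (fun r : ℝ => r ^ (s - 1)) (Set.Icc y z) := fun r hr =>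
    (Real.continuousAt_rpow_const r _ (Or.inl (hy.trans_le hr.1).ne')).continuousWithinAt
  obtain ⟨E, hE⟩ := isCompact_Icc.exists_bound_of_continuousOn hcont
  refine ⟨D * E, fun N k hN hyk hkz => ?_⟩
  have hN0 : (0 : ℝ) < N := Nat.cast_pos.2 hN
  have hk0 : (0 : ℝ) < k := (div_pos_iff_of_pos_right hN0).1 (hy.trans_le hyk)
  rw [rpow_one_sub_mul_eq hN0 hk0, abs_mul]
  exact mul_le_mul (hD ⟨k, rfl⟩) (hE _ ⟨hyk, hkz⟩) (abs_nonneg _)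
    ((abs_nonneg _).trans (hD ⟨k, rfl⟩))

section MixedCoeff

variable {K ε : ℕ → ℝ} {c₁ σ s v : ℝ} {n : ℕ → ℕ}

theorem tendsto_tsum_poissonSumProb_mul_expCoeff (hK0 : ∀ j, 0 ≤ K j) (hK : HasSum K c₁)
    (hK00 : K 0 = 0) (hs : 0 < s) (h0 : Tendsto ε atTop (𝓝 0))
    (hsum : Summable fun j => |ε j| / j) {x : ℝ} (hx : c₁ < x) (hxv : x < v)
    (hn : Tendsto (fun N : ℕ => (n N : ℝ) / N) atTop (𝓝 v)) :
    Tendsto (fun N : ℕ => ∑' j, poissonSumProb K N j *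
      {j : ℕ | (j : ℝ) < x * N ∧ j ≤ n N}.indicator
        (fun j => (N : ℝ) ^ (1 - s) * expCoeff (fun j => s + ε j) (n N - j)) j) atTop
      (𝓝 ((Real.Gamma s)⁻¹ * Real.exp (∑' j, ε j / j) * (v - c₁) ^ (s - 1))) := by
  obtain ⟨M, hM⟩ := exists_forall_abs_rpow_mul_le (tendsto_rpow_mul_expCoeff hs h0 hsum)
    (y := (v - x) / 2) (z := v + 1) (by linarith)
  refine tendsto_tsum_mul_of_concentrated (c := c₁) (M := |M|) (poissonSumProb_nonneg hK0)
    (hasSum_poissonSumProb hK0 (summable_div_natCast hK0 hK.summable))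
    (fun δ hδ => tendsto_tsum_indicator_poissonSumProb hK0 hK hK00 hδ) ?_ ?_
  · filter_upwards [hn.eventually_const_le (by linarith : (v + x) / 2 < v),
      hn.eventually_le_const (lt_add_one v), eventually_gt_atTop 0] with N hlow hup hN j
    have hN0 : (0 : ℝ) < N := Nat.cast_pos.2 hN
    by_cases hj : (j : ℝ) < x * N ∧ j ≤ n N
    · rw [Set.indicator_of_mem (by exact hj)]
      have hjx : (j : ℝ) / N < x := (div_lt_iff₀ hN0).2 hj.1
      have hj0 : 0 ≤ (j : ℝ) / N := by positivity
      have hcast : ((n N - j : ℕ) : ℝ) / N = n N / N - j / N := by rw [Nat.cast_sub hj.2, sub_div]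
      exact (hM N _ hN (by linarith) (by linarith)).trans (le_abs_self M)
    · rw [Set.indicator_of_notMem (by exact hj), abs_zero]
      exact abs_nonneg M
  · set l : Filter (ℕ × ℕ) :=
      comap (fun p : ℕ × ℕ => (p.2 : ℝ) / p.1) (𝓝 c₁) ⊓ comap Prod.fst atTop
    have hfst : Tendsto (fun p : ℕ × ℕ => p.1) l atTop := tendsto_comap.mono_left inf_le_right
    have hdiv : Tendsto (fun p : ℕ × ℕ => (p.2 : ℝ) / p.1) l (𝓝 c₁) :=
      tendsto_comap.mono_left inf_le_left
    have hmem : ∀ᶠ p in l, (p.2 : ℝ) < x * p.1 ∧ p.2 ≤ n p.1 := by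
      filter_upwards [hdiv.eventually_lt_const hx, (hn.comp hfst).eventually_const_lt hxv,
        hfst.eventually_gt_atTop 0] with p hp hnp hp0
      have hp0' : (0 : ℝ) < p.1 := Nat.cast_pos.2 hp0
      have hpx := (div_lt_iff₀ hp0').1 hp
      exact ⟨hpx, by exact_mod_cast (hpx.trans ((lt_div_iff₀ hp0').1 hnp)).le⟩
    refine (tendsto_rpow_mul_expCoeff_comp hs h0 hsum (k := fun p => n p.1 - p.2)
      (by linarith : 0 < v - c₁) hfst (((hn.comp hfst).sub hdiv).congr' ?_)).congr' ?_
    · filter_upwards [hmem] with p hp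
      rw [Nat.cast_sub hp.2, sub_div]
      rfl
    · filter_upwards [hmem] with p hp
      rw [Set.indicator_of_mem (by exact hp)]

theorem tendsto_rpow_mul_mixedCoeff (hK0 : ∀ j, 0 ≤ K j) (hK : HasSum K c₁) (hK00 : K 0 = 0)
    (hσ : 1 < σ) (hKO : K =O[atTop] fun j => (j : ℝ) ^ (-σ)) (hs : 0 < s)
    (h0 : Tendsto ε atTop (𝓝 0)) (hsum : Summable fun j => |ε j| / j)
    (hT0 : ∀ j, 1 ≤ j → 0 ≤ s + ε j) (hv : c₁ < v)
    (hn : Tendsto (fun N : ℕ => (n N : ℝ) / N) atTop (𝓝 v)) :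
    Tendsto (fun N : ℕ => (N : ℝ) ^ (1 - s) * mixedCoeff (fun j => s + ε j) K N (n N)) atTop
      (𝓝 ((Real.Gamma s)⁻¹ * Real.exp (∑' j, ε j / j) * (v - c₁) ^ (s - 1))) := by
  obtain ⟨x, hx, hxv⟩ := exists_between hv
  have hupper := tendsto_rpow_mul_sum_filter_le (q := poissonSumProb K) (x := x)
    (poissonSumProb_nonneg hK0) (expCoeff_nonneg hT0) (isBigO_sum_expCoeff hs h0 hsum)
    (fun τ hτ => by
      simpa only [add_sub_cancel] using
        eventually_natCast_mul_poissonSumProb_le hK0 hK hσ hKO (sub_pos.2 hx) hτ)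
    ((hK.nonneg hK0).trans_lt hv) hn
  have hlim :=
    (tendsto_tsum_poissonSumProb_mul_expCoeff hK0 hK hK00 hs h0 hsum hx hxv hn).add hupper
  rw [add_zero] at hlim
  refine hlim.congr fun N => ?_
  rw [mixedCoeff_eq_sum, ← Finset.sum_filter_not_add_sum_filter (Finset.range (n N + 1))
    (fun j : ℕ => x * N ≤ (j : ℝ)),
    mul_add]
  congr 1
  have hmem (j : ℕ) : j ∈ (Finset.range (n N + 1)).filter (fun j : ℕ => ¬ x * N ≤ (j : ℝ)) ↔
      (j : ℝ) < x * N ∧ j ≤ n N := by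
    rw [Finset.mem_filter, Finset.mem_range, not_le, Nat.lt_succ_iff, and_comm]
  rw [Finset.mul_sum, tsum_eq_sum
    (s := (Finset.range (n N + 1)).filter fun j : ℕ => ¬ x * N ≤ (j : ℝ))]
  · refine Finset.sum_congr rfl fun j hj => ?_
    rw [Set.indicator_of_mem (by exact (hmem j).1 hj)]
    ring
  · intro j hj
    rw [Set.indicator_of_notMem (by exact fun h => hj ((hmem j).2 h)), mul_zero]

end MixedCoeff

/-! ### Removing one cycle from a permutation -/

section Permutations

variable {N : ℕ} {σ τ σ' : Equiv.Perm (Fin N)} {S C : Finset (Fin N)} {i k x : Fin N}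

theorem mem_cycleSet : k ∈ cycleSet σ i ↔ σ.SameCycle i k := by
  rw [cycleSet, Finset.mem_filter_univ]

theorem self_mem_cycleSet (σ : Equiv.Perm (Fin N)) (i : Fin N) : i ∈ cycleSet σ i :=
  mem_cycleSet.2 (Equiv.Perm.SameCycle.refl σ i)

theorem apply_mem_cycleSet (h : k ∈ cycleSet σ i) : σ k ∈ cycleSet σ i :=
  mem_cycleSet.2 (Equiv.Perm.sameCycle_apply_right.2 (mem_cycleSet.1 h))

theorem card_cycleSet_pos (σ : Equiv.Perm (Fin N)) (i : Fin N) : 0 < (cycleSet σ i).card :=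
  Finset.card_pos.2 ⟨i, self_mem_cycleSet σ i⟩

theorem card_cycleSet_le (σ : Equiv.Perm (Fin N)) (i : Fin N) : (cycleSet σ i).card ≤ N :=
  (Finset.card_le_univ _).trans_eq (Fintype.card_fin N)

theorem cycleSet_eq_of_mem (h : k ∈ cycleSet σ i) : cycleSet σ k = cycleSet σ i := by
  have hik := mem_cycleSet.1 h
  ext m
  rw [mem_cycleSet, mem_cycleSet]
  exact ⟨hik.trans, hik.symm.trans⟩

theorem cycleSet_eq_singleton (h : σ i = i) : cycleSet σ i = {i} := by
  ext k
  rw [mem_cycleSet, Finset.mem_singleton]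
  exact ⟨fun h' => (h'.eq_of_left h).symm, fun h' => h' ▸ Equiv.Perm.SameCycle.refl σ _⟩

theorem card_cycleSet_eq_one_iff : (cycleSet σ i).card = 1 ↔ σ i = i := by
  refine ⟨fun h => ?_, fun h => by rw [cycleSet_eq_singleton h, Finset.card_singleton]⟩
  exact Finset.card_le_one.1 h.le _ (apply_mem_cycleSet (self_mem_cycleSet σ i)) _
    (self_mem_cycleSet σ i)

theorem cycleSet_eq_support_cycleOf (h : σ i ≠ i) : cycleSet σ i = (σ.cycleOf i).support := by
  ext k
  rw [mem_cycleSet, Equiv.Perm.mem_support_cycleOf_iff' h]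

theorem cycleSet_congr (hmaps : ∀ i ∈ S, σ i ∈ S) (heq : ∀ i ∈ S, σ i = τ i) (hi : i ∈ S) :
    cycleSet σ i = cycleSet τ i := by
  have hpow (n : ℕ) : (σ ^ n) i ∈ S ∧ (σ ^ n) i = (τ ^ n) i := by
    induction n with
    | zero => exact ⟨hi, rfl⟩
    | succ n ih =>
      rw [pow_succ', pow_succ', Equiv.Perm.mul_apply, Equiv.Perm.mul_apply]
      exact ⟨hmaps _ ih.1, by rw [heq _ ih.1, ih.2]⟩
  ext k
  rw [mem_cycleSet, mem_cycleSet]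
  constructor <;> intro h <;> obtain ⟨n, hn⟩ := h.exists_nat_pow_eq
  · exact ⟨n, by rwa [zpow_natCast, ← (hpow n).2]⟩
  · exact ⟨n, by rwa [zpow_natCast, (hpow n).2]⟩

theorem filter_card_cycleSet_eq_biUnion {j : ℕ} (hj : 2 ≤ j) :
    Finset.univ.filter (fun i => (cycleSet σ i).card = j) =
      (σ.cycleFactorsFinset.filter fun c => j = (Finset.card ∘ Equiv.Perm.support) c).biUnion
        Equiv.Perm.support := by
  ext i
  rw [Finset.mem_filter_univ, Finset.mem_biUnion]
  constructor
  · intro h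
    have hi : σ i ≠ i := fun h' => by rw [card_cycleSet_eq_one_iff.2 h'] at h; omega
    rw [cycleSet_eq_support_cycleOf hi] at h
    exact ⟨σ.cycleOf i, Finset.mem_filter.2 ⟨Equiv.Perm.cycleOf_mem_cycleFactorsFinset_iff.2
      (Equiv.Perm.mem_support.2 hi), h.symm⟩,
      cycleSet_eq_support_cycleOf hi ▸ self_mem_cycleSet σ i⟩
  · rintro ⟨c, hc, hi⟩
    obtain ⟨hcσ, hcj⟩ := Finset.mem_filter.1 hc
    rw [cycleSet_eq_support_cycleOf (Equiv.Perm.mem_support.1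
      (Equiv.Perm.mem_cycleFactorsFinset_support_le hcσ hi)),
      ← (Equiv.Perm.eq_cycleOf_of_mem_cycleFactorsFinset_iff σ c hcσ i).2 hi]
    exact hcj.symm

theorem mul_cycleCount (σ : Equiv.Perm (Fin N)) {j : ℕ} (hj : 1 ≤ j) :
    j * cycleCount σ j = (Finset.univ.filter fun i => (cycleSet σ i).card = j).card := by
  rw [cycleCount, Equiv.Perm.parts_partition, Multiset.count_add, Multiset.count_replicate]
  obtain rfl | hj2 := hj.eq_or_lt
  · have hcount : Multiset.count 1 σ.cycleType = 0 :=
      Multiset.count_eq_zero.2 fun h => by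
        have := Equiv.Perm.two_le_of_mem_cycleType h
        omega
    rw [hcount, if_pos rfl, zero_add, one_mul, ← Finset.card_compl]
    congr 1
    ext i
    rw [Finset.mem_compl, Equiv.Perm.notMem_support, Finset.mem_filter_univ,
      card_cycleSet_eq_one_iff]
  · rw [if_neg hj2.ne, add_zero, Equiv.Perm.cycleType_def, Multiset.count_map,
      filter_card_cycleSet_eq_biUnion hj2, Finset.card_biUnion]
    · rw [Finset.sum_congr rfl fun c hc => (Finset.mem_filter.1 hc).2.symm, Finset.sum_const,
        smul_eq_mul, mul_comm]
      rfl
    · exact fun c hc d hd hcd => Equiv.Perm.disjoint_iff_disjoint_support.1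
        (Equiv.Perm.cycleFactorsFinset_pairwise_disjoint σ (Finset.mem_filter.1 hc).1
          (Finset.mem_filter.1 hd).1 hcd)

/-- The permutations that fix every element of `S`. -/
def permFixing (S : Finset (Fin N)) : Finset (Equiv.Perm (Fin N)) :=
  Finset.univ.filter fun σ => ∀ i ∈ S, σ i = i

/-- The permutations that act on `C` as one cycle, containing `x`, and fix everything else. -/
def cyclicOn (C : Finset (Fin N)) (x : Fin N) : Finset (Equiv.Perm (Fin N)) :=
  Finset.univ.filter fun τ => (∀ i, i ∉ C → τ i = i) ∧ cycleSet τ x = C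

theorem mem_permFixing : σ ∈ permFixing S ↔ ∀ i ∈ S, σ i = i := Finset.mem_filter_univ _

theorem mem_cyclicOn : τ ∈ cyclicOn C x ↔ (∀ i, i ∉ C → τ i = i) ∧ cycleSet τ x = C :=
  Finset.mem_filter_univ _

theorem permFixing_empty : permFixing (∅ : Finset (Fin N)) = Finset.univ :=
  Finset.filter_true_of_mem fun _ _ i hi => absurd hi (Finset.notMem_empty i)

theorem permFixing_univ : permFixing (Finset.univ : Finset (Fin N)) = {1} := by
  ext σ
  rw [mem_permFixing, Finset.mem_singleton, Equiv.ext_iff]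
  exact ⟨fun h i => h i (Finset.mem_univ i), fun h i _ => h i⟩

theorem cyclicOn_singleton (x : Fin N) : cyclicOn {x} x = {1} := by
  ext τ
  rw [mem_cyclicOn, Finset.mem_singleton]
  constructor
  · rintro ⟨hfix, hx⟩
    ext i
    by_cases hi : i = x
    · rw [hi, card_cycleSet_eq_one_iff.1 (hx ▸ Finset.card_singleton x), Equiv.Perm.one_apply]
    · rw [hfix i (Finset.notMem_singleton.2 hi), Equiv.Perm.one_apply]
  · rintro rfl
    exact ⟨fun _ _ => rfl, cycleSet_eq_singleton rfl⟩

theorem mem_cyclicOn_iff_isCycle (hC : 2 ≤ C.card) (hx : x ∈ C) :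
    τ ∈ cyclicOn C x ↔ τ.IsCycle ∧ τ.support = C := by
  rw [mem_cyclicOn]
  constructor
  · rintro ⟨hfix, hcycle⟩
    have hxne : τ x ≠ x := fun h => by
      rw [← hcycle, card_cycleSet_eq_one_iff.2 h] at hC
      omega
    have hsame (i : Fin N) : τ.SameCycle x i ↔ τ i ≠ i := by
      refine ⟨fun h hi => hxne (h.apply_eq_self_iff.2 hi), fun hi => ?_⟩
      rw [← mem_cycleSet, hcycle]
      exact not_not.1 (mt (hfix i) hi)
    refine ⟨(Equiv.Perm.isCycle_iff_sameCycle hxne).2 fun {i} => hsame i, ?_⟩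
    ext i
    rw [Equiv.Perm.mem_support, ← hsame, ← mem_cycleSet, hcycle]
  · rintro ⟨hcycle, rfl⟩
    refine ⟨fun i hi => Equiv.Perm.notMem_support.1 hi, ?_⟩
    ext i
    rw [mem_cycleSet, (Equiv.Perm.isCycle_iff_sameCycle (Equiv.Perm.mem_support.1 hx)).1 hcycle,
      Equiv.Perm.mem_support]

theorem ofSubtype_mem_cyclicOn_iff (hC : 2 ≤ C.card) (hx : x ∈ C)
    (g : Equiv.Perm {i // i ∈ C}) :
    Equiv.Perm.ofSubtype g ∈ cyclicOn C x ↔ g.cycleType = {C.card} := by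
  rw [mem_cyclicOn_iff_isCycle hC hx, ← Equiv.Perm.cycleType_ofSubtype]
  refine ⟨fun h => by rw [h.1.cycleType, h.2], fun h => ?_⟩
  have hcycle : (Equiv.Perm.ofSubtype g).IsCycle := by
    rw [← Equiv.Perm.card_cycleType_eq_one, h, Multiset.card_singleton]
  rw [hcycle.cycleType, Multiset.singleton_inj] at h
  refine ⟨hcycle, Finset.eq_of_subset_of_card_le (fun i hi => ?_) h.ge⟩
  exact not_not.1 (mt (Equiv.Perm.ofSubtype_apply_of_not_mem g) (Equiv.Perm.mem_support.1 hi))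

theorem card_cyclicOn (hx : x ∈ C) : (cyclicOn C x).card = (C.card - 1).factorial := by
  obtain hC | hC := Nat.lt_or_ge C.card 2
  · obtain rfl : C = {x} := Finset.eq_singleton_iff_unique_mem.2 ⟨hx, fun y hy =>
      Finset.card_le_one.1 (Nat.le_of_lt_succ hC) y hy x hx⟩
    rw [cyclicOn_singleton, Finset.card_singleton, Finset.card_singleton, Nat.factorial_zero]
  · have hcard := Equiv.Perm.card_of_cycleType_singleton (α := {i // i ∈ C}) hC
      (Fintype.card_coe C).ge
    rw [Fintype.card_coe, Nat.choose_self, mul_one] at hcard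
    rw [← hcard, ← Finset.card_image_of_injective _ Equiv.Perm.ofSubtype_injective]
    congr 1
    ext τ
    simp only [Finset.mem_image, Finset.mem_filter_univ, ← ofSubtype_mem_cyclicOn_iff hC hx]
    refine ⟨fun hτ => ?_, fun ⟨_, hg, hgτ⟩ => hgτ ▸ hg⟩
    have hsupport := ((mem_cyclicOn_iff_isCycle hC hx).1 hτ).2
    have hinv (i : Fin N) : τ i ∈ C ↔ i ∈ C := by rw [← hsupport, Equiv.Perm.apply_mem_support]
    have hof : Equiv.Perm.ofSubtype (τ.subtypePerm hinv) = τ :=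
      Equiv.Perm.ofSubtype_subtypePerm _ fun i hi => hsupport ▸ Equiv.Perm.mem_support.2 hi
    exact ⟨_, hof.symm ▸ hτ, hof⟩

theorem disjoint_cycleSet (hσ : σ ∈ permFixing S) (hx : x ∉ S) : Disjoint (cycleSet σ x) S := by
  refine Finset.disjoint_left.2 fun k hk hkS => hx ?_
  have hxk := self_mem_cycleSet σ x
  rw [← cycleSet_eq_of_mem hk, cycleSet_eq_singleton (mem_permFixing.1 hσ k hkS),
    Finset.mem_singleton] at hxk
  exact hxk ▸ hkS

theorem mul_apply_of_mem (hσ' : σ' ∈ permFixing (S ∪ C)) (hi : i ∈ C) : (τ * σ') i = τ i := by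
  rw [Equiv.Perm.mul_apply, mem_permFixing.1 hσ' i (Finset.mem_union_right _ hi)]

theorem apply_notMem (hσ' : σ' ∈ permFixing (S ∪ C)) (hi : i ∉ C) : σ' i ∉ C := fun h =>
  hi (σ'.injective (mem_permFixing.1 hσ' _ (Finset.mem_union_right S h)) ▸ h)

theorem mul_apply_of_notMem (hτ : τ ∈ cyclicOn C x) (hσ' : σ' ∈ permFixing (S ∪ C))
    (hi : i ∉ C) : (τ * σ') i = σ' i :=
  (mem_cyclicOn.1 hτ).1 _ (apply_notMem hσ' hi)

theorem cycleSet_mul_of_mem (hτ : τ ∈ cyclicOn C x) (hσ' : σ' ∈ permFixing (S ∪ C))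
    (hi : i ∈ C) : cycleSet (τ * σ') i = C := by
  have hC := (mem_cyclicOn.1 hτ).2
  rw [← cycleSet_congr (S := C) (fun k hk => ?_)
    (fun k hk => (mul_apply_of_mem hσ' hk).symm) hi, cycleSet_eq_of_mem (by rwa [hC]), hC]
  rw [← hC] at hk ⊢
  exact apply_mem_cycleSet hk

theorem cycleSet_mul_of_notMem (hτ : τ ∈ cyclicOn C x) (hσ' : σ' ∈ permFixing (S ∪ C))
    (hi : i ∉ C) : cycleSet (τ * σ') i = cycleSet σ' i :=
  (cycleSet_congr (S := Cᶜ)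
    (fun _ hk => Finset.mem_compl.2 (apply_notMem hσ' (Finset.mem_compl.1 hk)))
    (fun _ hk => (mul_apply_of_notMem hτ hσ' (Finset.mem_compl.1 hk)).symm)
    (Finset.mem_compl.2 hi)).symm

theorem cycleOf_mul (hx : x ∈ C) (hτ : τ ∈ cyclicOn C x) (hσ' : σ' ∈ permFixing (S ∪ C)) :
    (τ * σ').cycleOf x = τ := by
  have hsame (i : Fin N) : (τ * σ').SameCycle x i ↔ i ∈ C := by
    rw [← mem_cycleSet, cycleSet_mul_of_mem hτ hσ' hx]
  ext1 i
  by_cases hi : i ∈ C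
  · rw [((hsame i).2 hi).cycleOf_apply, mul_apply_of_mem hσ' hi]
  · rw [Equiv.Perm.cycleOf_apply_of_not_sameCycle (mt (hsame i).1 hi),
      (mem_cyclicOn.1 hτ).1 i hi]

theorem cycleOf_apply_of_mem (hi : i ∈ cycleSet σ x) : σ.cycleOf x i = σ i :=
  (mem_cycleSet.1 hi).cycleOf_apply

theorem cycleOf_apply_of_notMem (hi : i ∉ cycleSet σ x) : σ.cycleOf x i = i :=
  Equiv.Perm.cycleOf_apply_of_not_sameCycle (mt mem_cycleSet.2 hi)

theorem cycleOf_mem_cyclicOn (σ : Equiv.Perm (Fin N)) (x : Fin N) :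
    σ.cycleOf x ∈ cyclicOn (cycleSet σ x) x :=
  mem_cyclicOn.2 ⟨fun _ => cycleOf_apply_of_notMem, (cycleSet_congr (fun _ => apply_mem_cycleSet)
    (fun _ hi => (cycleOf_apply_of_mem hi).symm) (self_mem_cycleSet σ x)).symm⟩

theorem cycleOf_inv_mul_mem_permFixing (hσ : σ ∈ permFixing S) (hx : x ∉ S) :
    (σ.cycleOf x)⁻¹ * σ ∈ permFixing (S ∪ cycleSet σ x) := by
  refine mem_permFixing.2 fun i hi => ?_
  rw [Equiv.Perm.mul_apply, Equiv.Perm.inv_eq_iff_eq]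
  obtain hiS | hiC := Finset.mem_union.1 hi
  · rw [mem_permFixing.1 hσ i hiS, cycleOf_apply_of_notMem
      (Finset.disjoint_right.1 (disjoint_cycleSet hσ hx) hiS)]
  · exact (cycleOf_apply_of_mem hiC).symm

theorem mul_mem_permFixing (hCS : Disjoint C S) (hτ : τ ∈ cyclicOn C x)
    (hσ' : σ' ∈ permFixing (S ∪ C)) : τ * σ' ∈ permFixing S :=
  mem_permFixing.2 fun i hi => by
    rw [mul_apply_of_notMem hτ hσ' (Finset.disjoint_right.1 hCS hi)]
    exact mem_permFixing.1 hσ' i (Finset.mem_union_left _ hi)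

theorem sum_filter_cycleSet_eq {M : Type*} [AddCommMonoid M] (hx : x ∈ C) (hCS : Disjoint C S)
    (F : Equiv.Perm (Fin N) → M) :
    ∑ σ ∈ (permFixing S).filter (fun σ => cycleSet σ x = C), F σ =
      ∑ τ ∈ cyclicOn C x, ∑ σ' ∈ permFixing (S ∪ C), F (τ * σ') := by
  rw [← Finset.sum_product']
  refine Finset.sum_bij' (fun σ _ => (σ.cycleOf x, (σ.cycleOf x)⁻¹ * σ)) (fun p _ => p.1 * p.2)
    (fun σ hσ => ?_) (fun p hp => ?_) (fun σ _ => mul_inv_cancel_left _ _) (fun p hp => ?_)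
    (fun σ _ => by rw [mul_inv_cancel_left])
  · obtain ⟨hσS, rfl⟩ := Finset.mem_filter.1 hσ
    exact Finset.mem_product.2 ⟨cycleOf_mem_cyclicOn σ x,
      cycleOf_inv_mul_mem_permFixing hσS (Finset.disjoint_left.1 hCS hx)⟩
  · obtain ⟨hτ, hσ'⟩ := Finset.mem_product.1 hp
    exact Finset.mem_filter.2 ⟨mul_mem_permFixing hCS hτ hσ', cycleSet_mul_of_mem hτ hσ' hx⟩
  · obtain ⟨hτ, hσ'⟩ := Finset.mem_product.1 hp
    ext1
    · exact cycleOf_mul hx hτ hσ'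
    · rw [cycleOf_mul hx hτ hσ', inv_mul_cancel_left]

theorem disjoint_insert_of_subset_erase (hx : x ∉ S) (hC : C ⊆ Sᶜ.erase x) :
    Disjoint (insert x C) S :=
  Finset.disjoint_insert_left.2 ⟨hx, Finset.disjoint_left.2 fun _ hi =>
    Finset.mem_compl.1 (Finset.mem_of_mem_erase (hC hi))⟩

theorem sum_permFixing_eq_sum_powerset {M : Type*} [AddCommMonoid M] (hx : x ∉ S)
    (F : Equiv.Perm (Fin N) → M) :
    ∑ σ ∈ permFixing S, F σ = ∑ D ∈ (Sᶜ.erase x).powerset,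
      ∑ τ ∈ cyclicOn (insert x D) x, ∑ σ' ∈ permFixing (S ∪ insert x D), F (τ * σ') := by
  have hmaps : ∀ σ ∈ permFixing S, (cycleSet σ x).erase x ∈ (Sᶜ.erase x).powerset := fun σ hσ =>
    Finset.mem_powerset.2 (Finset.erase_subset_erase x fun _ hi =>
      Finset.mem_compl.2 (Finset.disjoint_left.1 (disjoint_cycleSet hσ hx) hi))
  rw [← Finset.sum_fiberwise_of_maps_to hmaps]
  refine Finset.sum_congr rfl fun D hD => ?_
  rw [Finset.mem_powerset] at hD
  rw [← sum_filter_cycleSet_eq (Finset.mem_insert_self x D)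
    (disjoint_insert_of_subset_erase hx hD)]
  refine Finset.sum_congr (Finset.filter_congr fun σ _ => ⟨fun h => ?_, fun h => ?_⟩) fun _ _ => rfl
  · rw [← h, Finset.insert_erase (self_mem_cycleSet σ x)]
  · rw [h, Finset.erase_insert fun hxD => Finset.notMem_erase x _ (hD hxD)]

theorem sum_range_choose_smul_factorial (n : ℕ) (v : ℕ → ℝ) :
    ∑ k ∈ Finset.range (n + 1), n.choose k •
        ((k.factorial : ℝ) * ((n - k).factorial * v (k + 1))) =
      n.factorial * ∑ l ∈ Finset.Icc 1 (n + 1), v l := by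
  rw [← Finset.Ico_add_one_right_eq_Icc, Finset.sum_Ico_eq_sum_range, Finset.mul_sum,
    Nat.add_sub_cancel]
  refine Finset.sum_congr rfl fun k hk => ?_
  have hchoose : (n.choose k : ℝ) * k.factorial * (n - k).factorial = n.factorial := by
    exact_mod_cast Nat.choose_mul_factorial_mul_factorial
      (Nat.le_of_lt_succ (Finset.mem_range.1 hk))
  rw [nsmul_eq_mul, ← hchoose, add_comm 1 k]
  ring

theorem card_compl_union (hCS : Disjoint C S) : (S ∪ C)ᶜ.card = Sᶜ.card - C.card := by
  rw [Finset.card_compl, Finset.card_union_of_disjoint hCS.symm, Finset.card_compl,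
    Nat.sub_add_eq]

theorem sum_permFixing_eq (hx : x ∉ S) (F : Equiv.Perm (Fin N) → ℝ) (v : ℕ → ℝ)
    (hF : ∀ C : Finset (Fin N), x ∈ C → Disjoint C S → ∀ τ ∈ cyclicOn C x,
      ∑ σ' ∈ permFixing (S ∪ C), F (τ * σ') = ((S ∪ C)ᶜ.card).factorial * v C.card) :
    ∑ σ ∈ permFixing S, F σ = ((Sᶜ.card - 1).factorial : ℝ) * ∑ l ∈ Finset.Icc 1 Sᶜ.card, v l := by
  have hxS : x ∈ Sᶜ := Finset.mem_compl.2 hx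
  obtain ⟨n, hn⟩ := Nat.exists_eq_add_one_of_ne_zero (Finset.card_pos.2 ⟨x, hxS⟩).ne'
  have herase : (Sᶜ.erase x).card = n := by
    rw [Finset.card_erase_of_mem hxS, hn, Nat.add_sub_cancel]
  rw [hn, Nat.add_sub_cancel, ← sum_range_choose_smul_factorial,
    sum_permFixing_eq_sum_powerset hx, ← herase, ← Finset.sum_powerset_apply_card]
  refine Finset.sum_congr rfl fun D hD => ?_
  have hDx := Finset.mem_powerset.1 hD
  have hdisj := disjoint_insert_of_subset_erase hx hDx
  have hcard : (insert x D).card = D.card + 1 :=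
    Finset.card_insert_of_notMem fun hxD => Finset.notMem_erase x _ (hDx hxD)
  rw [Finset.sum_congr rfl (hF _ (Finset.mem_insert_self x D) hdisj), Finset.sum_const,
    card_cyclicOn (Finset.mem_insert_self x D), card_compl_union hdisj, hcard, hn, herase,
    nsmul_eq_mul, Nat.add_sub_cancel, Nat.add_sub_add_right]

end Permutations

section CycleWeights

variable {N : ℕ} {w : ℕ → ℝ} {τ σ' : Equiv.Perm (Fin N)} {S C A : Finset (Fin N)} {x : Fin N}

/-- The product of the weights `w j` over the lengths `j` of the cycles of `σ` outside `S`. Each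
element of a cycle of length `j` contributes `w j ^ (1 / j)`, so that no cycle has to be named. -/
noncomputable def cycleWeight (w : ℕ → ℝ) (S : Finset (Fin N)) (σ : Equiv.Perm (Fin N)) : ℝ :=
  ∏ i ∈ Sᶜ, w (cycleSet σ i).card ^ ((1 : ℝ) / (cycleSet σ i).card)

/-- The lengths of the cycles of `σ` outside `S`, in lexicographic order. -/
noncomputable def lexFrom (σ : Equiv.Perm (Fin N)) (S : Finset (Fin N)) : ℕ → ℕ
  | 0 => if h : Sᶜ.Nonempty then (cycleSet σ (Sᶜ.min' h)).card else 0
  | n + 1 => lexFrom σ (if h : Sᶜ.Nonempty then S ∪ cycleSet σ (Sᶜ.min' h) else S) n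

theorem lexFrom_firstCycles (σ : Equiv.Perm (Fin N)) (k n : ℕ) :
    lexFrom σ (firstCycles σ k) n = lexLength σ (k + n) := by
  induction n generalizing k with
  | zero => rfl
  | succ n ih =>
    rw [← Nat.add_assoc, Nat.add_right_comm, ← ih (k + 1)]
    rfl

theorem lexFrom_empty (σ : Equiv.Perm (Fin N)) (n : ℕ) : lexFrom σ ∅ n = lexLength σ n :=
  (lexFrom_firstCycles σ 0 n).trans (by rw [Nat.zero_add])

theorem cycleWeight_mul (hw : ∀ j, 0 ≤ w j) (hx : x ∈ C) (hCS : Disjoint C S)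
    (hτ : τ ∈ cyclicOn C x) (hσ' : σ' ∈ permFixing (S ∪ C)) :
    cycleWeight w S (τ * σ') = w C.card * cycleWeight w (S ∪ C) σ' := by
  have hsplit : Sᶜ = C ∪ (S ∪ C)ᶜ := by
    rw [Finset.compl_union, Finset.union_inter_distrib_left, Finset.union_compl, Finset.inter_univ,
      Finset.union_eq_right.2 (Finset.subset_compl_iff_disjoint_right.2 hCS)]
  have hdisj : Disjoint C (S ∪ C)ᶜ :=
    disjoint_compl_right.mono_left Finset.subset_union_right
  rw [cycleWeight, hsplit, Finset.prod_union hdisj]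
  congr 1
  · rw [Finset.prod_congr rfl fun i hi => by rw [cycleSet_mul_of_mem hτ hσ' hi],
      Finset.prod_const, one_div, Real.rpow_inv_natCast_pow (hw _) (Finset.card_ne_zero_of_mem hx)]
  · refine Finset.prod_congr rfl fun i hi => ?_
    rw [cycleSet_mul_of_notMem hτ hσ' fun hiC =>
      Finset.mem_compl.1 hi (Finset.mem_union_right _ hiC)]

theorem lexFrom_mul (hτ : τ ∈ cyclicOn C x) (hσ' : σ' ∈ permFixing (S ∪ C)) (hA : C ⊆ A) (n : ℕ) :
    lexFrom (τ * σ') A n = lexFrom σ' A n := by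
  have hmin : ∀ {A : Finset (Fin N)}, C ⊆ A → ∀ h : Aᶜ.Nonempty,
      cycleSet (τ * σ') (Aᶜ.min' h) = cycleSet σ' (Aᶜ.min' h) := fun hA h =>
    cycleSet_mul_of_notMem hτ hσ' fun hC => Finset.mem_compl.1 (Finset.min'_mem _ h) (hA hC)
  induction n generalizing A with
  | zero =>
    unfold lexFrom
    split_ifs with h
    · rw [hmin hA h]
    · rfl
  | succ n ih =>
    unfold lexFrom
    split_ifs with h
    · rw [hmin hA h, ih (hA.trans Finset.subset_union_left)]
    · exact ih hA

theorem lexFrom_mul_eq_cons (h : Sᶜ.Nonempty) (hx : Sᶜ.min' h ∈ C) (hτ : τ ∈ cyclicOn C x)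
    (hσ' : σ' ∈ permFixing (S ∪ C)) (m : ℕ) :
    (fun i : Fin (m + 1) => lexFrom (τ * σ') S i) =
      Fin.cons C.card fun i : Fin m => lexFrom σ' (S ∪ C) i := by
  have hset := cycleSet_mul_of_mem hτ hσ' hx
  ext i
  refine Fin.cases ?_ (fun i => ?_) i
  · rw [Fin.cons_zero, Fin.val_zero, lexFrom, dif_pos h, hset]
  · rw [Fin.cons_succ, Fin.val_succ, lexFrom, dif_pos h, hset,
      lexFrom_mul hτ hσ' Finset.subset_union_right]

theorem lexFrom_eq_cons_zero (h : ¬ Sᶜ.Nonempty) (σ : Equiv.Perm (Fin N)) (m : ℕ) :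
    (fun i : Fin (m + 1) => lexFrom σ S i) = Fin.cons 0 fun i : Fin m => lexFrom σ S i := by
  ext i
  refine Fin.cases ?_ (fun i => ?_) i
  · rw [Fin.cons_zero, Fin.val_zero, lexFrom, dif_neg h]
  · rw [Fin.cons_succ, Fin.val_succ, lexFrom, dif_neg h]

theorem factorial_pred_mul {n : ℕ} (hn : n ≠ 0) (a : ℝ) :
    ((n - 1).factorial : ℝ) * (n * a) = n.factorial * a := by
  rw [← Nat.mul_factorial_pred hn, Nat.cast_mul]
  ring

theorem sum_cycleWeight (hw : ∀ j, 0 ≤ w j) (S : Finset (Fin N)) :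
    ∑ σ ∈ permFixing S, cycleWeight w S σ = (Sᶜ.card).factorial * expCoeff w Sᶜ.card := by
  induction hn : Sᶜ.card using Nat.strong_induction_on generalizing S with
  | _ n ih =>
    obtain h | ⟨x, hx⟩ := Finset.eq_empty_or_nonempty Sᶜ
    · obtain rfl : n = 0 := by rw [← hn, h, Finset.card_empty]
      rw [(Finset.compl_eq_empty_iff S).1 h, permFixing_univ, Finset.sum_singleton, cycleWeight,
        Finset.compl_univ, Finset.prod_empty, expCoeff_zero, Nat.factorial_zero, Nat.cast_one,
        one_mul]
    · have hn0 : n ≠ 0 := hn ▸ Finset.card_ne_zero_of_mem hx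
      rw [sum_permFixing_eq (Finset.mem_compl.1 hx) _ fun l => w l * expCoeff w (n - l), hn,
        ← mul_expCoeff, factorial_pred_mul hn0]
      intro C hxC hCS τ hτ
      have hcard := card_compl_union hCS
      have hC := Finset.card_pos.2 ⟨x, hxC⟩
      rw [Finset.sum_congr rfl fun σ' hσ' => cycleWeight_mul hw hxC hCS hτ hσ', ← Finset.mul_sum,
        ih (n - C.card) (by omega) (S ∪ C) (by rw [hcard, hn]), hcard, hn]
      ring

/-- The sum of `f (L₁, …, Lₘ)` over the permutations of `n` elements, weighted by the product of
`w` over the cycle lengths and divided by `n!`; given here by the recursion that splits off the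
cycle of the smallest element, of length `l`. -/
noncomputable def lexSum (w : ℕ → ℝ) : (m n : ℕ) → ((Fin m → ℕ) → ℝ) → ℝ
  | 0, n, f => expCoeff w n * f Fin.elim0
  | m + 1, n, f =>
    if n = 0 then lexSum w m 0 (fun v => f (Fin.cons 0 v))
    else (1 / (n : ℝ)) * ∑ l ∈ Finset.Icc 1 n, w l * lexSum w m (n - l) (fun v => f (Fin.cons l v))

theorem sum_cycleWeight_mul_lexFrom (hw : ∀ j, 0 ≤ w j) (m : ℕ) (S : Finset (Fin N))
    (f : (Fin m → ℕ) → ℝ) :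
    ∑ σ ∈ permFixing S, cycleWeight w S σ * f (fun i => lexFrom σ S i) =
      (Sᶜ.card).factorial * lexSum w m Sᶜ.card f := by
  induction m generalizing S with
  | zero =>
    simp_rw [fun σ => Subsingleton.elim (fun i : Fin 0 => lexFrom σ S i) Fin.elim0]
    rw [← Finset.sum_mul, sum_cycleWeight hw, lexSum, mul_assoc]
  | succ m ih =>
    by_cases h : Sᶜ.Nonempty
    · have hn0 : Sᶜ.card ≠ 0 := Finset.card_ne_zero.2 h
      rw [sum_permFixing_eq (Finset.mem_compl.1 (Finset.min'_mem _ h)) _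
        (fun l => w l * lexSum w m (Sᶜ.card - l) (fun v => f (Fin.cons l v))), lexSum,
        if_neg hn0, ← factorial_pred_mul hn0, one_div, mul_inv_cancel_left₀ (by positivity)]
      intro C hxC hCS τ hτ
      have hterm : ∀ σ' ∈ permFixing (S ∪ C), cycleWeight w S (τ * σ') *
          f (fun i : Fin (m + 1) => lexFrom (τ * σ') S i) = w C.card * (cycleWeight w (S ∪ C) σ' *
            (fun v : Fin m → ℕ => f (Fin.cons C.card v)) fun i => lexFrom σ' (S ∪ C) i) :=
        fun σ' hσ' => by
          rw [cycleWeight_mul hw hxC hCS hτ hσ', mul_assoc, lexFrom_mul_eq_cons h hxC hτ hσ']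
      rw [Finset.sum_congr rfl hterm, ← Finset.mul_sum, ih (S ∪ C) fun v => f (Fin.cons C.card v),
        card_compl_union hCS]
      ring
    · simp_rw [lexFrom_eq_cons_zero h]
      rw [ih S fun v => f (Fin.cons 0 v), Finset.not_nonempty_iff_eq_empty.1 h, Finset.card_empty,
        lexSum, if_pos rfl]

theorem sum_cycleWeight_mul_card_cycleSet (hw : ∀ j, 0 ≤ w j) (x : Fin N) (f : ℕ → ℝ) :
    ∑ σ : Equiv.Perm (Fin N), cycleWeight w ∅ σ * f (cycleSet σ x).card =
      ((N - 1).factorial : ℝ) * ∑ l ∈ Finset.Icc 1 N, w l * f l * expCoeff w (N - l) := by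
  have hcard : (∅ : Finset (Fin N))ᶜ.card = N := by
    rw [Finset.compl_empty, Finset.card_univ, Fintype.card_fin]
  rw [← permFixing_empty, sum_permFixing_eq (Finset.notMem_empty x) _
    (fun l => w l * f l * expCoeff w (N - l)), hcard]
  intro C hxC hCS τ hτ
  have hterm : ∀ σ' ∈ permFixing (∅ ∪ C), cycleWeight w ∅ (τ * σ') *
      f (cycleSet (τ * σ') x).card = w C.card * f C.card * cycleWeight w (∅ ∪ C) σ' :=
    fun σ' hσ' => by
      rw [cycleWeight_mul hw hxC hCS hτ hσ', cycleSet_mul_of_mem hτ hσ' hxC, mul_right_comm]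
  rw [Finset.sum_congr rfl hterm, ← Finset.mul_sum, sum_cycleWeight hw, card_compl_union hCS, hcard]
  ring

theorem cycleWeight_empty (hw : ∀ j, 0 ≤ w j) (σ : Equiv.Perm (Fin N)) :
    cycleWeight w ∅ σ = ∏ j ∈ Finset.Icc 1 N, w j ^ cycleCount σ j := by
  have hmaps : ∀ i ∈ (Finset.univ : Finset (Fin N)), (cycleSet σ i).card ∈ Finset.Icc 1 N :=
    fun i _ => Finset.mem_Icc.2 ⟨card_cycleSet_pos σ i, card_cycleSet_le σ i⟩
  rw [cycleWeight, Finset.compl_empty, ← Finset.prod_fiberwise_of_maps_to hmaps]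
  refine Finset.prod_congr rfl fun j hj => ?_
  have hj1 := (Finset.mem_Icc.1 hj).1
  rw [Finset.prod_congr rfl fun i hi => by rw [(Finset.mem_filter.1 hi).2], Finset.prod_const,
    ← mul_cycleCount σ hj1, pow_mul, one_div, Real.rpow_inv_natCast_pow (hw j) (by omega)]

end CycleWeights

/-! ### Fatou's lemma for a sum with a discrete and a continuous limit -/

section Fatou

theorem tsum_liminf_le {ι : Type*} (u : ℕ → ι → ℝ≥0∞) :
    ∑' i, liminf (fun N => u N i) atTop ≤ liminf (fun N => ∑' i, u N i) atTop := by
  let _ : MeasurableSpace ι := ⊤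
  simp only [← lintegral_count]
  exact lintegral_liminf_le fun N => measurable_from_top

theorem liminf_add_liminf_le (u v : ℕ → ℝ≥0∞) :
    liminf u atTop + liminf v atTop ≤ liminf (fun N => u N + v N) atTop := by
  simpa only [tsum_bool, add_comm, cond_true, cond_false] using
    tsum_liminf_le fun N b => cond b (u N) (v N)

theorem mul_le_liminf_of_tendsto {ι : Type*} {l : Filter ι} [l.NeBot] {p r t : ι → ℝ≥0∞}
    {q Ψ : ℝ≥0∞} (hp : Tendsto p l (𝓝 q)) (hr : Ψ ≤ liminf r l) (ht : ∀ᶠ i in l, p i * r i ≤ t i) :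
    q * Ψ ≤ liminf t l :=
  calc q * Ψ ≤ liminf p l * liminf r l := by rw [hp.liminf_eq]; gcongr
    _ ≤ liminf (p * r) l := ENNReal.le_liminf_mul
    _ ≤ liminf t l := liminf_le_liminf ht

theorem setLIntegral_Ioi_comp_ceil_le {a : ℝ} (ha : 0 < a) (u : ℕ → ℝ≥0∞) :
    ∫⁻ b in Ioi 0, ENNReal.ofReal a * u ⌈a * b⌉₊ ≤ ∑' l, u l := by
  have hceil : Measurable fun b : ℝ => ⌈a * b⌉₊ := Nat.measurable_ceil.comp (measurable_const_mul a)
  rw [← lintegral_map (f := fun l => ENNReal.ofReal a * u l) measurable_from_top hceil,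
    lintegral_countable']
  refine ENNReal.tsum_le_tsum fun l => ?_
  have hsub : (fun b : ℝ => ⌈a * b⌉₊) ⁻¹' {l} ∩ Ioi 0 ⊆ Ioc ((l - 1) / a) (l / a) := by
    rintro b ⟨rfl, hb⟩
    have hlt := Nat.ceil_lt_add_one (mul_pos ha hb).le
    exact ⟨(div_lt_iff₀ ha).2 (by linarith), (le_div_iff₀ ha).2 (by linarith [Nat.le_ceil (a * b)])⟩
  have hmeasure : Measure.map (fun b : ℝ => ⌈a * b⌉₊) (volume.restrict (Ioi 0)) {l} ≤
      ENNReal.ofReal a⁻¹ := by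
    rw [Measure.map_apply hceil (measurableSet_singleton l),
      Measure.restrict_apply (hceil (measurableSet_singleton l))]
    refine (measure_mono hsub).trans_eq ?_
    rw [Real.volume_Ioc, ← sub_div, sub_sub_cancel, one_div]
  calc _ ≤ ENNReal.ofReal a * u l * ENNReal.ofReal a⁻¹ := by gcongr
    _ = u l := by
      rw [mul_right_comm, ← ENNReal.ofReal_mul ha.le, mul_inv_cancel₀ ha.ne', ENNReal.ofReal_one,
        one_mul]

theorem tendsto_ceil_mul_div {a b : ℝ} (hab : 0 ≤ a * b) :
    Tendsto (fun N : ℕ => (⌈a * N * b⌉₊ : ℝ) / N) atTop (𝓝 (a * b)) :=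
  ((tendsto_nat_ceil_mul_div_atTop hab).comp tendsto_natCast_atTop_atTop).congr fun N => by
    rw [Function.comp_apply, mul_right_comm]

theorem eventually_lt_mul_self_of_tendsto_div {l : ℕ → ℕ} {y : ℝ} (hy : 0 < y)
    (hl : Tendsto (fun N => (l N : ℝ) / N) atTop (𝓝 y)) : ∀ᶠ N in atTop, N < l N * l N := by
  have hsq := (hl.pos_mul_atTop hy ((tendsto_natCast_atTop_atTop (R := ℝ)).comp
    (tendsto_atTop_of_tendsto_div hy tendsto_id hl)))
  filter_upwards [hsq.eventually_gt_atTop 1, eventually_gt_atTop 0] with N hN hN0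
  have hN0' : (0 : ℝ) < N := Nat.cast_pos.2 hN0
  rw [Function.comp_apply, div_mul_eq_mul_div, one_lt_div hN0'] at hN
  exact_mod_cast hN

theorem tsum_add_setLIntegral_le_liminf_tsum {t : ℕ → ℕ → ℝ≥0∞} {q : ℕ → ℝ≥0∞} {g : ℝ → ℝ≥0∞}
    {a : ℝ} {s : Set ℝ} (ha : 0 < a) (hs : MeasurableSet s) (hs0 : s ⊆ Ioi 0)
    (hq : ∀ l, q l ≤ liminf (fun N => t N l) atTop)
    (hg : ∀ b ∈ s, ∀ l : ℕ → ℕ, Tendsto (fun N => (l N : ℝ) / N) atTop (𝓝 (a * b)) →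
      g b ≤ liminf (fun N : ℕ => ENNReal.ofReal (a * N) * t N (l N)) atTop) :
    ∑' l, q l + ∫⁻ b in s, g b ≤ liminf (fun N => ∑' l, t N l) atTop := by
  -- The terms with `l ≤ √N` carry the discrete part of the limit, the others the continuous part.
  set short : ℕ → ℕ → ℝ≥0∞ := fun N => {l | l * l ≤ N}.indicator (t N)
  set long : ℕ → ℕ → ℝ≥0∞ := fun N => {l | l * l ≤ N}ᶜ.indicator (t N)
  have hshort : ∑' l, q l ≤ liminf (fun N => ∑' l, short N l) atTop := by
    refine (ENNReal.tsum_le_tsum fun l => (hq l).trans_eq (liminf_congr ?_)).trans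
      (tsum_liminf_le short)
    filter_upwards [eventually_ge_atTop (l * l)] with N hN
    exact (Set.indicator_of_mem (s := {l | l * l ≤ N}) hN (t N)).symm
  have hpointwise : ∀ b ∈ s, g b ≤
      liminf (fun N : ℕ => ENNReal.ofReal (a * N) * long N ⌈a * N * b⌉₊) atTop := fun b hb => by
    have hab : 0 < a * b := mul_pos ha (hs0 hb)
    have hceil := tendsto_ceil_mul_div hab.le
    refine (hg b hb _ hceil).trans_eq (liminf_congr ?_)
    filter_upwards [eventually_lt_mul_self_of_tendsto_div hab hceil] with N hN
    exact congrArg _ (Set.indicator_of_mem (s := {l | l * l ≤ N}ᶜ) hN.not_ge (t N)).symm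
  have hlong : ∫⁻ b in s, g b ≤ liminf (fun N => ∑' l, long N l) atTop :=
    calc ∫⁻ b in s, g b ≤ ∫⁻ b in s,
          liminf (fun N : ℕ => ENNReal.ofReal (a * N) * long N ⌈a * N * b⌉₊) atTop :=
        setLIntegral_mono' hs hpointwise
      _ ≤ liminf (fun N : ℕ => ∫⁻ b in s, ENNReal.ofReal (a * N) * long N ⌈a * N * b⌉₊) atTop :=
        lintegral_liminf_le fun N => (measurable_from_top (f := long N)).comp
          (Nat.measurable_ceil.comp (measurable_const_mul (a * N))) |>.const_mul _
      _ ≤ liminf (fun N => ∑' l, long N l) atTop := by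
        refine liminf_le_liminf ?_
        filter_upwards [eventually_gt_atTop 0] with N hN
        exact (lintegral_mono_set hs0).trans
          (setLIntegral_Ioi_comp_ceil_le (mul_pos ha (Nat.cast_pos.2 hN)) _)
  refine (add_le_add hshort hlong).trans ((liminf_add_liminf_le _ _).trans_eq
    (congrArg (liminf · atTop) (funext fun N => ?_)))
  rw [← ENNReal.tsum_add]
  exact tsum_congr fun l => Set.indicator_self_add_compl_apply {l | l * l ≤ N} (t N) l

end Fatou

/-! ### The law of the lexicographic cycle lengths -/

/-- The coefficient conditions of the supercritical case: `T j` and `K j` stand for `θ_j R^j` and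
`κ_j R^j`, and `c` for `g_κ^{1}(R)`. -/
structure Supercritical (T K : ℕ → ℝ) (c θs : ℝ) : Prop where
  nonneg_T : ∀ j, 0 ≤ T j
  nonneg_K : ∀ j, 0 ≤ K j
  K_zero : K 0 = 0
  hasSum_K : HasSum K c
  c_pos : 0 < c
  c_lt_one : c < 1
  θs_pos : 0 < θs
  isBigO_T_sub : ∃ d : ℝ, 0 < d ∧ (fun j => T j - θs) =O[atTop] fun j : ℕ => (j : ℝ) ^ (-d)
  isBigO_K : ∃ s : ℝ, 1 < s ∧ K =O[atTop] fun j : ℕ => (j : ℝ) ^ (-s)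

section Analytic

variable {gθ gκ : ℂ → ℂ} {θ κ : ℕ → ℝ≥0} {R η φ : ℝ}

theorem supercritical_scaled (hgθ : IsDeltaExtension gθ θ R η φ) (hgκ : IsDeltaExtension gκ κ R η φ)
    (hκ : ∃ j, j ≠ 0 ∧ 0 < κ j) {s c θs : ℝ} {C : ℕ → ℝ} (hs : 1 < s) (hc1 : c < 1) (hθs : 0 < θs)
    (hc : Tendsto (fun r : ℝ => modDeriv gκ 1 (r : ℂ)) (𝓝[<] R) (𝓝 (c : ℂ)))
    (hgκ_high : ∀ n : ℕ, s < n → ∃ d : ℝ, 0 < d ∧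
      (fun z : ℂ => modDeriv gκ n z - (C n : ℂ) * (1 - z / R) ^ ((s - n : ℝ) : ℂ))
        =O[𝓝[domainDelta R η φ] (R : ℂ)] fun z : ℂ => ‖1 - z / R‖ ^ (s - n + d))
    (hgθ_deriv : ∀ n : ℕ, 1 ≤ n → ∃ d : ℝ, 0 < d ∧
      (fun z : ℂ => modDeriv gθ n z - (θs : ℂ) * ((n - 1).factorial : ℂ) / (1 - z / R) ^ n)
        =O[𝓝[domainDelta R η φ] (R : ℂ)] fun z : ℂ => ‖1 - z / R‖ ^ (-(n : ℝ) + d)) :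
    Supercritical (scaled θ R) (scaled κ R) c θs := by
  obtain ⟨n, hn⟩ := exists_nat_ge (s + 2)
  obtain ⟨d, hd, hdO⟩ := hgκ_high n (by linarith)
  have hκO := hgκ.isBigO_scaled hn hd.le hdO
  have hsum := hgκ.hasSum_scaled hs hκO hc
  obtain ⟨j, hj, hκj⟩ := hκ
  have hterm : 0 < scaled κ R j := by
    rw [scaled_of_ne_zero hj]
    exact mul_pos hκj (pow_pos hgκ.R_pos j)
  obtain ⟨d', hd', hdO'⟩ := hgθ_deriv 3 (by norm_num)
  exact {
    nonneg_T := scaled_nonneg hgθ.R_pos.le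
    nonneg_K := scaled_nonneg hgκ.R_pos.le
    K_zero := scaled_zero
    hasSum_K := hsum
    c_pos := hterm.trans_le (le_hasSum hsum j fun i _ => scaled_nonneg hgκ.R_pos.le i)
    c_lt_one := hc1
    θs_pos := hθs
    isBigO_T_sub := hgθ.exists_isBigO_scaled_sub hd'
      (by simpa [Nat.factorial, mul_div_assoc] using hdO')
    isBigO_K := ⟨s, hs, hκO⟩ }

end Analytic

section RatioLimits

theorem tendsto_of_isBigO_natCast_rpow_neg {f : ℕ → ℝ} {d : ℝ} (hd : 0 < d)
    (hf : f =O[atTop] fun j : ℕ => (j : ℝ) ^ (-d)) : Tendsto f atTop (𝓝 0) :=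
  hf.trans_tendsto ((tendsto_rpow_neg_atTop hd).comp tendsto_natCast_atTop_atTop)

theorem summable_abs_div_of_isBigO {f : ℕ → ℝ} {d : ℝ} (hd : 0 < d)
    (hf : f =O[atTop] fun j : ℕ => (j : ℝ) ^ (-d)) : Summable fun j => |f j| / j := by
  refine summable_of_isBigO_nat (Real.summable_nat_rpow.2 (by linarith : -d - 1 < -1)) ?_
  refine (hf.abs_left.mul (isBigO_refl (fun j : ℕ => (j : ℝ)⁻¹) atTop)).congr'
    (Eventually.of_forall fun j => (div_eq_mul_inv _ _).symm) ?_
  filter_upwards [eventually_ne_atTop 0] with j hj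
  rw [Real.rpow_sub_one (Nat.cast_ne_zero.2 hj), div_eq_mul_inv]

theorem tendsto_natCast_mul_of_isBigO {f : ℕ → ℝ} {s : ℝ} (hs : 1 < s)
    (hf : f =O[atTop] fun j : ℕ => (j : ℝ) ^ (-s)) :
    Tendsto (fun j : ℕ => (j : ℝ) * f j) atTop (𝓝 0) := by
  refine tendsto_of_isBigO_natCast_rpow_neg (sub_pos.2 hs)
    (((isBigO_refl (fun j : ℕ => (j : ℝ)) atTop).mul hf).congr' EventuallyEq.rfl ?_)
  filter_upwards [eventually_ne_atTop 0] with j hj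
  rw [neg_sub, sub_eq_neg_add, Real.rpow_add_one (Nat.cast_ne_zero.2 hj), mul_comm]

theorem eventually_lt_of_tendsto_div {n l : ℕ → ℕ} {v b : ℝ}
    (hn : Tendsto (fun N => (n N : ℝ) / N) atTop (𝓝 v))
    (hl : Tendsto (fun N => (l N : ℝ) / N) atTop (𝓝 b)) (hb : b < v) :
    ∀ᶠ N in atTop, l N < n N := by
  filter_upwards [hl.eventually_lt hn hb, eventually_gt_atTop 0] with N hN hN0
  exact_mod_cast (div_lt_div_iff_of_pos_right (Nat.cast_pos.2 hN0)).1 hN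

theorem tendsto_natCast_sub_div {n l : ℕ → ℕ} {v b : ℝ}
    (hn : Tendsto (fun N => (n N : ℝ) / N) atTop (𝓝 v))
    (hl : Tendsto (fun N => (l N : ℝ) / N) atTop (𝓝 b)) (hb : b < v) :
    Tendsto (fun N => ((n N - l N : ℕ) : ℝ) / N) atTop (𝓝 (v - b)) := by
  refine (hn.sub hl).congr' ?_
  filter_upwards [eventually_lt_of_tendsto_div hn hl hb] with N hN
  rw [Nat.cast_sub hN.le, sub_div]

/-- The probability that a given one of `n` elements lies in a cycle of length `l`, under the
distribution on permutations with cycle weights `w`. -/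
noncomputable def cycleLengthProb (w : ℕ → ℝ) (n l : ℕ) : ℝ :=
  w l * expCoeff w (n - l) / (n * expCoeff w n)

namespace Supercritical

variable {T K : ℕ → ℝ} {c θs v : ℝ} {n : ℕ → ℕ}

theorem mixWeight_nonneg (h : Supercritical T K c θs) (N j : ℕ) : 0 ≤ mixWeight T K N j :=
  add_nonneg (h.nonneg_T j) (mul_nonneg (Nat.cast_nonneg _) (h.nonneg_K j))

theorem expCoeff_mixWeight_nonneg (h : Supercritical T K c θs) (N n : ℕ) :
    0 ≤ expCoeff (mixWeight T K N) n :=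
  expCoeff_nonneg (fun j _ => h.mixWeight_nonneg N j) n

theorem cycleLengthProb_nonneg (h : Supercritical T K c θs) (N n l : ℕ) :
    0 ≤ cycleLengthProb (mixWeight T K N) n l :=
  div_nonneg (mul_nonneg (h.mixWeight_nonneg _ _) (h.expCoeff_mixWeight_nonneg _ _))
    (mul_nonneg (Nat.cast_nonneg _) (h.expCoeff_mixWeight_nonneg _ _))

theorem exists_tendsto_mixedCoeff (h : Supercritical T K c θs) :
    ∃ A : ℝ, 0 < A ∧ ∀ (n : ℕ → ℕ) (v : ℝ), c < v → Tendsto (fun N => (n N : ℝ) / N) atTop (𝓝 v) →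
      Tendsto (fun N : ℕ => (N : ℝ) ^ (1 - θs) * mixedCoeff T K N (n N)) atTop
        (𝓝 (A * (v - c) ^ (θs - 1))) := by
  obtain ⟨d, hd, hT⟩ := h.isBigO_T_sub
  obtain ⟨s, hs, hK⟩ := h.isBigO_K
  refine ⟨(Real.Gamma θs)⁻¹ * Real.exp (∑' j, (T j - θs) / j),
    mul_pos (inv_pos.2 (Real.Gamma_pos_of_pos h.θs_pos)) (Real.exp_pos _), fun n v hv hn => ?_⟩
  simpa only [add_sub_cancel] using tendsto_rpow_mul_mixedCoeff h.nonneg_K h.hasSum_K h.K_zero hs hK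
    h.θs_pos (tendsto_of_isBigO_natCast_rpow_neg hd hT) (summable_abs_div_of_isBigO hd hT)
    (fun j _ => by simpa only [add_sub_cancel] using h.nonneg_T j) hv hn

theorem eventually_expCoeff_mixWeight_pos (h : Supercritical T K c θs) (hv : c < v)
    (hn : Tendsto (fun N => (n N : ℝ) / N) atTop (𝓝 v)) :
    ∀ᶠ N in atTop, 0 < expCoeff (mixWeight T K N) (n N) := by
  obtain ⟨A, hA, hlim⟩ := h.exists_tendsto_mixedCoeff
  filter_upwards [(hlim n v hv hn).eventually_const_lt
    (mul_pos hA (Real.rpow_pos_of_pos (sub_pos.2 hv) _))] with N hN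
  refine (h.expCoeff_mixWeight_nonneg N (n N)).lt_of_ne' fun h0 => hN.ne' ?_
  rw [mixedCoeff, h0, mul_zero, mul_zero]

theorem tendsto_expCoeff_div (h : Supercritical T K c θs) {n' : ℕ → ℕ} {v' : ℝ} (hv : c < v)
    (hn : Tendsto (fun N => (n N : ℝ) / N) atTop (𝓝 v)) (hv' : c < v')
    (hn' : Tendsto (fun N => (n' N : ℝ) / N) atTop (𝓝 v')) :
    Tendsto (fun N => expCoeff (mixWeight T K N) (n' N) / expCoeff (mixWeight T K N) (n N)) atTop
      (𝓝 (((v' - c) / (v - c)) ^ (θs - 1))) := by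
  obtain ⟨A, hA, hlim⟩ := h.exists_tendsto_mixedCoeff
  have hpos := Real.rpow_pos_of_pos (sub_pos.2 hv) (θs - 1)
  have hdiv := (hlim n' v' hv' hn').div (hlim n v hv hn) (mul_pos hA hpos).ne'
  rw [mul_div_mul_left _ _ hA.ne', ← Real.div_rpow (sub_pos.2 hv').le (sub_pos.2 hv).le] at hdiv
  refine hdiv.congr' ?_
  filter_upwards [eventually_gt_atTop 0] with N hN
  have hN' : (0 : ℝ) < N := Nat.cast_pos.2 hN
  rw [Pi.div_apply, mixedCoeff, mixedCoeff,
    mul_div_mul_left _ _ (Real.rpow_pos_of_pos hN' _).ne',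
    mul_div_mul_left _ _ (Real.exp_pos _).ne']

theorem tendsto_cycleLengthProb (h : Supercritical T K c θs) (hv : c < v)
    (hn : Tendsto (fun N => (n N : ℝ) / N) atTop (𝓝 v)) (l : ℕ) :
    Tendsto (fun N => cycleLengthProb (mixWeight T K N) (n N) l) atTop (𝓝 (K l / v)) := by
  have hv0 : 0 < v := h.c_pos.trans hv
  have hsub := tendsto_natCast_sub_div hn (tendsto_const_div_atTop_nhds_zero_nat (l : ℝ)) hv0
  rw [sub_zero] at hsub
  have hratio := h.tendsto_expCoeff_div hv hn hv hsub
  rw [div_self (sub_pos.2 hv).ne', Real.one_rpow] at hratio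
  have hweight := ((tendsto_const_div_atTop_nhds_zero_nat (T l)).add_const (K l)).div hn hv0.ne'
  rw [zero_add] at hweight
  rw [← mul_one (K l / v)]
  refine (hweight.mul hratio).congr' ?_
  filter_upwards [eventually_ne_atTop 0] with N hN
  have hN' : (N : ℝ) ≠ 0 := Nat.cast_ne_zero.2 hN
  rw [cycleLengthProb, mixWeight, mul_div_mul_comm, Pi.div_apply]
  congr 1
  field_simp

theorem tendsto_mixWeight_comp (h : Supercritical T K c θs) {l : ℕ → ℕ} {y : ℝ} (hy : 0 < y)
    (hl : Tendsto (fun N => (l N : ℝ) / N) atTop (𝓝 y)) :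
    Tendsto (fun N => mixWeight T K N (l N)) atTop (𝓝 θs) := by
  obtain ⟨d, hd, hT⟩ := h.isBigO_T_sub
  obtain ⟨s, hs, hK⟩ := h.isBigO_K
  have hltop := tendsto_atTop_of_tendsto_div hy tendsto_id hl
  have hTlim := ((tendsto_of_isBigO_natCast_rpow_neg hd hT).comp hltop).const_add θs
  have hKlim := ((tendsto_natCast_mul_of_isBigO hs hK).comp hltop).div hl hy.ne'
  have hsum := hTlim.add hKlim
  rw [zero_div, add_zero, add_zero] at hsum
  refine hsum.congr' ?_
  filter_upwards [hltop.eventually_ne_atTop 0] with N hl0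
  have hl0' : (l N : ℝ) ≠ 0 := Nat.cast_ne_zero.2 hl0
  simp only [mixWeight, Function.comp_apply, Pi.div_apply, add_sub_cancel]
  field_simp

theorem tendsto_natCast_mul_cycleLengthProb (h : Supercritical T K c θs)
    (hn : Tendsto (fun N => (n N : ℝ) / N) atTop (𝓝 v)) {l : ℕ → ℕ} {y : ℝ} (hy : 0 < y)
    (hl : Tendsto (fun N => (l N : ℝ) / N) atTop (𝓝 y)) (hyv : c < v - y) :
    Tendsto (fun N => N * cycleLengthProb (mixWeight T K N) (n N) (l N)) atTop
      (𝓝 (θs / v * ((v - y - c) / (v - c)) ^ (θs - 1))) := by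
  have hc := h.c_pos
  have hv0 : 0 < v := by linarith
  have hratio := h.tendsto_expCoeff_div (by linarith) hn hyv
    (tendsto_natCast_sub_div hn hl (by linarith))
  refine (((h.tendsto_mixWeight_comp hy hl).div hn hv0.ne').mul hratio).congr fun N => ?_
  rw [cycleLengthProb, mul_div_mul_comm, ← mul_assoc, Pi.div_apply, div_div_eq_mul_div,
    mul_div_assoc, mul_comm (N : ℝ), div_mul_eq_mul_div, mul_div_assoc]

end Supercritical

end RatioLimits

section LexLimit

theorem lexSum_nonneg {w : ℕ → ℝ} (hw : ∀ j, 0 ≤ w j) (m n : ℕ) {f : (Fin m → ℕ) → ℝ}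
    (hf : ∀ u, 0 ≤ f u) : 0 ≤ lexSum w m n f := by
  induction m generalizing n with
  | zero => exact mul_nonneg (expCoeff_nonneg (fun j _ => hw j) n) (hf _)
  | succ m ih =>
    rw [lexSum]
    split_ifs
    · exact ih _ fun u => hf _
    · exact mul_nonneg (by positivity)
        (Finset.sum_nonneg fun l _ => mul_nonneg (hw l) (ih _ fun u => hf _))

theorem sum_cycleLengthProb_mul_lexSum_le {w : ℕ → ℝ} (hw : ∀ j, 0 ≤ w j) {m n : ℕ} (hn : n ≠ 0)
    {f : (Fin (m + 1) → ℕ) → ℝ} (hf : ∀ u, 0 ≤ f u) :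
    ∑ l ∈ Finset.Icc 1 n, cycleLengthProb w n l *
        (lexSum w m (n - l) (fun u => f (Fin.cons l u)) / expCoeff w (n - l)) ≤
      lexSum w (m + 1) n f / expCoeff w n := by
  rw [lexSum, if_neg hn, one_div, inv_mul_eq_div, div_div, Finset.sum_div]
  refine Finset.sum_le_sum fun l _ => ?_
  rw [cycleLengthProb, div_mul_eq_mul_div]
  refine div_le_div_of_nonneg_right ?_
    (mul_nonneg n.cast_nonneg (expCoeff_nonneg (fun j _ => hw j) n))
  rw [mul_assoc, mul_div_left_comm]
  exact mul_le_mul_of_nonneg_left (mul_le_of_le_one_right (lexSum_nonneg hw _ _ fun u => hf _)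
    (div_self_le_one _)) (hw l)

theorem uStar_one_sub (c x : ℝ) : uStar (1 - c) x = (1 - c) * x / (c + (1 - c) * x) := by
  rw [uStar, sub_sub_cancel]

theorem one_sub_uStar_one_sub {c x : ℝ} (h : c + (1 - c) * x ≠ 0) :
    1 - uStar (1 - c) x = c / (c + (1 - c) * x) := by
  rw [uStar_one_sub, one_sub_div h, add_sub_cancel_right]

/-- The integral of `f` over the first `m` steps of the stick-breaking process with `η_0 = x`. -/
noncomputable def stickIntegral (ν θs : ℝ) : (m : ℕ) → ℝ → ((Fin m → ℝ) → ℝ≥0∞) → ℝ≥0∞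
  | 0, _, f => f Fin.elim0
  | m + 1, x, f =>
    ENNReal.ofReal (1 - uStar ν x) * stickIntegral ν θs m x (fun z => f (Fin.cons 0 z)) +
    ENNReal.ofReal (uStar ν x) * ∫⁻ b in Ioo (0 : ℝ) 1, ENNReal.ofReal (θs * (1 - b) ^ (θs - 1)) *
      stickIntegral ν θs m (x * (1 - b)) (fun z => f (Fin.cons (x * b) z))

namespace Supercritical

variable {T K : ℕ → ℝ} {c θs x : ℝ} {n : ℕ → ℕ}

theorem tendsto_scaled_cycleLengthProb (h : Supercritical T K c θs) (hx : 0 < x)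
    (hn : Tendsto (fun N => (n N : ℝ) / N) atTop (𝓝 (c + (1 - c) * x))) {b : ℝ}
    (hb : b ∈ Ioo (0 : ℝ) 1) {l : ℕ → ℕ}
    (hl : Tendsto (fun N => (l N : ℝ) / N) atTop (𝓝 ((1 - c) * x * b))) :
    Tendsto (fun N => (1 - c) * x * N * cycleLengthProb (mixWeight T K N) (n N) (l N)) atTop
      (𝓝 (uStar (1 - c) x * (θs * (1 - b) ^ (θs - 1)))) := by
  have ha : 0 < (1 - c) * x := mul_pos (sub_pos.2 h.c_lt_one) hx
  have hrest : c + (1 - c) * x - (1 - c) * x * b - c = (1 - c) * x * (1 - b) := by ring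
  have hlim := (h.tendsto_natCast_mul_cycleLengthProb hn (mul_pos ha hb.1) hl
    (sub_pos.1 (hrest ▸ mul_pos ha (sub_pos.2 hb.2)))).const_mul ((1 - c) * x)
  rw [hrest, add_sub_cancel_left, mul_div_cancel_left₀ _ ha.ne', ← mul_assoc, ← mul_div_assoc,
    mul_div_right_comm, ← uStar_one_sub, mul_assoc] at hlim
  exact hlim.congr fun N => (mul_assoc _ _ _).symm

theorem le_liminf_sum_cycleLengthProb (h : Supercritical T K c θs) (hx : 0 < x)
    (hn : Tendsto (fun N => (n N : ℝ) / N) atTop (𝓝 (c + (1 - c) * x))) {H : ℕ → ℕ → ℝ≥0∞}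
    {Ψ : ℝ → ℝ≥0∞} (hH : ∀ b ∈ Ico (0 : ℝ) 1, ∀ l : ℕ → ℕ,
      Tendsto (fun N => (l N : ℝ) / N) atTop (𝓝 ((1 - c) * x * b)) →
      Ψ b ≤ liminf (fun N => H N (l N)) atTop) :
    ENNReal.ofReal (1 - uStar (1 - c) x) * Ψ 0 + ENNReal.ofReal (uStar (1 - c) x) *
        ∫⁻ b in Ioo (0 : ℝ) 1, ENNReal.ofReal (θs * (1 - b) ^ (θs - 1)) * Ψ b ≤
      liminf (fun N => ∑ l ∈ Finset.Icc 1 (n N),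
        ENNReal.ofReal (cycleLengthProb (mixWeight T K N) (n N) l) * H N l) atTop := by
  have hν : 0 < 1 - c := sub_pos.2 h.c_lt_one
  have ha : 0 < (1 - c) * x := mul_pos hν hx
  have hcv : c < c + (1 - c) * x := lt_add_of_pos_right c ha
  have hv : 0 < c + (1 - c) * x := h.c_pos.trans hcv
  have hu : 0 ≤ uStar (1 - c) x := by
    rw [uStar_one_sub]
    positivity
  have hshort : ∑' l, ENNReal.ofReal (K l / (c + (1 - c) * x)) =
      ENNReal.ofReal (1 - uStar (1 - c) x) := by
    have hsum := h.hasSum_K.div_const (c + (1 - c) * x)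
    rw [← ENNReal.ofReal_tsum_of_nonneg (fun l => div_nonneg (h.nonneg_K l) hv.le) hsum.summable,
      hsum.tsum_eq, one_sub_uStar_one_sub hv.ne']
  rw [← hshort, ← ENNReal.tsum_mul_right, ← lintegral_const_mul' _ _ ENNReal.ofReal_ne_top]
  simp only [sum_eq_tsum_indicator (L := .unconditional ℕ)]
  refine tsum_add_setLIntegral_le_liminf_tsum ha measurableSet_Ioo Ioo_subset_Ioi_self
    (fun l => ?_) fun b hb l hl => ?_
  · obtain rfl | hl0 := eq_or_ne l 0
    · rw [h.K_zero, zero_div, ENNReal.ofReal_zero, zero_mul]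
      exact zero_le
    have hl := tendsto_const_div_atTop_nhds_zero_nat (l : ℝ)
    refine mul_le_liminf_of_tendsto (ENNReal.tendsto_ofReal (h.tendsto_cycleLengthProb hcv hn l))
      (hH 0 ⟨le_rfl, one_pos⟩ (fun _ => l) (by rwa [mul_zero])) ?_
    filter_upwards [eventually_lt_of_tendsto_div hn hl hv] with N hN
    rw [Set.indicator_of_mem (Finset.mem_coe.2 (Finset.mem_Icc.2 ⟨Nat.pos_of_ne_zero hl0, hN.le⟩))]
  · have hab := mul_pos ha hb.1
    rw [← mul_assoc, ← ENNReal.ofReal_mul hu]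
    refine mul_le_liminf_of_tendsto
      (ENNReal.tendsto_ofReal (h.tendsto_scaled_cycleLengthProb hx hn hb hl))
      (hH b ⟨hb.1.le, hb.2⟩ l hl) ?_
    filter_upwards [eventually_lt_of_tendsto_div hn hl
        ((mul_lt_of_lt_one_right ha hb.2).trans (lt_add_of_pos_left _ h.c_pos)),
      (tendsto_atTop_of_tendsto_div hab tendsto_id hl).eventually_ge_atTop 1] with N hN hN1
    rw [Set.indicator_of_mem (Finset.mem_coe.2 (Finset.mem_Icc.2 ⟨hN1, hN.le⟩)), ← mul_assoc,
      ENNReal.ofReal_mul (mul_nonneg ha.le N.cast_nonneg)]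

theorem stickIntegral_le_liminf_lexSum (h : Supercritical T K c θs) (m : ℕ) (hx : 0 < x)
    (hn : Tendsto (fun N => (n N : ℝ) / N) atTop (𝓝 (c + (1 - c) * x)))
    {F : ℕ → (Fin m → ℕ) → ℝ} {f : (Fin m → ℝ) → ℝ} (hF0 : ∀ N u, 0 ≤ F N u)
    (hF : ∀ (u : ℕ → Fin m → ℕ) (z : Fin m → ℝ),
      Tendsto (fun N i => (u N i : ℝ) / (N * (1 - c))) atTop (𝓝 z) →
      Tendsto (fun N => F N (u N)) atTop (𝓝 (f z))) :
    stickIntegral (1 - c) θs m x (fun z => ENNReal.ofReal (f z)) ≤ liminf (fun N => ENNReal.ofReal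
      (lexSum (mixWeight T K N) m (n N) (F N) / expCoeff (mixWeight T K N) (n N))) atTop := by
  have hν : 0 < 1 - c := sub_pos.2 h.c_lt_one
  induction m generalizing x n with
  | zero =>
    have hlim := hF (fun _ => Fin.elim0) Fin.elim0 (tendsto_pi_nhds.2 fun i => i.elim0)
    rw [stickIntegral, ← (ENNReal.tendsto_ofReal hlim).liminf_eq]
    refine liminf_le_liminf ?_
    filter_upwards [h.eventually_expCoeff_mixWeight_pos
      (lt_add_of_pos_right c (mul_pos hν hx)) hn] with N hN
    rw [lexSum, mul_div_cancel_left₀ _ hN.ne']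
  | succ m ih =>
    have hrest : ∀ b ∈ Ico (0 : ℝ) 1, ∀ l : ℕ → ℕ,
        Tendsto (fun N => (l N : ℝ) / N) atTop (𝓝 ((1 - c) * x * b)) →
        stickIntegral (1 - c) θs m (x * (1 - b))
            (fun z => ENNReal.ofReal (f (Fin.cons (x * b) z))) ≤
          liminf (fun N => ENNReal.ofReal (lexSum (mixWeight T K N) m (n N - l N)
            (fun u => F N (Fin.cons (l N) u)) / expCoeff (mixWeight T K N) (n N - l N))) atTop := by
      intro b hb l hl
      refine ih (mul_pos hx (sub_pos.2 hb.2)) ?_ (fun _ _ => hF0 _ _) fun u z hu => hF _ _ ?_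
      · convert tendsto_natCast_sub_div hn hl ?_ using 2
        · ring
        · nlinarith [h.c_pos, mul_pos (mul_pos hν hx) (sub_pos.2 hb.2)]
      · have hfirst := hl.div_const (1 - c)
        rw [mul_assoc, mul_div_cancel_left₀ _ hν.ne'] at hfirst
        refine (Tendsto.finCons hfirst hu).congr fun N => ?_
        ext i
        refine Fin.cases ?_ (fun i => ?_) i
        · rw [Fin.cons_zero, Fin.cons_zero, div_div]
        · rw [Fin.cons_succ, Fin.cons_succ]
    rw [stickIntegral]
    refine (le_of_eq ?_).trans ((h.le_liminf_sum_cycleLengthProb hx hn (H := fun N l =>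
      ENNReal.ofReal (lexSum (mixWeight T K N) m (n N - l) (fun u => F N (Fin.cons l u)) /
        expCoeff (mixWeight T K N) (n N - l))) hrest).trans (liminf_le_liminf ?_))
    · simp only [sub_zero, mul_one, mul_zero]
    have hv : 0 < c + (1 - c) * x := add_pos h.c_pos (mul_pos hν hx)
    filter_upwards [(tendsto_atTop_of_tendsto_div hv tendsto_id hn).eventually_ne_atTop 0] with N hN
    have hw := h.mixWeight_nonneg N
    simp only [← ENNReal.ofReal_mul (h.cycleLengthProb_nonneg _ _ _)]
    rw [← ENNReal.ofReal_sum_of_nonneg fun l _ => mul_nonneg (h.cycleLengthProb_nonneg _ _ _)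
      (div_nonneg (lexSum_nonneg hw _ _ fun u => hF0 _ _) (h.expCoeff_mixWeight_nonneg _ _))]
    exact ENNReal.ofReal_le_ofReal (sum_cycleLengthProb_mul_lexSum_le hw hN (hF0 N))

end Supercritical

end LexLimit

/-! ### The law of the stick-breaking process -/

section StickBreaking

theorem betaMeasure_one {θs : ℝ} (hθ : 0 < θs) : betaMeasure 1 θs =
    (volume.restrict (Ioo (0 : ℝ) 1)).withDensity
      (fun b => ENNReal.ofReal (θs * (1 - b) ^ (θs - 1))) := by
  have hbeta : beta 1 θs = 1 / θs := by
    rw [beta, Real.Gamma_one, one_mul, add_comm, Real.Gamma_add_one hθ.ne',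
      div_mul_cancel_right₀ (Real.Gamma_pos_of_pos hθ).ne', one_div]
  rw [betaMeasure, ← withDensity_indicator measurableSet_Ioo]
  congr 1
  ext b
  by_cases hb : b ∈ Ioo (0 : ℝ) 1
  · rw [Set.indicator_of_mem hb, betaPDF_of_pos_lt_one hb.1 hb.2, hbeta, one_div_one_div, sub_self,
      Real.rpow_zero, mul_one]
  · rw [Set.indicator_of_notMem hb, betaPDF_eq, if_neg (show ¬ (0 < b ∧ b < 1) from hb),
      ENNReal.ofReal_zero]

theorem lintegral_betaMeasure_one {θs : ℝ} (hθ : 0 < θs) {f : ℝ → ℝ≥0∞} (hf : Measurable f) :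
    ∫⁻ b, f b ∂(betaMeasure 1 θs) =
      ∫⁻ b in Ioo (0 : ℝ) 1, ENNReal.ofReal (θs * (1 - b) ^ (θs - 1)) * f b := by
  rw [betaMeasure_one hθ, lintegral_withDensity_eq_lintegral_mul _ (by fun_prop) hf]
  rfl

theorem setLIntegral_Icc_ite_le {s : ℝ} (hs : s ∈ Icc (0 : ℝ) 1) (A C : ℝ≥0∞) :
    ∫⁻ u in Icc (0 : ℝ) 1, (if u ≤ s then A else C) =
      ENNReal.ofReal (1 - s) * C + ENNReal.ofReal s * A := by
  have hdisj : Disjoint (Icc 0 s) (Ioc s 1) :=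
    Set.disjoint_left.2 fun u hu hu' => hu'.1.not_ge hu.2
  rw [← Icc_union_Ioc_eq_Icc hs.1 hs.2, lintegral_union measurableSet_Ioc hdisj,
    setLIntegral_congr_fun (g := fun _ => A) measurableSet_Icc fun u hu => if_pos hu.2,
    setLIntegral_congr_fun (g := fun _ => C) measurableSet_Ioc fun u hu => if_neg hu.1.not_ge,
    setLIntegral_const, setLIntegral_const, Real.volume_Icc, Real.volume_Ioc, sub_zero, add_comm,
    mul_comm C, mul_comm A]

theorem uStar_mem_Icc {ν x : ℝ} (hν : ν ∈ Ioo (0 : ℝ) 1) (hx : 0 ≤ x) :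
    uStar ν x ∈ Icc (0 : ℝ) 1 := by
  have hνx : 0 ≤ ν * x := mul_nonneg hν.1.le hx
  have hν1 : 0 < 1 - ν := sub_pos.2 hν.2
  exact ⟨div_nonneg hνx (by linarith), (div_le_one (by linarith)).2 (by linarith)⟩

theorem measurable_stickD (ν : ℝ) : Measurable fun p : ℝ × ℝ × ℝ => stickD ν p.1 p.2.1 p.2.2 := by
  unfold stickD uStar
  exact (Measurable.ite (measurableSet_le (by fun_prop) (by fun_prop)) measurable_const
    measurable_const).mul (by fun_prop)

theorem lintegral_comp_stickD {ν θs x : ℝ} (hν : ν ∈ Ioo (0 : ℝ) 1) (hθ : 0 < θs) (hx : 0 ≤ x)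
    {H : ℝ → ℝ≥0∞} (hH : Measurable H) :
    ∫⁻ q : ℝ × ℝ, H (stickD ν x q.1 q.2)
        ∂((volume.restrict (Icc (0 : ℝ) 1)).prod (betaMeasure 1 θs)) =
      ENNReal.ofReal (1 - uStar ν x) * H 0 + ENNReal.ofReal (uStar ν x) *
        ∫⁻ b in Ioo (0 : ℝ) 1, ENNReal.ofReal (θs * (1 - b) ^ (θs - 1)) * H b := by
  have := isProbabilityMeasureBeta one_pos hθ
  have hinner : ∀ u, ∫⁻ b, H (stickD ν x u b) ∂(betaMeasure 1 θs) =
      if u ≤ uStar ν x then ∫⁻ b, H b ∂(betaMeasure 1 θs) else H 0 := fun u => by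
    unfold stickD
    split_ifs
    · simp only [one_mul]
    · simp only [zero_mul, lintegral_const, measure_univ, mul_one]
  rw [lintegral_prod (fun q : ℝ × ℝ => H (stickD ν x q.1 q.2))
    (hH.comp ((measurable_stickD ν).comp
      (by fun_prop : Measurable fun q : ℝ × ℝ => (x, q)))).aemeasurable,
    lintegral_congr hinner, setLIntegral_Icc_ite_le (uStar_mem_Icc hν hx),
    lintegral_betaMeasure_one hθ hH]

/-- The lengths of the first `m` sticks broken off a stick of length `x`, as a function of the
driving variables `p i = (U_{i+1}, B_{i+1})`. -/
noncomputable def stickVec (ν : ℝ) : (m : ℕ) → ℝ → (Fin m → ℝ × ℝ) → (Fin m → ℝ)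
  | 0, _, _ => Fin.elim0
  | m + 1, x, p => Fin.cons (x * stickD ν x (p 0).1 (p 0).2)
      (stickVec ν m (x * (1 - stickD ν x (p 0).1 (p 0).2)) (fun i => p i.succ))

theorem stickVec_stickEta (ν : ℝ) (u b : ℕ → ℝ) (m k : ℕ) :
    stickVec ν m (stickEta ν u b k) (fun i => (u (k + i), b (k + i))) =
      fun i : Fin m => stickX ν u b (k + i) := by
  induction m generalizing k with
  | zero => exact Subsingleton.elim _ _
  | succ m ih =>
    refine (Fin.cons_self_tail _).symm.trans (Eq.trans ?_ (Fin.cons_self_tail _))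
    congr 1
    refine Eq.trans ?_ ((ih (k + 1)).trans ?_)
    · simp only [stickVec, Fin.tail_cons, Fin.val_succ, Fin.val_zero, add_zero, stickEta,
        add_assoc, add_comm 1]
    · simp only [Fin.tail_def, Fin.val_succ, add_assoc, add_comm 1]

theorem measurable_finCons {α : Type*} [MeasurableSpace α] {m : ℕ} {g : α → ℝ}
    {h : α → Fin m → ℝ} (hg : Measurable g) (hh : Measurable h) :
    Measurable fun a => (Fin.cons (g a) (h a) : Fin (m + 1) → ℝ) :=
  measurable_pi_iff.2 (Fin.cases hg fun i => (measurable_pi_apply i).comp hh)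

theorem measurable_stickVec (ν : ℝ) (m : ℕ) :
    Measurable fun a : ℝ × (Fin m → ℝ × ℝ) => stickVec ν m a.1 a.2 := by
  induction m with
  | zero => exact measurable_const
  | succ m ih =>
    have hD : Measurable fun a : ℝ × (Fin (m + 1) → ℝ × ℝ) => stickD ν a.1 (a.2 0).1 (a.2 0).2 :=
      (measurable_stickD ν).comp (by fun_prop : Measurable fun a : ℝ × (Fin (m + 1) → ℝ × ℝ) =>
        (a.1, (a.2 0).1, (a.2 0).2))
    exact measurable_finCons (measurable_fst.mul hD) (ih.comp ((measurable_fst.mul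
      (measurable_const.sub hD)).prodMk
      (measurable_pi_iff.2 fun i => (measurable_pi_apply i.succ).comp measurable_snd)))

theorem lintegral_comp_stickVec {ν θs : ℝ} (hν : ν ∈ Ioo (0 : ℝ) 1) (hθ : 0 < θs) (m : ℕ) {x : ℝ}
    (hx : 0 ≤ x) {f : (Fin m → ℝ) → ℝ≥0∞} (hf : Measurable f) :
    ∫⁻ p, f (stickVec ν m x p)
      ∂(Measure.pi fun _ : Fin m => (volume.restrict (Icc (0 : ℝ) 1)).prod (betaMeasure 1 θs)) =
      stickIntegral ν θs m x f := by
  have := isProbabilityMeasureBeta one_pos hθ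
  induction m generalizing x with
  | zero => simp [stickIntegral, stickVec]
  | succ m ih =>
    set μ := (volume.restrict (Icc (0 : ℝ) 1)).prod (betaMeasure 1 θs)
    set H : ℝ → ℝ≥0∞ := fun d => ∫⁻ q, f (Fin.cons (x * d) (stickVec ν m (x * (1 - d)) q))
      ∂(Measure.pi fun _ : Fin m => μ)
    have hcons : ∀ y : ℝ, Measurable fun z : Fin m → ℝ => f (Fin.cons y z) := fun y =>
      hf.comp (measurable_finCons measurable_const measurable_id)
    have hH : Measurable H := by
      refine Measurable.lintegral_prod_right' (f := fun a : ℝ × (Fin m → ℝ × ℝ) =>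
        f (Fin.cons (x * a.1) (stickVec ν m (x * (1 - a.1)) a.2))) ?_
      exact hf.comp (measurable_finCons (by fun_prop) ((measurable_stickVec ν m).comp
        (by fun_prop : Measurable fun a : ℝ × (Fin m → ℝ × ℝ) => (x * (1 - a.1), a.2))))
    have hsplit := (measurePreserving_piFinSuccAbove (fun _ : Fin (m + 1) => μ) 0).symm
    have hstick : Measurable fun p => f (stickVec ν (m + 1) x p) :=
      hf.comp ((measurable_stickVec ν (m + 1)).comp (by fun_prop :
        Measurable fun p : Fin (m + 1) → ℝ × ℝ => (x, p)))
    have h_integral : ∀ b ∈ Ico (0 : ℝ) 1,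
        H b = stickIntegral ν θs m (x * (1 - b)) (fun z => f (Fin.cons (x * b) z)) :=
      fun b hb => ih (mul_nonneg hx (sub_nonneg.2 hb.2.le)) (hcons _)
    calc ∫⁻ p, f (stickVec ν (m + 1) x p) ∂(Measure.pi fun _ => μ)
        = ∫⁻ q, H (stickD ν x q.1 q.2) ∂μ := by
          rw [← hsplit.lintegral_comp hstick]
          exact lintegral_prod _ (hstick.comp hsplit.measurable).aemeasurable
      _ = ENNReal.ofReal (1 - uStar ν x) * H 0 + ENNReal.ofReal (uStar ν x) *
          ∫⁻ b in Ioo (0 : ℝ) 1, ENNReal.ofReal (θs * (1 - b) ^ (θs - 1)) * H b :=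
        lintegral_comp_stickD hν hθ hx hH
      _ = stickIntegral ν θs (m + 1) x f := by
        rw [stickIntegral, h_integral 0 ⟨le_rfl, one_pos⟩, sub_zero, mul_one, mul_zero]
        congr 2
        exact setLIntegral_congr_fun measurableSet_Ioo fun b hb => by
          rw [h_integral b ⟨hb.1.le, hb.2⟩]

section Driven

variable {Ω : Type*} [MeasurableSpace Ω] {P : Measure Ω} {U B : ℕ → Ω → ℝ} {ν θs : ℝ}

theorem map_driving_eq_pi [IsProbabilityMeasure P] (hθ : 0 < θs)
    (hU : ∀ n, HasLaw (U n) (volume.restrict (Icc (0 : ℝ) 1)) P)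
    (hB : ∀ n, HasLaw (B n) (betaMeasure 1 θs) P) (hindep : iIndepFun (Sum.elim U B) P) (m : ℕ) :
    P.map (fun ω (i : Fin m) => (U i ω, B i ω)) =
      Measure.pi fun _ : Fin m => (volume.restrict (Icc (0 : ℝ) 1)).prod (betaMeasure 1 θs) := by
  have := isProbabilityMeasureBeta one_pos hθ
  set g : Fin m ⊕ Fin m → ℕ ⊕ ℕ := Sum.map Fin.val Fin.val
  set law : Fin m ⊕ Fin m → Measure ℝ :=
    Sum.elim (fun _ => volume.restrict (Icc (0 : ℝ) 1)) (fun _ => betaMeasure 1 θs)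
  have hlaw : ∀ i, HasLaw (Sum.elim U B (g i)) (law i) P :=
    Sum.rec (fun i => hU i) fun i => hB i
  have : ∀ i, SigmaFinite (law i) :=
    Sum.rec (fun _ => inferInstanceAs (SigmaFinite (volume.restrict (Icc (0 : ℝ) 1))))
      fun _ => inferInstanceAs (SigmaFinite (betaMeasure 1 θs))
  have hmap := (hindep.precomp (Sum.map_injective.2 ⟨Fin.val_injective, Fin.val_injective⟩ :
    Function.Injective g)).map_fun_eq_pi_map fun i => (hlaw i).aemeasurable
  simp only [(hlaw _).map_eq] at hmap
  have hpair := (measurePreserving_sumPiEquivProdPi law).trans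
    (measurePreserving_arrowProdEquivProdArrow ℝ ℝ (Fin m)
      (fun _ => volume.restrict (Icc (0 : ℝ) 1)) (fun _ => betaMeasure 1 θs)).symm
  rw [← hpair.map_eq, ← hmap, AEMeasurable.map_map_of_aemeasurable hpair.measurable.aemeasurable
    (aemeasurable_pi_lambda _ fun i => (hlaw i).aemeasurable)]
  rfl

theorem stickX_eq_stickVec (ν : ℝ) (u b : ℕ → ℝ) (m : ℕ) :
    (fun i : Fin m => stickX ν u b i) = stickVec ν m 1 (fun i => (u i, b i)) := by
  simpa only [zero_add, stickEta] using (stickVec_stickEta ν u b m 0).symm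

theorem aemeasurable_stickX (hU : ∀ n, AEMeasurable (U n) P) (hB : ∀ n, AEMeasurable (B n) P)
    (ν : ℝ) (m : ℕ) :
    AEMeasurable (fun ω (i : Fin m) => stickX ν (fun n => U n ω) (fun n => B n ω) i) P := by
  refine AEMeasurable.congr ?_
    (Eventually.of_forall fun ω => (stickX_eq_stickVec ν (U · ω) (B · ω) m).symm)
  exact (measurable_stickVec ν m).comp_aemeasurable (aemeasurable_const.prodMk
    (aemeasurable_pi_lambda _ fun i : Fin m => (hU i).prodMk (hB i)))

theorem lintegral_comp_stickX [IsProbabilityMeasure P] (hν : ν ∈ Ioo (0 : ℝ) 1) (hθ : 0 < θs)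
    (hU : ∀ n, HasLaw (U n) (volume.restrict (Icc (0 : ℝ) 1)) P)
    (hB : ∀ n, HasLaw (B n) (betaMeasure 1 θs) P) (hindep : iIndepFun (Sum.elim U B) P) (m : ℕ)
    {f : (Fin m → ℝ) → ℝ≥0∞} (hf : Measurable f) :
    ∫⁻ ω, f (fun i => stickX ν (fun n => U n ω) (fun n => B n ω) i) ∂P =
      stickIntegral ν θs m 1 f := by
  have hstick : Measurable fun p => f (stickVec ν m 1 p) :=
    hf.comp ((measurable_stickVec ν m).comp (by fun_prop :
      Measurable fun p : Fin m → ℝ × ℝ => ((1 : ℝ), p)))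
  rw [← lintegral_comp_stickVec hν hθ m zero_le_one hf, ← map_driving_eq_pi hθ hU hB hindep m,
    lintegral_map' hstick.aemeasurable
      (aemeasurable_pi_lambda _ fun i => (hU i).aemeasurable.prodMk (hB i).aemeasurable)]
  exact lintegral_congr fun ω => congrArg f (stickX_eq_stickVec ν (U · ω) (B · ω) m)

theorem map_stickX_zero [IsProbabilityMeasure P] (hν : ν ∈ Ioo (0 : ℝ) 1) (hθ : 0 < θs)
    (hU : ∀ n, HasLaw (U n) (volume.restrict (Icc (0 : ℝ) 1)) P)
    (hB : ∀ n, HasLaw (B n) (betaMeasure 1 θs) P) (hindep : iIndepFun (Sum.elim U B) P) :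
    P.map (fun ω => stickX ν (fun n => U n ω) (fun n => B n ω) 0) =
      ENNReal.ofReal (1 - ν) • Measure.dirac (0 : ℝ) +
        (volume.restrict (Ioo (0 : ℝ) 1)).withDensity
          (fun x => ENNReal.ofReal (ν * θs * (1 - x) ^ (θs - 1))) := by
  have hae : AEMeasurable (fun ω => stickX ν (fun n => U n ω) (fun n => B n ω) 0) P :=
    (measurable_pi_apply (0 : Fin 1)).comp_aemeasurable
      (aemeasurable_stickX (fun n => (hU n).aemeasurable) (fun n => (hB n).aemeasurable) ν 1)
  have hu : uStar ν 1 = ν := by rw [uStar, mul_one, sub_add_cancel, div_one]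
  refine Measure.ext_of_lintegral _ fun f hf => ?_
  have hfirst := lintegral_comp_stickX hν hθ hU hB hindep 1 (hf.comp (measurable_pi_apply 0))
  simp only [stickIntegral, hu, Function.comp_apply, Fin.cons_zero, one_mul, Fin.val_zero] at hfirst
  rw [lintegral_map' hf.aemeasurable hae, hfirst, lintegral_add_measure, lintegral_smul_measure,
    lintegral_dirac' _ hf, lintegral_withDensity_eq_lintegral_mul _ (by fun_prop) hf,
    ← lintegral_const_mul' _ _ ENNReal.ofReal_ne_top, smul_eq_mul]
  simp only [Pi.mul_apply, mul_assoc, ENNReal.ofReal_mul hν.1.le]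

end Driven

end StickBreaking

/-! ### Expectations under the surrogate-spatial measure -/

section Expectation

variable {θ κ : ℕ → ℝ≥0} {R : ℝ} {N : ℕ}

theorem mixWeight_scaled_nonneg (hR : 0 ≤ R) (N j : ℕ) :
    0 ≤ mixWeight (scaled θ R) (scaled κ R) N j :=
  add_nonneg (scaled_nonneg hR j) (mul_nonneg N.cast_nonneg (scaled_nonneg hR j))

theorem cycleWeight_mixWeight_scaled (hR : 0 ≤ R) (σ : Equiv.Perm (Fin N)) :
    cycleWeight (mixWeight (scaled θ R) (scaled κ R) N) ∅ σ = weight θ κ N σ * R ^ N := by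
  set w : ℕ → ℝ := fun j => θ j + N * κ j
  have hw0 : ∀ j, 0 ≤ w j := fun j => by positivity
  have hweight : (weight θ κ N σ : ℝ) = cycleWeight w ∅ σ := by
    rw [cycleWeight_empty hw0, weight]
    push_cast
    rfl
  have hpow : R ^ N = ∏ _i ∈ (∅ : Finset (Fin N))ᶜ, R := by
    rw [Finset.prod_const, Finset.compl_empty, Finset.card_univ, Fintype.card_fin]
  rw [hweight, hpow, cycleWeight, cycleWeight, ← Finset.prod_mul_distrib]
  refine Finset.prod_congr rfl fun i _ => ?_
  have hl := (card_cycleSet_pos σ i).ne'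
  have hmix : mixWeight (scaled θ R) (scaled κ R) N (cycleSet σ i).card =
      w (cycleSet σ i).card * R ^ (cycleSet σ i).card := by
    rw [mixWeight, scaled_of_ne_zero hl, scaled_of_ne_zero hl]
    ring
  rw [hmix, Real.mul_rpow (hw0 _) (pow_nonneg hR _), one_div, Real.pow_rpow_inv_natCast hR hl]

theorem sum_weight_mul_pow (hR : 0 ≤ R) :
    ((∑ σ, weight θ κ N σ : ℝ≥0) : ℝ) * R ^ N =
      N.factorial * expCoeff (mixWeight (scaled θ R) (scaled κ R) N) N := by
  have hsum := sum_cycleWeight (mixWeight_scaled_nonneg (θ := θ) (κ := κ) hR N)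
    (∅ : Finset (Fin N))
  simp only [permFixing_empty, Finset.compl_empty, Finset.card_univ, Fintype.card_fin,
    cycleWeight_mixWeight_scaled hR] at hsum
  rw [← hsum, NNReal.coe_sum, Finset.sum_mul]

theorem normConst_pos (hR : 0 ≤ R)
    (hN : 0 < expCoeff (mixWeight (scaled θ R) (scaled κ R) N) N) : 0 < normConst θ κ N := by
  have hfac : (0 : ℝ) < N.factorial := Nat.cast_pos.2 N.factorial_pos
  have hsum : 0 < ((∑ σ, weight θ κ N σ : ℝ≥0) : ℝ) * R ^ N :=
    (mul_pos hfac hN).trans_eq (sum_weight_mul_pow hR).symm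
  exact div_pos (NNReal.coe_pos.1 (pos_of_mul_pos_left hsum (pow_nonneg hR N)))
    (Nat.cast_pos.2 N.factorial_pos)

theorem surrogateMeasure_real_singleton (h : normConst θ κ N ≠ 0) (σ : Equiv.Perm (Fin N)) :
    (surrogateMeasure θ κ N).real {σ} = weight θ κ N σ / (∑ τ, weight θ κ N τ : ℝ≥0) := by
  have hsing : MeasurableSingletonClass (Equiv.Perm (Fin N)) := ⟨fun _ => trivial⟩
  have hfac : (N.factorial : ℝ≥0) ≠ 0 := Nat.cast_ne_zero.2 N.factorial_ne_zero
  rw [surrogateMeasure, if_neg h, normConst, mul_div_cancel₀ _ hfac, measureReal_def,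
    Measure.coe_finsetSum, Finset.sum_apply, Finset.sum_eq_single σ]
  · simp only [Measure.smul_apply, measurableSet_singleton, Measure.dirac_apply', smul_eq_mul,
      Set.indicator_of_mem (Set.mem_singleton σ), Pi.one_apply, mul_one, ENNReal.coe_toReal,
      NNReal.coe_div]
  · intro τ _ hτ
    rw [Measure.smul_apply, Measure.dirac_apply' _ (measurableSet_singleton σ),
      Set.indicator_of_notMem (Set.notMem_singleton_iff.2 hτ), smul_zero]
  · exact fun hσ => absurd (Finset.mem_univ σ) hσ

theorem integral_surrogateMeasure (hR : 0 < R)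
    (hN : 0 < expCoeff (mixWeight (scaled θ R) (scaled κ R) N) N) (g : Equiv.Perm (Fin N) → ℝ) :
    ∫ σ, g σ ∂(surrogateMeasure θ κ N) =
      (∑ σ, cycleWeight (mixWeight (scaled θ R) (scaled κ R) N) ∅ σ * g σ) /
        (N.factorial * expCoeff (mixWeight (scaled θ R) (scaled κ R) N) N) := by
  have hsing : MeasurableSingletonClass (Equiv.Perm (Fin N)) := ⟨fun _ => trivial⟩
  rw [integral_fintype .of_finite, Finset.sum_div]
  refine Finset.sum_congr rfl fun σ _ => ?_
  rw [surrogateMeasure_real_singleton (normConst_pos hR.le hN).ne', smul_eq_mul,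
    cycleWeight_mixWeight_scaled hR.le, ← sum_weight_mul_pow hR.le, mul_right_comm,
    mul_div_mul_right _ _ (pow_pos hR N).ne', div_mul_eq_mul_div]

theorem integral_lexLength (hR : 0 < R)
    (hN : 0 < expCoeff (mixWeight (scaled θ R) (scaled κ R) N) N) (m : ℕ) (f : (Fin m → ℕ) → ℝ) :
    ∫ σ, f (fun i => lexLength σ i) ∂(surrogateMeasure θ κ N) =
      lexSum (mixWeight (scaled θ R) (scaled κ R) N) m N f /
        expCoeff (mixWeight (scaled θ R) (scaled κ R) N) N := by
  have hsum := sum_cycleWeight_mul_lexFrom (mixWeight_scaled_nonneg (θ := θ) (κ := κ) hR.le N) m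
    (∅ : Finset (Fin N)) f
  simp only [permFixing_empty, Finset.compl_empty, Finset.card_univ, Fintype.card_fin,
    lexFrom_empty] at hsum
  rw [integral_surrogateMeasure hR hN, hsum,
    mul_div_mul_left _ _ (Nat.cast_ne_zero.2 N.factorial_ne_zero)]

theorem integral_card_cycleSet (hR : 0 < R)
    (hN : 0 < expCoeff (mixWeight (scaled θ R) (scaled κ R) N) N) (x : Fin N) (f : ℕ → ℝ) :
    ∫ σ, f (cycleSet σ x).card ∂(surrogateMeasure θ κ N) =
      ∑ l ∈ Finset.Icc 1 N, cycleLengthProb (mixWeight (scaled θ R) (scaled κ R) N) N l * f l := by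
  have hfac : ((N - 1).factorial : ℝ) ≠ 0 := Nat.cast_ne_zero.2 (N - 1).factorial_ne_zero
  rw [integral_surrogateMeasure hR hN,
    sum_cycleWeight_mul_card_cycleSet (mixWeight_scaled_nonneg hR.le N),
    ← factorial_pred_mul x.pos.ne', mul_div_mul_left _ _ hfac, Finset.sum_div]
  exact Finset.sum_congr rfl fun l _ => by rw [cycleLengthProb, mul_right_comm, mul_div_right_comm]

theorem sum_Ioc_mul_cycleCount (K : ℕ) (σ : Equiv.Perm (Fin N)) :
    ∑ j ∈ Finset.Ioc K N, (j : ℝ) * (cycleCount σ j : ℝ) =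
      ∑ i : Fin N, if K < (cycleSet σ i).card then (1 : ℝ) else 0 := by
  have hcount : ∀ j ∈ Finset.Ioc K N, (j : ℝ) * (cycleCount σ j : ℝ) =
      ∑ i : Fin N, if (cycleSet σ i).card = j then (1 : ℝ) else 0 := fun j hj => by
    rw [Finset.sum_boole]
    exact_mod_cast mul_cycleCount σ (Nat.one_le_of_lt (Finset.mem_Ioc.1 hj).1)
  rw [Finset.sum_congr rfl hcount, Finset.sum_comm]
  refine Finset.sum_congr rfl fun i _ => ?_
  simp only [Finset.sum_ite_eq, Finset.mem_Ioc, card_cycleSet_le σ i, and_true]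

theorem sum_cycleLengthProb {w : ℕ → ℝ} {n : ℕ} (hn : n ≠ 0) (hw : expCoeff w n ≠ 0) :
    ∑ l ∈ Finset.Icc 1 n, cycleLengthProb w n l = 1 := by
  simp only [cycleLengthProb]
  rw [← Finset.sum_div, ← mul_expCoeff, div_self (mul_ne_zero (Nat.cast_ne_zero.2 hn) hw)]

theorem integral_sum_Ioc_mul_cycleCount (hR : 0 < R) (hN0 : N ≠ 0)
    (hN : 0 < expCoeff (mixWeight (scaled θ R) (scaled κ R) N) N) {K : ℕ} (hK : K ≤ N) :
    1 / (N : ℝ) * ∫ σ, (∑ j ∈ Finset.Ioc K N, (j : ℝ) * (cycleCount σ j : ℝ))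
        ∂(surrogateMeasure θ κ N) =
      1 - ∑ l ∈ Finset.Icc 1 K,
        cycleLengthProb (mixWeight (scaled θ R) (scaled κ R) N) N l := by
  have hsing : MeasurableSingletonClass (Equiv.Perm (Fin N)) := ⟨fun _ => trivial⟩
  have hsplit := Finset.sum_filter_not_add_sum_filter (Finset.Icc 1 N) (fun l : ℕ => K < l)
    fun l => cycleLengthProb (mixWeight (scaled θ R) (scaled κ R) N) N l
  have hshort : (Finset.Icc 1 N).filter (fun l : ℕ => ¬ K < l) = Finset.Icc 1 K := by
    ext l
    simp only [Finset.mem_filter, Finset.mem_Icc]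
    omega
  rw [hshort, sum_cycleLengthProb hN0 hN.ne', Finset.sum_filter] at hsplit
  simp only [sum_Ioc_mul_cycleCount]
  rw [integral_finsetSum _ fun i _ => .of_finite, Finset.sum_congr rfl fun i _ =>
      integral_card_cycleSet hR hN i fun l => if K < l then 1 else 0, Finset.sum_const,
    Finset.card_univ, Fintype.card_fin, nsmul_eq_mul, one_div,
    inv_mul_cancel_left₀ (Nat.cast_ne_zero.2 hN0)]
  simp only [mul_ite, mul_one, mul_zero]
  exact eq_sub_of_add_eq' hsplit

theorem tendsto_natCast_div_self : Tendsto (fun N : ℕ => (N : ℝ) / N) atTop (𝓝 1) := by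
  refine tendsto_const_nhds.congr' ?_
  filter_upwards [eventually_ne_atTop 0] with N hN
  rw [div_self (Nat.cast_ne_zero.2 hN)]

variable {c θs : ℝ}

theorem Supercritical.eventually_expCoeff_self_pos {T K : ℕ → ℝ} (h : Supercritical T K c θs) :
    ∀ᶠ N in atTop, 0 < expCoeff (mixWeight T K N) N :=
  h.eventually_expCoeff_mixWeight_pos h.c_lt_one tendsto_natCast_div_self

theorem longFraction_eq_one_sub_sum (hR : 0 < R)
    (h : Supercritical (scaled θ R) (scaled κ R) c θs) (K : ℕ) :
    longFraction θ κ K = 1 - ∑ l ∈ Finset.Icc 1 K, scaled κ R l := by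
  have hlim := (tendsto_finsetSum (Finset.Icc 1 K) fun l _ =>
    h.tendsto_cycleLengthProb h.c_lt_one tendsto_natCast_div_self l).const_sub 1
  simp only [div_one] at hlim
  refine (hlim.congr' ?_).liminf_eq
  filter_upwards [h.eventually_expCoeff_self_pos, eventually_ge_atTop K, eventually_ne_atTop 0]
    with N hN hK hN0
  exact (integral_sum_Ioc_mul_cycleCount hR hN0 hN hK).symm

theorem tendsto_longFraction (hR : 0 < R) (h : Supercritical (scaled θ R) (scaled κ R) c θs) :
    Tendsto (longFraction θ κ) atTop (𝓝 (1 - c)) := by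
  rw [funext (longFraction_eq_one_sub_sum hR h)]
  refine ((h.hasSum_K.tendsto_sum_nat.comp (tendsto_add_atTop_nat 1)).congr fun K => ?_).const_sub 1
  rw [Function.comp_apply, Finset.range_eq_Ico, Finset.sum_eq_sum_Ico_succ_bot K.succ_pos,
    scaled_zero, zero_add, zero_add]
  rfl

end Expectation

section Convergence

theorem le_liminf_of_ofReal_le {u : ℕ → ℝ} {A M : ℝ} (hu : ∀ N, u N ∈ Icc 0 M)
    (hA : ENNReal.ofReal A ≤ liminf (fun N => ENNReal.ofReal (u N)) atTop) :
    A ≤ liminf u atTop := by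
  have hcobdd : IsCoboundedUnder (· ≥ ·) atTop u :=
    isCoboundedUnder_ge_of_le atTop fun N => (hu N).2
  have hbdd : IsBoundedUnder (· ≥ ·) atTop u := isBoundedUnder_of ⟨0, fun N => (hu N).1⟩
  have hmap := ENNReal.ofReal_mono.map_liminf_of_continuousAt u
    ENNReal.continuous_ofReal.continuousAt hcobdd hbdd
  exact (ENNReal.ofReal_le_ofReal_iff (le_liminf_of_le hcobdd
    (Eventually.of_forall fun N => (hu N).1))).1 (hA.trans_eq hmap.symm)

theorem tendstoInDistribution_of_ofReal_integral_le_liminf {E : Type*} [TopologicalSpace E]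
    [MeasurableSpace E] [OpensMeasurableSpace E] {Ω : ℕ → Type*} [∀ N, MeasurableSpace (Ω N)]
    {μ : ∀ N, Measure (Ω N)} [∀ N, IsProbabilityMeasure (μ N)] {Ω' : Type*} [MeasurableSpace Ω']
    {P : Measure Ω'} [IsProbabilityMeasure P] {X : ∀ N, Ω N → E} {Z : Ω' → E}
    (hX : ∀ N, AEMeasurable (X N) (μ N)) (hZ : AEMeasurable Z P)
    (h : ∀ f : BoundedContinuousFunction E ℝ, 0 ≤ f → ∫⁻ ω, ENNReal.ofReal (f (Z ω)) ∂P ≤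
      liminf (fun N => ENNReal.ofReal (∫ ω, f (X N ω) ∂(μ N))) atTop) :
    TendstoInDistribution X atTop Z μ P := by
  have := Measure.isProbabilityMeasure_map hZ
  have := fun N => Measure.isProbabilityMeasure_map (hX N)
  refine ⟨hX, hZ, ProbabilityMeasure.tendsto_iff_forall_integral_tendsto.2
    (BoundedContinuousFunction.tendsto_integral_of_forall_integral_le_liminf_integral
      (μ := P.map Z) (μs := fun N => (μ N).map (X N)) fun f hf => ?_)⟩
  refine le_liminf_of_ofReal_le (M := ‖f‖) (fun N => ⟨integral_nonneg hf, ?_⟩) ?_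
  · exact (le_abs_self _).trans (f.norm_integral_le_norm _)
  · rw [ofReal_integral_eq_lintegral_ofReal (f.integrable _) (Eventually.of_forall hf),
      lintegral_map' f.continuous.measurable.ennreal_ofReal.aemeasurable hZ]
    refine (h f hf).trans_eq (congrArg (liminf · atTop) (funext fun N => ?_))
    rw [integral_map (hX N) f.continuous.measurable.aestronglyMeasurable]

variable {θ κ : ℕ → ℝ≥0} {R c θs : ℝ} {Ω : Type*} [MeasurableSpace Ω] {P : Measure Ω}
  [IsProbabilityMeasure P] {U B : ℕ → Ω → ℝ}

theorem tendstoInDistribution_lexLength (hR : 0 < R)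
    (h : Supercritical (scaled θ R) (scaled κ R) c θs)
    (hU : ∀ n, HasLaw (U n) (volume.restrict (Icc (0 : ℝ) 1)) P)
    (hB : ∀ n, HasLaw (B n) (betaMeasure 1 θs) P) (hindep : iIndepFun (Sum.elim U B) P) (m : ℕ) :
    TendstoInDistribution
      (fun (N : ℕ) (σ : Equiv.Perm (Fin N)) (i : Fin m) =>
        1 / ((N : ℝ) * (1 - c)) * (lexLength σ (i : ℕ) : ℝ))
      atTop
      (fun (ω : Ω) (i : Fin m) => stickX (1 - c) (fun n => U n ω) (fun n => B n ω) (i : ℕ))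
      (fun N : ℕ => surrogateMeasure θ κ N) P := by
  have hν : 1 - c ∈ Ioo (0 : ℝ) 1 := ⟨sub_pos.2 h.c_lt_one, sub_lt_self 1 h.c_pos⟩
  refine tendstoInDistribution_of_ofReal_integral_le_liminf
    (fun N => Measurable.aemeasurable measurable_from_top)
    (aemeasurable_stickX (fun n => (hU n).aemeasurable) (fun n => (hB n).aemeasurable) _ m)
    fun f hf => ?_
  rw [lintegral_comp_stickX hν h.θs_pos hU hB hindep m
    (f := fun z => ENNReal.ofReal (f z)) f.continuous.measurable.ennreal_ofReal]
  refine (h.stickIntegral_le_liminf_lexSum m one_pos (n := fun N => N) ?_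
    (F := fun N u => f fun i => 1 / ((N : ℝ) * (1 - c)) * u i) (fun N u => hf _)
    fun u z hz => (f.continuous.tendsto z).comp ?_).trans (liminf_le_liminf ?_)
  · simpa only [mul_one, add_sub_cancel] using tendsto_natCast_div_self
  · simpa only [one_div_mul_eq_div] using hz
  · filter_upwards [h.eventually_expCoeff_self_pos] with N hN
    rw [integral_lexLength hR hN m fun u => f fun i => 1 / ((N : ℝ) * (1 - c)) * u i]

end Convergence

end SurrogateSpatial

theorem mainTheorem6_general {θ κ : ℕ → ℝ≥0} {R c θs : ℝ} (hR : 0 < R)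
    (h : Supercritical (scaled θ R) (scaled κ R) c θs) {ν : ℝ} (hν : ν = 1 - c)
    {Ω : Type*} [MeasurableSpace Ω] {P : Measure Ω} [IsProbabilityMeasure P] {U B : ℕ → Ω → ℝ}
    (hU : ∀ n, HasLaw (U n) (volume.restrict (Set.Icc (0 : ℝ) 1)) P)
    (hB : ∀ n, HasLaw (B n) (betaMeasure 1 θs) P)
    (hindep : iIndepFun (Sum.elim U B) P) :
    (∀ᶠ N : ℕ in atTop, 0 < normConst θ κ N) ∧
    0 < ν ∧
    Tendsto (longFraction θ κ) atTop (𝓝 ν) ∧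
    (∀ m : ℕ, TendstoInDistribution
      (fun (N : ℕ) (σ : Equiv.Perm (Fin N)) (i : Fin m) =>
        1 / ((N : ℝ) * ν) * (lexLength σ (i : ℕ) : ℝ))
      atTop
      (fun (ω : Ω) (i : Fin m) => stickX ν (fun n => U n ω) (fun n => B n ω) (i : ℕ))
      (fun N : ℕ => surrogateMeasure θ κ N) P) ∧
    TendstoInDistribution
      (fun (N : ℕ) (σ : Equiv.Perm (Fin N)) => (lexLength σ 0 : ℝ) / ((N : ℝ) * ν))
      atTop
      (fun ω : Ω => stickX ν (fun n => U n ω) (fun n => B n ω) 0)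
      (fun N : ℕ => surrogateMeasure θ κ N) P ∧
    P.map (fun ω : Ω => stickX ν (fun n => U n ω) (fun n => B n ω) 0) =
      ENNReal.ofReal (1 - ν) • Measure.dirac (0 : ℝ) +
        (volume.restrict (Set.Ioo (0 : ℝ) 1)).withDensity
          (fun x => ENNReal.ofReal (ν * θs * (1 - x) ^ (θs - 1))) := by
  subst hν
  have hν : 1 - c ∈ Set.Ioo (0 : ℝ) 1 := ⟨sub_pos.2 h.c_lt_one, sub_lt_self 1 h.c_pos⟩
  have hjoint := tendstoInDistribution_lexLength hR h hU hB hindep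
  refine ⟨h.eventually_expCoeff_self_pos.mono fun N hN => normConst_pos hR.le hN, hν.1,
    tendsto_longFraction hR h, hjoint, ?_, map_stickX_zero hν h.θs_pos hU hB hindep⟩
  simpa only [Function.comp_def, one_div_mul_eq_div, Fin.val_zero] using
    (hjoint 1).continuous_comp (continuous_apply 0)

theorem mainTheorem6
    -- the weights
    (θ κ : ℕ → ℝ≥0)
    (hκ_nonarith : ∀ d : ℕ, 1 < d → ∃ j : ℕ, 1 ≤ j ∧ κ j ≠ 0 ∧ ¬ d ∣ j)
    (hκ_nondeg : ∃ j : ℕ, 2 ≤ j ∧ 0 < κ j)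
    -- both generating functions have radius of convergence `R` and extend to `Δ₀`
    (R η φ : ℝ) (hR : 0 < R) (hη : 0 < η) (hφ : 0 < φ) (hφ' : φ < Real.pi / 2)
    (hθ_radius : (genSeries θ).radius = ENNReal.ofReal R)
    (hκ_radius : (genSeries κ).radius = ENNReal.ofReal R)
    (gθ gκ : ℂ → ℂ)
    (hgθ : ∀ z : ℂ, ‖z‖ < R → gθ z = (genSeries θ).sum z)
    (hgκ : ∀ z : ℂ, ‖z‖ < R → gκ z = (genSeries κ).sum z)
    (hgθ_holo : DifferentiableOn ℂ gθ (domainDelta R η φ))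
    (hgκ_holo : DifferentiableOn ℂ gκ (domainDelta R η φ))
    -- `c n` is the left limit at `R` of the modified derivative of order `n < s`;
    -- for `n > s` that limit is infinite
    (s : ℝ) (hs : 1 < s) (hs_nonint : ∀ k : ℤ, s ≠ k)
    (c : ℕ → ℝ)
    (hc : ∀ n : ℕ, (n : ℝ) < s →
      Tendsto (fun r : ℝ => modDeriv gκ n (r : ℂ)) (𝓝[<] R) (𝓝 (c n : ℂ)))
    (hc_top : ∀ n : ℕ, s < n →
      Tendsto (fun r : ℝ => (modDeriv gκ n (r : ℂ)).re) (𝓝[<] R) atTop)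
    -- the supercritical case
    (hsuper : c 1 < 1)
    -- asymptotics of the generating functions at `R`
    (θs : ℝ) (hθs : 0 < θs) (δ : ℝ) (hδ : 0 < δ)
    (hgθ_as : (fun z : ℂ => gθ z - -(θs : ℂ) * Complex.log (1 - z / R))
      =O[𝓝[domainDelta R η φ] (R : ℂ)] fun z : ℂ => ‖1 - z / R‖ ^ δ)
    (hgκ_as : (fun z : ℂ => gκ z - ((c 0 : ℂ) - (c 1 : ℂ) * (1 - z / R)))
      =O[𝓝[domainDelta R η φ] (R : ℂ)] fun z : ℂ => ‖1 - z / R‖ ^ (1 + δ))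
    -- asymptotics of the modified derivatives at `R`
    (a : ℝ) (ha : a ≠ 0)
    (hgκ_low : ∀ n : ℕ, (n : ℝ) < s → ∃ d : ℝ, 0 < d ∧
      (fun z : ℂ => modDeriv gκ n z - (c n : ℂ))
        =O[𝓝[domainDelta R η φ] (R : ℂ)] fun z : ℂ => ‖1 - z / R‖ ^ d)
    (hgκ_high : ∀ n : ℕ, s < n → ∃ d : ℝ, 0 < d ∧
      (fun z : ℂ => modDeriv gκ n z -
          ((Real.Gamma (-s + n) * a / Real.Gamma (-s) : ℝ) : ℂ) * (1 - z / R) ^ ((s - n : ℝ) : ℂ))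
        =O[𝓝[domainDelta R η φ] (R : ℂ)] fun z : ℂ => ‖1 - z / R‖ ^ (s - n + d))
    (hgθ_deriv : ∀ n : ℕ, 1 ≤ n → ∃ d : ℝ, 0 < d ∧
      (fun z : ℂ => modDeriv gθ n z - (θs : ℂ) * ((n - 1).factorial : ℂ) / (1 - z / R) ^ n)
        =O[𝓝[domainDelta R η φ] (R : ℂ)] fun z : ℂ => ‖1 - z / R‖ ^ (-(n : ℝ) + d))
    -- the limiting fraction of points in long cycles
    (ν : ℝ) (hν : ν = 1 - c 1)
    -- the variables that drive the stick-breaking process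
    {Ω : Type*} [MeasurableSpace Ω] (P : Measure Ω) [IsProbabilityMeasure P]
    (U B : ℕ → Ω → ℝ)
    (hU : ∀ n, HasLaw (U n) (volume.restrict (Set.Icc (0 : ℝ) 1)) P)
    (hB : ∀ n, HasLaw (B n) (betaMeasure 1 θs) P)
    (hindep : iIndepFun (Sum.elim U B) P) :
    -- the measures are eventually well defined
    (∀ᶠ N : ℕ in atTop, 0 < normConst θ κ N) ∧
    -- `ν` is the limiting expected fraction of points in long cycles
    0 < ν ∧
    Tendsto (longFraction θ κ) atTop (𝓝 ν) ∧
    -- joint convergence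
    (∀ m : ℕ, TendstoInDistribution
      (fun (N : ℕ) (σ : Equiv.Perm (Fin N)) (i : Fin m) =>
        1 / ((N : ℝ) * ν) * (lexLength σ (i : ℕ) : ℝ))
      atTop
      (fun (ω : Ω) (i : Fin m) => stickX ν (fun n => U n ω) (fun n => B n ω) (i : ℕ))
      (fun N : ℕ => surrogateMeasure θ κ N) P) ∧
    -- the first cycle
    TendstoInDistribution
      (fun (N : ℕ) (σ : Equiv.Perm (Fin N)) => (lexLength σ 0 : ℝ) / ((N : ℝ) * ν))
      atTop
      (fun ω : Ω => stickX ν (fun n => U n ω) (fun n => B n ω) 0)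
      (fun N : ℕ => surrogateMeasure θ κ N) P ∧
    P.map (fun ω : Ω => stickX ν (fun n => U n ω) (fun n => B n ω) 0) =
      ENNReal.ofReal (1 - ν) • Measure.dirac (0 : ℝ) +
        (volume.restrict (Set.Ioo (0 : ℝ) 1)).withDensity
          (fun x => ENNReal.ofReal (ν * θs * (1 - x) ^ (θs - 1))) :=
  mainTheorem6_general hR
    (supercritical_scaled ⟨hR, hη, hφ, hφ', hθ_radius.ge, hgθ, hgθ_holo⟩
      ⟨hR, hη, hφ, hφ', hκ_radius.ge, hgκ, hgκ_holo⟩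
      (hκ_nondeg.imp fun _ hj => ⟨by omega, hj.2⟩) hs hsuper hθs
      (hc 1 (by exact_mod_cast hs)) hgκ_high hgθ_deriv)
    hν hU hB hindep
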